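/- **Conventions.** Let $\square$ be the category with objects $[1]^n=\{0,1\}^n$, $n\ge 0$, whose morphisms are the maps of posets generated under composition by the faces $\partial_{i,\varepsilon}\colon[1]^{n}\to[1]^{n+1}$ (insert the constant $\varepsilon\in\{0,1\}$ as $i$-th coordinate), the degeneracies $\sigma_i\colon[1]^{n+1}\to[1]^{n}$ (omit the $i$-th coordinate) and the connections $\gamma_{i,\varepsilon}\colon[1]^{n+2}\to[1]^{n+1}$ (replace the $i$-th and $(i+1)$-st coordinates by their maximum, respectively their minimum). It is monoidal with $[1]^m\otimes[1]^n=[1]^{m+n}$. A *cubical set* is a presheaf on $\square$; cubical sets carry the geometric product $\otimes$, the Day convolution of the monoidal structure of $\square$; cubes $x\in X_k$, $y\in Y_l$ determine a cube $x\otimes y\in (X\otimes Y)_{k+l}$. A *marked cubical set* is a cubical set together with a set of marked cubes of positive dimension containing all degenerate cubes (those of the form $z\sigma_i$ or $z\gamma_{i,\varepsilon}$); maps preserve marked cubes. Write $\mathsf{cSet}^+$ for this category. The *lax Gray tensor product* $X\otimes Y$ of marked cubical sets is the geometric product in which, besides the degenerate cubes, the cubes $x\otimes y$ with $x$ marked or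 $y$ marked are marked; its unit is the minimally marked $0$-cube. A *marked simplicial set* is a simplicial set with a set of marked simplices of positive dimension containing all degenerate ones; maps preserve marked simplices. The *(lax) Gray tensor product* $X\otimes Y$ is the cartesian product of the underlying simplicial sets in which an $n$-simplex $(x,y)$ is marked if and only if for all $p+q=n$ the front $p$-face of $x$ is marked or the back $q$-face of $y$ is marked. For $n\ge 2$ and $0\le k\le n$ let $\Delta^n_k$ be $\Delta^n$ in which, besides the degenerate simplices, those whose image contains $\{k-1,k,k+1\}\cap[n]$ are marked; let $\Delta^{n\prime}_k$ be obtained from it by marking also the $(n-1)$-dimensional faces opposite to the vertices $i\ne k$, and $\Delta^{n\prime\prime}_k$ by marking all $(n-1)$-dimensional faces. A *pre-complicial set* is a marked simplicial set with the right lifting property with respect to all inclusions $\Delta^{n\prime}_k\to\Delta^{n\prime\prime}_k$. Pre-complicial sets form a reflective full subcategory $\mathsf{PreComp}$ of marked simplicial sets that is closed under $\otimes$ and contains its unit $\Delta^0$ and the minimally marked $\Delta^1$. Simplices of $(\Delta^1)^{\otimes n}$ are identified with monotone maps $[m]\to\{0,1\}^n$; acting on such maps by composition makes $[1]^n\mapsto(\Delta^1)^{\otimes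 n}$ a functor $\square\to\mathsf{PreComp}$. For $n\ge 1$ let $T(\widetilde\square{}^n)$ be $(\Delta^1)^{\otimes n}$ with all simplices of dimension $\geq n$ marked in addition. The *triangulation* $T\colon\mathsf{cSet}^+\to\mathsf{PreComp}$ is the left adjoint so determined: $T(X)$ is the pre-complicial reflection of the colimit of the $(\Delta^1)^{\otimes n}$ over the $n$-cubes of $X$ and of the $T(\widetilde\square{}^n)$ over the marked $n$-cubes of $X$. Its simplices are classes $[x,\varphi]$ with $x\in X_n$ and $\varphi$ a simplex of $(\Delta^1)^{\otimes n}$. Its right adjoint $U$ has $U(Y)_n=\mathsf{PreComp}((\Delta^1)^{\otimes n},Y)$, where for $n\ge1$ an $n$-cube is marked if and only if it extends to $T(\widetilde\square{}^n)$. **Theorem.** The adjunction $T\dashv U$ is monoidal with respect to the lax Gray tensor products on $\mathsf{cSet}^+$ and $\mathsf{PreComp}$; equivalently, $T\colon(\mathsf{cSet}^+,\otimes)\to(\mathsf{PreComp},\otimes)$ is strong monoidal. That is, $T$ carries a strong monoidal structure and $U$ a lax monoidal structure for which $T\dashv U$ is a monoidal adjunction. The comparison isomorphism $T(X)\otimes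 T(Y)\cong T(X\otimes Y)$ is the canonical one, given on simplices by $$([x,\varphi],[y,\psi])\longmapsto[x\otimes y,(\varphi,\psi)]$$ for $x\in X_k$, $y\in Y_l$ and $m$-simplices $\varphi$ of $(\Delta^1)^{\otimes k}$ and $\psi$ of $(\Delta^1)^{\otimes l}$. -/

import Mathlib

open CategoryTheory Opposite
open MonoidalCategory DayFunctor

universe u

/-- The face map `[1]ⁿ → [1]ⁿ⁺¹` inserting the constant `ε` as the coordinate of (0-based) index `i`. -/
def boxFace {n : ℕ} (i : Fin (n + 1)) (ε : Bool) (x : Fin n → Bool) (j : Fin (n + 1)) : Bool :=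
  if h : (j : ℕ) < i then x ⟨j, by omega⟩ else if h' : (j : ℕ) = i then ε else x ⟨j - 1, by omega⟩

/-- The degeneracy `[1]ⁿ⁺¹ → [1]ⁿ` omitting the coordinate of index `i`. -/
def boxDegeneracy {n : ℕ} (i : Fin (n + 1)) (x : Fin (n + 1) → Bool) (j : Fin n) : Bool :=
  if (j : ℕ) < i then x ⟨j, by omega⟩ else x ⟨j + 1, by omega⟩

/-- The connection `[1]ⁿ⁺² → [1]ⁿ⁺¹` replacing the coordinates of index `i` and `i + 1` by their
maximum (`ε = true`) or their minimum (`ε = false`). -/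
def boxConnection {n : ℕ} (i : Fin (n + 1)) (ε : Bool) (x : Fin (n + 2) → Bool)
    (j : Fin (n + 1)) : Bool :=
  if (j : ℕ) < i then x ⟨j, by omega⟩
  else if (j : ℕ) = i then
    (if ε then max (x ⟨i, by omega⟩) (x ⟨i + 1, by omega⟩)
      else min (x ⟨i, by omega⟩) (x ⟨i + 1, by omega⟩))
  else x ⟨j + 1, by omega⟩

/-- The maps of the box category: the smallest class of maps between the posets `{0,1}ⁿ` that
contains identities, faces, degeneracies and both kinds of connections and is closed under
composition. -/
inductive IsBoxMap : {m n : ℕ} → ((Fin m → Bool) → (Fin n → Bool)) → Prop where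
  | id (n : ℕ) : IsBoxMap (fun x : Fin n → Bool => x)
  | comp {l m n : ℕ} {f : (Fin l → Bool) → (Fin m → Bool)} {g : (Fin m → Bool) → (Fin n → Bool)} :
      IsBoxMap f → IsBoxMap g → IsBoxMap (fun x => g (f x))
  | face {n : ℕ} (i : Fin (n + 1)) (ε : Bool) : IsBoxMap (boxFace i ε)
  | degeneracy {n : ℕ} (i : Fin (n + 1)) : IsBoxMap (boxDegeneracy i)
  | connection {n : ℕ} (i : Fin (n + 1)) (ε : Bool) : IsBoxMap (boxConnection i ε)

/-- The elementary degenerating maps: degeneracies and connections. -/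
inductive IsElemEpi : {m n : ℕ} → ((Fin m → Bool) → (Fin n → Bool)) → Prop where
  | degeneracy {n : ℕ} (i : Fin (n + 1)) : IsElemEpi (boxDegeneracy i)
  | connection {n : ℕ} (i : Fin (n + 1)) (ε : Bool) : IsElemEpi (boxConnection i ε)

lemma IsElemEpi.isBoxMap {m n : ℕ} {f : (Fin m → Bool) → (Fin n → Bool)} (hf : IsElemEpi f) :
    IsBoxMap f := by
  cases hf
  · exact .degeneracy _
  · exact .connection _ _

/-- Reindexing along an equality of dimensions is a map of the box category. -/
lemma IsBoxMap.cast {m n : ℕ} (h : n = m) :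
    IsBoxMap (fun (x : Fin m → Bool) i => x (Fin.cast h i)) := by
  subst h; exact .id _

lemma IsBoxMap.face' {m n : ℕ} (h : n = m + 1) (i : ℕ) (hi : i < n) (ε : Bool)
    (f : (Fin m → Bool) → (Fin n → Bool))
    (hf : ∀ x (j : Fin n), f x j = if h : (j : ℕ) < i then x ⟨j, by omega⟩ else
      if h' : (j : ℕ) = i then ε else x ⟨j - 1, by omega⟩) : IsBoxMap f := by
  subst h
  have : f = boxFace ⟨i, hi⟩ ε := by
    funext x j
    exact hf x j
  rw [this]
  exact .face _ _

lemma IsElemEpi.degeneracy' {m n : ℕ} (h : m = n + 1) (i : ℕ) (hi : i < m)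
    (f : (Fin m → Bool) → (Fin n → Bool))
    (hf : ∀ x (j : Fin n), f x j = if (j : ℕ) < i then x ⟨j, by omega⟩ else x ⟨j + 1, by omega⟩) :
    IsElemEpi f := by
  subst h
  have : f = boxDegeneracy ⟨i, hi⟩ := by
    funext x j
    exact hf x j
  rw [this]
  exact .degeneracy _

lemma IsElemEpi.connection' {m n : ℕ} (h : m = n + 1) (i : ℕ) (hi : i < n) (ε : Bool)
    (f : (Fin m → Bool) → (Fin n → Bool))
    (hf : ∀ x (j : Fin n), f x j = if (j : ℕ) < i then x ⟨j, by omega⟩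
      else if (j : ℕ) = i then
        (if ε then max (x ⟨i, by omega⟩) (x ⟨i + 1, by omega⟩)
          else min (x ⟨i, by omega⟩) (x ⟨i + 1, by omega⟩))
      else x ⟨j + 1, by omega⟩) : IsElemEpi f := by
  subst h
  obtain ⟨n, rfl⟩ : ∃ n', n = n' + 1 := ⟨n - 1, by omega⟩
  have : f = boxConnection ⟨i, hi⟩ ε := by
    funext x j
    exact hf x j
  rw [this]
  exact .connection _ _

/-- The product `f × g` of two maps, under `{0,1}ᵖ × {0,1}^q = {0,1}^(p + q)` (the coordinates of the
left factor come first). -/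
def boxTensor {m n m' n' : ℕ} (f : (Fin m → Bool) → (Fin n → Bool))
    (g : (Fin m' → Bool) → (Fin n' → Bool)) (x : Fin (m + m') → Bool) (j : Fin (n + n')) : Bool :=
  if h : (j : ℕ) < n then f (fun i => x ⟨i, by omega⟩) ⟨j, h⟩
  else g (fun i => x ⟨m + i, by omega⟩) ⟨j - n, by omega⟩

lemma boxTensor_id (m m' : ℕ) :
    boxTensor (fun x : Fin m → Bool => x) (fun x : Fin m' → Bool => x) = fun x => x := by
  funext x j
  simp only [boxTensor]
  split_ifs with h
  · rfl
  · congr; omega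

lemma boxTensor_comp {l m n l' m' n' : ℕ} (f : (Fin l → Bool) → (Fin m → Bool))
    (g : (Fin m → Bool) → (Fin n → Bool)) (f' : (Fin l' → Bool) → (Fin m' → Bool))
    (g' : (Fin m' → Bool) → (Fin n' → Bool)) :
    boxTensor (fun x => g (f x)) (fun x => g' (f' x)) =
      fun x => boxTensor g g' (boxTensor f f' x) := by
  funext x j
  simp only [boxTensor]
  split_ifs with h
  · congr; funext i; simp
  · congr; funext i; simp

lemma IsElemEpi.tensor_id {m n : ℕ} {f : (Fin m → Bool) → (Fin n → Bool)} (hf : IsElemEpi f)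
    (k : ℕ) : IsElemEpi (boxTensor f (fun x : Fin k → Bool => x)) := by
  cases hf with
  | @degeneracy n i =>
    refine .degeneracy' (by omega) i (by omega) _ fun x j => ?_
    simp only [boxTensor, boxDegeneracy]
    split_ifs <;> first | omega | rfl | (congr 2; omega)
  | @connection n i ε =>
    refine .connection' (by omega) i (by omega) ε _ fun x j => ?_
    simp only [boxTensor, boxConnection]
    split_ifs <;> first | omega | rfl | (congr 2; omega)

lemma IsElemEpi.id_tensor {m n : ℕ} {f : (Fin m → Bool) → (Fin n → Bool)} (hf : IsElemEpi f)
    (k : ℕ) : IsElemEpi (boxTensor (fun x : Fin k → Bool => x) f) := by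
  cases hf with
  | @degeneracy n i =>
    refine .degeneracy' (by omega) (k + i) (by omega) _ fun x j => ?_
    simp only [boxTensor, boxDegeneracy]
    split_ifs <;> first | omega | rfl | (congr 2; omega)
  | @connection n i ε =>
    refine .connection' (by omega) (k + i) (by omega) ε _ fun x j => ?_
    simp only [boxTensor, boxConnection]
    split_ifs <;> first | omega | rfl | (congr 2; omega)

lemma IsBoxMap.tensor_id {m n : ℕ} {f : (Fin m → Bool) → (Fin n → Bool)} (hf : IsBoxMap f) (k : ℕ) :
    IsBoxMap (boxTensor f (fun x : Fin k → Bool => x)) := by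
  induction hf with
  | id n => rw [boxTensor_id]; exact .id _
  | comp _ _ hf hg =>
    rw [boxTensor_comp _ _ (fun x => x) (fun x => x)]
    exact hf.comp hg
  | @face n i ε =>
    refine .face' (by omega) i (by omega) ε _ fun x j => ?_
    simp only [boxTensor, boxFace]
    split_ifs <;> first | omega | rfl | (congr 2; omega)
  | degeneracy i => exact ((IsElemEpi.degeneracy i).tensor_id k).isBoxMap
  | connection i ε => exact ((IsElemEpi.connection i ε).tensor_id k).isBoxMap

lemma IsBoxMap.id_tensor {m n : ℕ} {f : (Fin m → Bool) → (Fin n → Bool)} (hf : IsBoxMap f) (k : ℕ) :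
    IsBoxMap (boxTensor (fun x : Fin k → Bool => x) f) := by
  induction hf with
  | id n => rw [boxTensor_id]; exact .id _
  | comp _ _ hf hg =>
    rw [boxTensor_comp (fun x => x) (fun x => x)]
    exact hf.comp hg
  | @face n i ε =>
    refine .face' (by omega) (k + i) (by omega) ε _ fun x j => ?_
    simp only [boxTensor, boxFace]
    split_ifs <;> first | omega | rfl | (congr 2; omega)
  | degeneracy i => exact ((IsElemEpi.degeneracy i).id_tensor k).isBoxMap
  | connection i ε => exact ((IsElemEpi.connection i ε).id_tensor k).isBoxMap

lemma IsBoxMap.tensor {m n m' n' : ℕ} {f : (Fin m → Bool) → (Fin n → Bool)}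
    {g : (Fin m' → Bool) → (Fin n' → Bool)} (hf : IsBoxMap f) (hg : IsBoxMap g) :
    IsBoxMap (boxTensor f g) := by
  have := (hf.tensor_id m').comp (hg.id_tensor n)
  rwa [← boxTensor_comp f (fun x => x) (fun x => x) g] at this

/-- every box map into a tensor product decomposes -/
lemma IsBoxMap.exists_tensor {m n : ℕ} {f : (Fin m → Bool) → (Fin n → Bool)} (hf : IsBoxMap f)
    {k l : ℕ} (h : k + l = n) : ∃ (m₁ m₂ : ℕ) (h' : m₁ + m₂ = m)
      (f₁ : (Fin m₁ → Bool) → (Fin k → Bool)) (f₂ : (Fin m₂ → Bool) → (Fin l → Bool)),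
      IsBoxMap f₁ ∧ IsBoxMap f₂ ∧
        f = fun x j => boxTensor f₁ f₂ (fun i => x (Fin.cast h' i)) (Fin.cast h.symm j) := by
  induction hf generalizing k l with
  | id n =>
    refine ⟨k, l, h, _, _, .id _, .id _, ?_⟩
    rw [boxTensor_id]
    rfl
  | comp _ _ hf hg =>
    obtain ⟨m₁, m₂, h', g₁, g₂, hg₁, hg₂, rfl⟩ := hg h
    obtain ⟨l₁, l₂, h'', f₁, f₂, hf₁, hf₂, rfl⟩ := hf h'
    refine ⟨l₁, l₂, h'', _, _, hf₁.comp hg₁, hf₂.comp hg₂, ?_⟩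
    subst h'
    rw [boxTensor_comp f₁ g₁ f₂ g₂]
    rfl
  | @face n i ε =>
    by_cases hi : (i : ℕ) < k
    · obtain ⟨k, rfl⟩ : ∃ k', k = k' + 1 := ⟨k - 1, by omega⟩
      refine ⟨k, l, by omega, _, _, .face ⟨i, hi⟩ ε, .id _, ?_⟩
      funext x j
      simp only [boxTensor, boxFace, Fin.val_cast]
      split_ifs <;> first | omega | rfl | (congr 1; ext; simp; omega)
    · obtain ⟨l, rfl⟩ : ∃ l', l = l' + 1 := ⟨l - 1, by omega⟩
      refine ⟨k, l, by omega, _, _, .id _, .face ⟨i - k, by omega⟩ ε, ?_⟩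
      funext x j
      simp only [boxTensor, boxFace, Fin.val_cast]
      split_ifs <;> first | omega | rfl | (congr 1; ext; simp; omega)
  | @degeneracy n i =>
    by_cases hi : (i : ℕ) < k + 1
    · refine ⟨k + 1, l, by omega, _, _, .degeneracy ⟨i, hi⟩, .id _, ?_⟩
      funext x j
      simp only [boxTensor, boxDegeneracy, Fin.val_cast]
      split_ifs <;> first | omega | rfl | (congr 1; ext; simp; omega)
    · refine ⟨k, l + 1, by omega, _, _, .id _, .degeneracy ⟨i - k, by omega⟩, ?_⟩
      funext x j
      simp only [boxTensor, boxDegeneracy, Fin.val_cast]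
      split_ifs <;> first | omega | rfl | (congr 1; ext; simp; omega)
  | @connection n i ε =>
    by_cases hi : (i : ℕ) < k
    · obtain ⟨k, rfl⟩ : ∃ k', k = k' + 1 := ⟨k - 1, by omega⟩
      refine ⟨k + 2, l, by omega, _, _, .connection ⟨i, hi⟩ ε, .id _, ?_⟩
      funext x j
      simp only [boxTensor, boxConnection, Fin.val_cast]
      split_ifs <;> first | omega | rfl | (congr 1; ext; simp; omega)
    · obtain ⟨l, rfl⟩ : ∃ l', l = l' + 1 := ⟨l - 1, by omega⟩
      refine ⟨k, l + 2, by omega, _, _, .id _, .connection ⟨i - k, by omega⟩ ε, ?_⟩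
      funext x j
      simp only [boxTensor, boxConnection, Fin.val_cast]
      split_ifs <;> first | omega | rfl | (congr 1; ext; simp; omega) | (congr 2 <;> ext <;> simp <;> omega)

lemma boxFun_congr {m n : ℕ} (f : (Fin m → Bool) → (Fin n → Bool)) {x y : Fin m → Bool}
    {i j : Fin n} (h : ∀ k, x k = y k) (hij : (i : ℕ) = j) : f x i = f y j := by
  obtain rfl : x = y := funext h
  obtain rfl : i = j := Fin.ext hij
  rfl

lemma boxTensor_assoc {m₁ n₁ m₂ n₂ m₃ n₃ : ℕ} (f : (Fin m₁ → Bool) → (Fin n₁ → Bool))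
    (g : (Fin m₂ → Bool) → (Fin n₂ → Bool)) (h : (Fin m₃ → Bool) → (Fin n₃ → Bool))
    (x : Fin (m₁ + m₂ + m₃) → Bool) (j : Fin (n₁ + (n₂ + n₃))) :
    boxTensor (boxTensor f g) h x (Fin.cast (Nat.add_assoc _ _ _).symm j) =
      boxTensor f (boxTensor g h) (fun i => x (Fin.cast (Nat.add_assoc _ _ _).symm i)) j := by
  simp only [boxTensor, Fin.val_cast]
  split_ifs <;> first
    | omega
    | refine boxFun_congr _ (fun k => congrArg x (Fin.ext ?_)) ?_ <;> simp <;> omega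

lemma boxTensor_zero_left {m n : ℕ} (f : (Fin m → Bool) → (Fin n → Bool))
    (x : Fin (0 + m) → Bool) (j : Fin n) :
    boxTensor (fun x : Fin 0 → Bool => x) f x (Fin.cast (Nat.zero_add _).symm j) =
      f (fun i => x (Fin.cast (Nat.zero_add _).symm i)) j := by
  simp only [boxTensor, Fin.val_cast]
  split_ifs
  · omega
  · exact boxFun_congr _ (fun k => congrArg x (Fin.ext (by simp))) (by simp)

lemma boxTensor_zero_right {m n : ℕ} (f : (Fin m → Bool) → (Fin n → Bool))
    (x : Fin (m + 0) → Bool) (j : Fin n) :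
    boxTensor f (fun x : Fin 0 → Bool => x) x (Fin.cast (Nat.add_zero _).symm j) =
      f (fun i => x (Fin.cast (Nat.add_zero _).symm i)) j := by
  simp only [boxTensor, Fin.val_cast]
  split_ifs
  · rfl
  · omega

lemma boxTensor_pentagon (a b c d : ℕ) (x : Fin (a + b + c + d) → Bool)
    (j : Fin (a + (b + (c + d)))) :
    boxTensor (fun x : Fin a → Bool => x)
      (fun (x : Fin (b + c + d) → Bool) (i : Fin (b + (c + d))) =>
        x (Fin.cast (Nat.add_assoc _ _ _).symm i))
      (fun i => boxTensor (fun (x : Fin (a + b + c) → Bool) (i : Fin (a + (b + c))) =>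
        x (Fin.cast (Nat.add_assoc _ _ _).symm i)) (fun x : Fin d → Bool => x) x
          (Fin.cast (Nat.add_assoc _ _ _).symm i)) j =
      x (Fin.cast (Nat.add_assoc _ _ _).symm (Fin.cast (Nat.add_assoc _ _ _).symm j)) := by
  simp only [boxTensor, Fin.val_cast, Fin.cast_mk]
  split_ifs <;> first
    | omega
    | refine congrArg x (Fin.ext ?_); simp; done
    | refine congrArg x (Fin.ext ?_); simp; omega

lemma boxTensor_triangle (a b : ℕ) (x : Fin (a + 0 + b) → Bool) (j : Fin (a + b)) :
    boxTensor (fun x : Fin a → Bool => x)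
      (fun (x : Fin (0 + b) → Bool) (i : Fin b) => x (Fin.cast (Nat.zero_add _).symm i))
      (fun i => x (Fin.cast (Nat.add_assoc _ _ _).symm i)) j =
    boxTensor (fun (x : Fin (a + 0) → Bool) (i : Fin a) => x (Fin.cast (Nat.add_zero _).symm i))
      (fun x : Fin b → Bool => x) x j := by
  simp only [boxTensor, Fin.val_cast, Fin.cast_mk]
  split_ifs
  · rfl
  · refine congrArg x (Fin.ext ?_); simp

/-- The objects `[1]ⁿ` of the box category; `dim` is `n`. -/
structure Box where
  dim : ℕ

namespace Box

/-- A morphism of the box category. -/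
@[ext]
structure Hom (a b : Box) where
  toFun : (Fin a.dim → Bool) → (Fin b.dim → Bool)
  isBoxMap : IsBoxMap toFun

instance : Category Box where
  Hom := Hom
  id a := ⟨fun x => x, .id _⟩
  comp f g := ⟨fun x => g.toFun (f.toFun x), f.isBoxMap.comp g.isBoxMap⟩

lemma hom_ext {a b : Box} {f g : a ⟶ b} (h : ∀ x j, f.toFun x j = g.toFun x j) : f = g :=
  Hom.ext (funext fun x => funext fun j => h x j)

@[simp] lemma id_toFun (a : Box) (x : Fin a.dim → Bool) : Hom.toFun (𝟙 a) x = x := rfl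
@[simp] lemma comp_toFun {a b c : Box} (f : a ⟶ b) (g : b ⟶ c) (x : Fin a.dim → Bool) :
    (f ≫ g).toFun x = g.toFun (f.toFun x) := rfl

/-- The identity isomorphism between cubes of equal dimension. -/
def castIso {m n : ℕ} (h : m = n) : (⟨m⟩ : Box) ≅ ⟨n⟩ where
  hom := ⟨fun x i => x (Fin.cast h.symm i), .cast h.symm⟩
  inv := ⟨fun x i => x (Fin.cast h i), .cast h⟩

/-- The tensor product `[1]ᵐ ⊗ [1]ⁿ = [1]ᵐ⁺ⁿ`. -/
def tensor (a b : Box) : Box := ⟨a.dim + b.dim⟩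

/-- The tensor product of two morphisms. -/
def tensorMap {a b a' b' : Box} (f : a ⟶ b) (g : a' ⟶ b') : tensor a a' ⟶ tensor b b' :=
  ⟨boxTensor f.toFun g.toFun, f.isBoxMap.tensor g.isBoxMap⟩

instance : MonoidalCategoryStruct Box where
  tensorObj := tensor
  tensorHom := tensorMap
  whiskerLeft a _ _ f := tensorMap (𝟙 a) f
  whiskerRight f a := tensorMap f (𝟙 a)
  tensorUnit := ⟨0⟩
  associator a b c := castIso (Nat.add_assoc a.dim b.dim c.dim)
  leftUnitor a := castIso (Nat.zero_add a.dim)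
  rightUnitor a := castIso (Nat.add_zero a.dim)

lemma tensorHom_toFun {a b a' b' : Box} (f : a ⟶ b) (g : a' ⟶ b') :
    (f ⊗ₘ g).toFun = boxTensor f.toFun g.toFun := rfl

@[simp] lemma tensorUnit_dim : (𝟙_ Box).dim = 0 := rfl
@[simp] lemma tensorObj_dim (a b : Box) : (a ⊗ b).dim = a.dim + b.dim := rfl

instance : MonoidalCategory Box := MonoidalCategory.ofTensorHom
  (id_tensorHom_id := fun a b => Hom.ext (boxTensor_id _ _))
  (id_tensorHom := fun _ _ _ _ => rfl)
  (tensorHom_id := fun _ _ => rfl)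
  (tensorHom_comp_tensorHom := fun f₁ f₂ g₁ g₂ =>
    (Hom.ext (boxTensor_comp f₁.toFun g₁.toFun f₂.toFun g₂.toFun)).symm)
  (associator_naturality := fun f g h =>
    hom_ext fun x j => boxTensor_assoc f.toFun g.toFun h.toFun x j)
  (leftUnitor_naturality := fun f => hom_ext fun x j => boxTensor_zero_left f.toFun x j)
  (rightUnitor_naturality := fun f => hom_ext fun x j => boxTensor_zero_right f.toFun x j)
  (pentagon := fun a b c d =>
    hom_ext fun x j => boxTensor_pentagon a.dim b.dim c.dim d.dim x j)
  (triangle := fun a b => hom_ext fun x j => boxTensor_triangle a.dim b.dim x j)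

end Box

section
open Simplicial

/-- A marked simplicial set: a simplicial set with a set of marked simplices of positive dimension
containing all degenerate ones. -/
structure MarkedSSet where
  toSSet : SSet.{u}
  marked (n : ℕ) : Set (toSSet _⦋n⦌)
  not_marked_zero (x : toSSet _⦋0⦌) : x ∉ marked 0
  degenerate_le (n : ℕ) : toSSet.degenerate n ⊆ marked n

namespace MarkedSSet

/-- A map of marked simplicial sets is a simplicial map preserving marked simplices. -/
@[ext]
structure Hom (X Y : MarkedSSet.{u}) where
  map : X.toSSet ⟶ Y.toSSet
  map_marked (n : ℕ) (x : X.toSSet _⦋n⦌) (hx : x ∈ X.marked n) :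
    map.app (op ⦋n⦌) x ∈ Y.marked n

instance : Category MarkedSSet.{u} where
  Hom := Hom
  id X := ⟨𝟙 _, fun n x hx => by simpa using hx⟩
  comp f g := ⟨f.map ≫ g.map, fun n x hx => by
    simpa using g.map_marked n _ (f.map_marked n x hx)⟩

@[ext]
lemma hom_ext {X Y : MarkedSSet.{u}} {f g : X ⟶ Y} (h : f.map = g.map) : f = g :=
  Hom.ext h

@[simp] lemma id_map (X : MarkedSSet.{u}) : Hom.map (𝟙 X) = 𝟙 X.toSSet := rfl
@[simp] lemma comp_map {X Y Z : MarkedSSet.{u}} (f : X ⟶ Y) (g : Y ⟶ Z) :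
    (f ≫ g).map = f.map ≫ g.map := rfl

/-- The underlying simplicial set. -/
@[simps]
def forget : MarkedSSet.{u} ⥤ SSet.{u} where
  obj X := X.toSSet
  map f := f.map

instance : forget.{u}.Faithful where
  map_injective h := hom_ext h

/-- The minimal marking of a simplicial set: only degenerate simplices are marked. -/
def flat (X : SSet.{u}) : MarkedSSet.{u} where
  toSSet := X
  marked n := X.degenerate n
  not_marked_zero x := by simp
  degenerate_le n := le_rfl

/-- The `n`-truncation: all simplices of dimension `> n` are marked in addition. -/
def trunc (n : ℕ) (X : MarkedSSet.{u}) : MarkedSSet.{u} where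
  toSSet := X.toSSet
  marked m := {x | x ∈ X.marked m ∨ n < m}
  not_marked_zero x := by simpa using X.not_marked_zero x
  degenerate_le m x hx := Or.inl (X.degenerate_le m hx)

/-- The front face operator `[p] → [n]`, `i ↦ i`, for `p + q = n`. -/
def front {p q n : ℕ} (h : p + q = n) : ⦋p⦌ ⟶ ⦋n⦌ :=
  SimplexCategory.mkHom ⟨fun i => ⟨i, by omega⟩, fun i j hij => by simpa using hij⟩

/-- The back face operator `[q] → [n]`, `i ↦ p + i`, for `p + q = n`. -/
def back {p q n : ℕ} (h : p + q = n) : ⦋q⦌ ⟶ ⦋n⦌ :=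
  SimplexCategory.mkHom ⟨fun i => ⟨p + i, by omega⟩, fun i j hij => by simpa using hij⟩

/-- An isomorphism of simplicial sets that preserves and reflects markings. -/
def isoMk {X Y : MarkedSSet.{u}} (e : X.toSSet ≅ Y.toSSet)
    (h : ∀ n (x : X.toSSet _⦋n⦌), e.hom.app (op ⦋n⦌) x ∈ Y.marked n ↔ x ∈ X.marked n) : X ≅ Y where
  hom := ⟨e.hom, fun n x hx => (h n x).2 hx⟩
  inv := ⟨e.inv, fun n x hx => by
    rw [← h]
    simpa [← comp_apply, ← NatTrans.comp_app] using hx⟩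

/-- `(x, y)` is fully cloven if for every `p + q = n` the front `p`-face of `x` or the back `q`-face of
`y` is marked. -/
def FullyCloven (X Y : MarkedSSet.{u}) {n : ℕ} (x : X.toSSet _⦋n⦌) (y : Y.toSSet _⦋n⦌) : Prop :=
  ∀ (p q : ℕ) (h : p + q = n),
    X.toSSet.map (front h).op x ∈ X.marked p ∨ Y.toSSet.map (back h).op y ∈ Y.marked q

lemma front_zero_eq {n : ℕ} (h : n + 0 = n) : front h = 𝟙 _ := rfl
lemma back_zero_eq {n : ℕ} (h : 0 + n = n) : back h = 𝟙 _ := by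
  ext i; simp [back]

@[simp] lemma front_apply {p q n : ℕ} (h : p + q = n) (i : Fin (p + 1)) :
  ((front h).toOrderHom i : ℕ) = i := rfl
@[simp] lemma back_apply {p q n : ℕ} (h : p + q = n) (i : Fin (q + 1)) :
  ((back h).toOrderHom i : ℕ) = p + i := rfl

/-- A simplex `x ∘ g` with `g` noninjective is degenerate. -/
lemma map_mem_degenerate {X : SSet.{u}} {m n : ℕ} (g : ⦋m⦌ ⟶ ⦋n⦌) (hg : ¬ Function.Injective g)
    (x : X _⦋n⦌) : X.map g.op x ∈ X.degenerate m := by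
  cases m with
  | zero => exact absurd (Function.injective_of_subsingleton (α := Fin 1) _) hg
  | succ m =>
    obtain ⟨i, θ, rfl⟩ := SimplexCategory.eq_σ_comp_of_not_injective g hg
    exact ⟨m, by omega, SimplexCategory.σ i, X.map θ.op x, by simp⟩

lemma degenerate_iff {X : SSet.{u}} {m : ℕ} (x : X _⦋m⦌) :
    x ∈ X.degenerate m ↔ ∃ (n : ℕ) (g : ⦋m⦌ ⟶ ⦋n⦌) (_ : ¬ Function.Injective g) (y : X _⦋n⦌),
      X.map g.op y = x := by
  constructor
  · rintro ⟨n, h, g, y, rfl⟩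
    refine ⟨n, g, fun hg => ?_, y, rfl⟩
    have := Fintype.card_le_of_injective (α := Fin (m+1)) (β := Fin (n + 1)) _ hg
    simp at this
    omega
  · rintro ⟨n, g, hg, y, rfl⟩
    exact map_mem_degenerate g hg y

lemma not_injective_of_eq {m n : ℕ} (g : ⦋m⦌ ⟶ ⦋n⦌) {i j : Fin (m+1)} (hij : i ≠ j)
    (h : g.toOrderHom i = g.toOrderHom j) : ¬ Function.Injective g := fun hg => hij (hg h)


lemma σ_val {n : ℕ} (i : Fin (n + 1)) (a : Fin (n + 2)) :
    ((SimplexCategory.σ i).toOrderHom a : ℕ) = if (a : ℕ) ≤ i then (a : ℕ) else a - 1 := by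
  change ((i.predAbove a : Fin (n + 1)) : ℕ) = _
  simp only [Fin.predAbove, Fin.lt_def, Fin.val_castSucc]
  split_ifs <;> simp <;> omega

lemma comp_val {a b c : ℕ} (f : ⦋a⦌ ⟶ ⦋b⦌) (g : ⦋b⦌ ⟶ ⦋c⦌) (i : Fin (a + 1)) :
    ((f ≫ g).toOrderHom i) = g.toOrderHom (f.toOrderHom i) := rfl

lemma val_le {a b : ℕ} (f : ⦋a⦌ ⟶ ⦋b⦌) (i : Fin (a + 1)) : (f.toOrderHom i : ℕ) ≤ b :=
  Nat.le_of_lt_succ (f.toOrderHom i).2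

lemma hom_ext' {a b : ℕ} {f g : ⦋a⦌ ⟶ ⦋b⦌}
    (h : ∀ i : Fin (a + 1), (f.toOrderHom i : ℕ) = g.toOrderHom i) : f = g := by
  ext i
  exact h i

lemma back_comp_back {a b p q n : ℕ} (h : a + b = q) (h' : p + q = n) :
    (back h ≫ back h' : ⦋b⦌ ⟶ ⦋n⦌) = back (p := p + a) (by omega) :=
  hom_ext' fun i => by simp; omega

lemma fullyCloven_of_degenerate (X Y : MarkedSSet.{u}) {n : ℕ}
    (z : (X.toSSet ⊗ Y.toSSet : SSet.{u}) _⦋n⦌)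
    (hz : z ∈ (X.toSSet ⊗ Y.toSSet : SSet.{u}).degenerate n) : FullyCloven X Y z.1 z.2 := by
  cases n with
  | zero =>
    rw [SSet.degenerate_zero] at hz
    exact hz.elim
  | succ n =>
    rw [SSet.degenerate_eq_iUnion_range_σ] at hz
    simp only [Set.mem_iUnion, Set.mem_range] at hz
    obtain ⟨i, w, rfl⟩ := hz
    intro p q h
    by_cases hp : (i : ℕ) + 1 ≤ p
    · left
      apply X.degenerate_le
      change X.toSSet.map (front h).op (X.toSSet.map (SimplexCategory.σ i).op w.1) ∈ _
      rw [← Functor.map_comp_apply, ← op_comp]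
      refine map_mem_degenerate _ (not_injective_of_eq _ (i := ⟨i, by omega⟩)
        (j := ⟨i + 1, by omega⟩) (by simp) ?_) _
      simp [Fin.ext_iff, σ_val]
    · right
      apply Y.degenerate_le
      change Y.toSSet.map (back h).op (Y.toSSet.map (SimplexCategory.σ i).op w.2) ∈ _
      rw [← Functor.map_comp_apply, ← op_comp]
      refine map_mem_degenerate _ (not_injective_of_eq _ (i := ⟨i - p, by omega⟩)
        (j := ⟨i - p + 1, by omega⟩) (by simp) ?_) _
      have h1 : p + (i - p) = (i : ℕ) := by omega
      have h2 : p + (i - p + 1) = (i : ℕ) + 1 := by omega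
      simp [Fin.ext_iff, σ_val, h1, h2]

/-- The Gray tensor product: the cartesian product of the underlying simplicial sets, the marked
simplices being the fully cloven ones. -/
def gray (X Y : MarkedSSet.{u}) : MarkedSSet.{u} where
  toSSet := X.toSSet ⊗ Y.toSSet
  marked n := {z | FullyCloven X Y z.1 z.2}
  not_marked_zero z hz := by
    rcases hz 0 0 rfl with h | h
    · exact X.not_marked_zero _ h
    · exact Y.not_marked_zero _ h
  degenerate_le n z hz := fullyCloven_of_degenerate X Y z hz

lemma FullyCloven.map {X Y X' Y' : MarkedSSet.{u}} (f : X ⟶ X') (g : Y ⟶ Y') {n : ℕ}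
    {x : X.toSSet _⦋n⦌} {y : Y.toSSet _⦋n⦌} (h : FullyCloven X Y x y) :
    FullyCloven X' Y' (f.map.app _ x) (g.map.app _ y) := by
  intro p q hpq
  rw [← NatTrans.naturality_apply, ← NatTrans.naturality_apply]
  exact (h p q hpq).imp (f.map_marked _ _) (g.map_marked _ _)

/-- The Gray tensor product of two maps. -/
def grayMap {X Y X' Y' : MarkedSSet.{u}} (f : X ⟶ X') (g : Y ⟶ Y') : gray X Y ⟶ gray X' Y' where
  map := f.map ⊗ₘ g.map
  map_marked _ _ hz := FullyCloven.map f g hz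

lemma fullyCloven_assoc {X Y Z : MarkedSSet.{u}} {n : ℕ} (x : X.toSSet _⦋n⦌) (y : Y.toSSet _⦋n⦌)
    (z : Z.toSSet _⦋n⦌) :
    FullyCloven X (gray Y Z) x (y, z) ↔ FullyCloven (gray X Y) Z (x, y) z := by
  constructor
  · intro H p q h
    by_cases hz : Z.toSSet.map (back h).op z ∈ Z.marked q
    · exact Or.inr hz
    · left
      intro a b h'
      subst h'
      change X.toSSet.map (front rfl).op (X.toSSet.map (front h).op x) ∈ _ ∨
        Y.toSSet.map (back rfl).op (Y.toSSet.map (front h).op y) ∈ _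
      rcases H a (b + q) (by omega) with H | H
      · left
        rw [← Functor.map_comp_apply, ← op_comp]
        exact H
      · right
        rcases H b q rfl with H | H
        · change Y.toSSet.map (front _).op (Y.toSSet.map (back _).op y) ∈ _ at H
          rw [← Functor.map_comp_apply, ← op_comp] at H ⊢
          exact H
        · refine absurd ?_ hz
          change Z.toSSet.map (back _).op (Z.toSSet.map (back _).op z) ∈ _ at H
          rw [← Functor.map_comp_apply, ← op_comp] at H
          rw [back_comp_back] at H
          exact H
  · intro H p q h
    by_cases hx : X.toSSet.map (front h).op x ∈ X.marked p
    · exact Or.inl hx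
    · right
      intro a b h'
      change Y.toSSet.map (front h').op (Y.toSSet.map (back h).op y) ∈ _ ∨
        Z.toSSet.map (back h').op (Z.toSSet.map (back h).op z) ∈ _
      rcases H (p + a) b (by omega) with H | H
      · left
        rcases H p a rfl with H | H
        · refine absurd ?_ hx
          change X.toSSet.map (front _).op (X.toSSet.map (front _).op x) ∈ _ at H
          rw [← Functor.map_comp_apply, ← op_comp] at H
          exact H
        · change Y.toSSet.map (back _).op (Y.toSSet.map (front _).op y) ∈ _ at H
          rw [← Functor.map_comp_apply, ← op_comp] at H ⊢
          exact H
      · right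
        rw [← Functor.map_comp_apply, ← op_comp]
        rw [back_comp_back]
        exact H

/-- The unit of the Gray tensor product, the point. -/
def point : MarkedSSet.{u} := flat (𝟙_ SSet.{u})

lemma point_marked {n : ℕ} (x : (𝟙_ SSet.{u}) _⦋n + 1⦌) : x ∈ point.marked (n + 1) :=
  ⟨0, by omega, SimplexCategory.const _ _ 0, PUnit.unit, rfl⟩

lemma fullyCloven_point_left {X : MarkedSSet.{u}} {n : ℕ} (u : (𝟙_ SSet.{u}) _⦋n⦌)
    (x : X.toSSet _⦋n⦌) : FullyCloven point X u x ↔ x ∈ X.marked n := by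
  constructor
  · intro H
    rcases H 0 n (by omega) with H | H
    · exact absurd H (point.not_marked_zero _)
    · rwa [back_zero_eq, op_id, Functor.map_id_apply] at H
  · intro hx p q h
    cases p with
    | zero =>
      right
      obtain rfl : q = n := by omega
      rwa [back_zero_eq, op_id, Functor.map_id_apply]
    | succ p => exact Or.inl (point_marked _)

lemma fullyCloven_point_right {X : MarkedSSet.{u}} {n : ℕ} (u : (𝟙_ SSet.{u}) _⦋n⦌)
    (x : X.toSSet _⦋n⦌) : FullyCloven X point x u ↔ x ∈ X.marked n := by
  constructor
  · intro H
    rcases H n 0 (by omega) with H | H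
    · rwa [front_zero_eq, op_id, Functor.map_id_apply] at H
    · exact absurd H (point.not_marked_zero _)
  · intro hx p q h
    cases q with
    | zero =>
      left
      obtain rfl : p = n := by omega
      rwa [front_zero_eq, op_id, Functor.map_id_apply]
    | succ p => exact Or.inr (point_marked _)

instance : MonoidalCategoryStruct MarkedSSet.{u} where
  tensorObj := gray
  tensorHom := grayMap
  whiskerLeft X _ _ f := grayMap (𝟙 X) f
  whiskerRight f Y := grayMap f (𝟙 Y)
  tensorUnit := point
  associator X Y Z := isoMk (α_ X.toSSet Y.toSSet Z.toSSet)
    fun _ w => fullyCloven_assoc w.1.1 w.1.2 w.2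
  leftUnitor X := isoMk (λ_ X.toSSet) (fun _ w => (fullyCloven_point_left w.1 w.2).symm)
  rightUnitor X := isoMk (ρ_ X.toSSet) (fun _ w => (fullyCloven_point_right w.2 w.1).symm)

instance : MonoidalCategory MarkedSSet.{u} :=
  Monoidal.induced forget
    { μIso := fun X Y => Iso.refl _
      εIso := Iso.refl _
      whiskerLeft_eq := fun X _ _ f => by
        change (𝟙 X.toSSet ⊗ₘ f.map) = 𝟙 _ ≫ (X.toSSet ◁ f.map) ≫ 𝟙 _
        simp
      whiskerRight_eq := fun f Y => by
        change (f.map ⊗ₘ 𝟙 Y.toSSet) = 𝟙 _ ≫ (f.map ▷ Y.toSSet) ≫ 𝟙 _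
        simp
      tensorHom_eq := fun f g => by
        change (f.map ⊗ₘ g.map) = 𝟙 _ ≫ (f.map ⊗ₘ g.map) ≫ 𝟙 _
        simp
      associator_eq := fun X Y Z => by
        change (α_ X.toSSet Y.toSSet Z.toSSet).hom = _
        simp
        rfl
      leftUnitor_eq := fun X => by
        change (λ_ X.toSSet).hom = _
        simp
        rfl
      rightUnitor_eq := fun X => by
        change (ρ_ X.toSSet).hom = _
        simp
        rfl }

/-- The simplices of `Δ[n]` whose image contains `{k - 1, k, k + 1} ∩ [n]`. -/
def IsComplicialFace {n : ℕ} (k : Fin (n + 1)) {m : ℕ} (α : Δ[n] _⦋m⦌) : Prop :=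
  ∀ j : Fin (n + 1), (j : ℕ) ≤ k + 1 → (k : ℕ) ≤ j + 1 → j ∈ Set.range α

/-- The `k`-complicial `(n + 1)`-simplex. -/
def admDelta (n : ℕ) (k : Fin (n + 2)) : MarkedSSet.{u} where
  toSSet := Δ[n + 1]
  marked m := {α | α ∈ (Δ[n + 1] : SSet.{u}).degenerate m ∨ IsComplicialFace k α}
  not_marked_zero α hα := by
    rcases hα with hα | hα
    · simp at hα
    · obtain ⟨j, hj, h1, h2⟩ : ∃ j : Fin (n + 2), j ≠ k ∧ (j : ℕ) ≤ k + 1 ∧ (k : ℕ) ≤ j + 1 := by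
        by_cases hk : (k : ℕ) = 0
        · exact ⟨⟨1, by omega⟩, by simp [Fin.ext_iff, hk], by simp [hk], by simp [hk]⟩
        · exact ⟨⟨k - 1, by omega⟩, by simp [Fin.ext_iff]; omega, by simp; omega, by simp; omega⟩
      obtain ⟨a, ha⟩ := hα j h1 h2
      obtain ⟨b, hb⟩ := hα k (by omega) (by omega)
      rw [Subsingleton.elim (α := Fin 1) a b] at ha
      exact hj (ha.symm.trans hb)
  degenerate_le m α hα := Or.inl hα

/-- The source of the elementary complicial marking extension of dimension `n + 2`: the `k`-complicial
simplex with the faces of codimension one opposite to the vertices other than `k` marked as well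
(that is, with the horn `Λ[n + 2, k]` made `n`-trivial). -/
def admDelta' (n : ℕ) (k : Fin (n + 3)) : MarkedSSet.{u} where
  toSSet := Δ[n + 2]
  marked m := {α | α ∈ (admDelta (n + 1) k).marked m ∨ (α ∈ Λ[n + 2, k].obj (op ⦋m⦌) ∧ n < m)}
  not_marked_zero α hα := by
    rcases hα with hα | hα
    · exact (admDelta (n + 1) k).not_marked_zero α hα
    · exact absurd hα.2 (by omega)
  degenerate_le m α hα := Or.inl (Or.inl hα)

/-- The target of the elementary complicial marking extension: the `n`-truncation of the
`k`-complicial `(n + 2)`-simplex (the remaining face of codimension one is marked too). -/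
def admDelta'' (n : ℕ) (k : Fin (n + 3)) : MarkedSSet.{u} := trunc n (admDelta (n + 1) k)

lemma stdSimplex_mem_degenerate_iff {n m : ℕ} (α : (Δ[n] : SSet.{u}) _⦋m⦌) :
    α ∈ (Δ[n] : SSet.{u}).degenerate m ↔ ¬ Function.Injective α := by
  constructor
  · rintro ⟨p, hp, g, y, rfl⟩ h
    have : Function.Injective (g.toOrderHom : Fin (m + 1) → Fin (p + 1)) :=
      Function.Injective.of_comp (f := y) h
    have := Fintype.card_le_of_injective _ this
    simp at this
    omega
  · intro h
    have := map_mem_degenerate (X := (Δ[n] : SSet.{u})) (SSet.stdSimplex.objEquiv α) h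
      (SSet.stdSimplex.objEquiv.symm (𝟙 _))
    rw [SSet.stdSimplex.map_objEquiv_symm] at this
    erw [Category.comp_id] at this
    exact this

/-- The elementary complicial marking extension. -/
def admIncl (n : ℕ) (k : Fin (n + 3)) : admDelta'.{u} n k ⟶ admDelta'' n k where
  map := 𝟙 _
  map_marked _ _ hα := hα.imp_right And.right

/-- A marked simplicial set is pre-complicial if it has the right lifting property with respect to
the elementary complicial marking extensions (in dimension one these are trivial). -/
def IsPreComplicial : ObjectProperty MarkedSSet.{u} := fun X =>
  ∀ (n : ℕ) (k : Fin (n + 3)) (f : admDelta' n k ⟶ X), ∃ g : admDelta'' n k ⟶ X, admIncl n k ≫ g = f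

/-- The faces that are marked in the source of a marking extension. -/
def IsGood {n : ℕ} (k : Fin (n + 3)) {m : ℕ} (γ : ⦋m⦌ ⟶ ⦋n + 2⦌) : Prop :=
  (∀ j : Fin (n + 3), (j : ℕ) ≤ k + 1 → (k : ℕ) ≤ j + 1 → j ∈ Set.range γ.toOrderHom) ∨
    ∃ j ≠ k, ∀ i ≠ j, i ∈ Set.range γ.toOrderHom


lemma mem_range_of_not_mem {n m : ℕ} (γ : Fin (m + 1) → Fin (n + 3)) (hγ : Function.Injective γ)
    (hm : n < m) {j : Fin (n + 3)} (hj : j ∉ Set.range γ) {i : Fin (n + 3)} (hi : i ≠ j) :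
    i ∈ Set.range γ := by
  have h1 : Finset.univ.image γ ⊆ Finset.univ.erase j := fun a ha => by
    simp only [Finset.mem_image, Finset.mem_univ, true_and] at ha
    simp only [Finset.mem_erase, Finset.mem_univ, and_true]
    rintro rfl
    exact hj ha
  have h2 := Finset.eq_of_subset_of_card_le h1 (by
    rw [Finset.card_image_of_injective _ hγ, Finset.card_erase_of_mem (Finset.mem_univ _)]
    simp
    omega)
  have : i ∈ Finset.univ.image γ := by rw [h2]; simp [hi]
  simpa using this

lemma lt_of_mem_range {n m : ℕ} (γ : Fin (m + 1) → Fin (n + 3)) {j : Fin (n + 3)}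
    (hj : ∀ i ≠ j, i ∈ Set.range γ) : n < m := by
  have h1 : Finset.univ.erase j ⊆ Finset.univ.image γ := fun a ha => by
    simpa using hj a (Finset.ne_of_mem_erase ha)
  have := (Finset.card_le_card h1).trans Finset.card_image_le
  rw [Finset.card_erase_of_mem (Finset.mem_univ _)] at this
  simp at this
  omega

lemma mem_admDelta'_iff {n : ℕ} (k : Fin (n + 3)) {m : ℕ} (α : (Δ[n + 2] : SSet.{u}) _⦋m⦌) :
    α ∈ (admDelta' n k).marked m ↔
      ¬ Function.Injective α ∨ IsGood k (SSet.stdSimplex.objEquiv α) := by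
  change ((_ ∨ _) ∨ (_ ∧ _)) ↔ _
  rw [stdSimplex_mem_degenerate_iff, SSet.mem_horn_iff_notMem_range]
  constructor
  · rintro ((h | h) | ⟨⟨j, hj, h⟩, h'⟩)
    · exact Or.inl h
    · exact Or.inr (Or.inl h)
    · by_cases hα : Function.Injective α
      · exact Or.inr (Or.inr ⟨j, hj, fun i hi => mem_range_of_not_mem _ hα h' h hi⟩)
      · exact Or.inl hα
  · rintro (h | h | ⟨j, hj, h⟩)
    · exact Or.inl (Or.inl h)
    · exact Or.inl (Or.inr h)
    · by_cases hj' : j ∈ Set.range α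
      · refine Or.inl (Or.inr fun i _ _ => ?_)
        by_cases hi : i = j
        · rwa [hi]
        · exact h i hi
      · exact Or.inr ⟨⟨j, hj, hj'⟩, lt_of_mem_range _ h⟩

lemma mem_admDelta''_iff {n : ℕ} (k : Fin (n + 3)) {m : ℕ} (α : (Δ[n + 2] : SSet.{u}) _⦋m⦌) :
    α ∈ (admDelta'' n k).marked m ↔
      ¬ Function.Injective α ∨ IsGood k (SSet.stdSimplex.objEquiv α) ∨
        ∀ i ≠ k, i ∈ Set.range α := by
  change ((_ ∨ _) ∨ _) ↔ _
  rw [stdSimplex_mem_degenerate_iff]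
  constructor
  · rintro ((h | h) | h')
    · exact Or.inl h
    · exact Or.inr (Or.inl (Or.inl h))
    · by_cases hα : Function.Injective α
      · right
        by_cases hk : k ∈ Set.range α
        · left
          by_cases hs : ∀ j, j ∈ Set.range α
          · exact Or.inl fun j _ _ => hs j
          · push Not at hs
            obtain ⟨j, hj⟩ := hs
            exact Or.inr ⟨j, fun h => hj (h ▸ hk), fun i hi => mem_range_of_not_mem _ hα h' hj hi⟩
        · exact Or.inr fun i hi => mem_range_of_not_mem _ hα h' hk hi
      · exact Or.inl hα
  · rintro (h | (h | ⟨j, hj, h⟩) | h)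
    · exact Or.inl (Or.inl h)
    · exact Or.inl (Or.inr h)
    · exact Or.inr (lt_of_mem_range _ h)
    · exact Or.inr (lt_of_mem_range _ h)

lemma isPreComplicial_iff (X : MarkedSSet.{u}) : IsPreComplicial X ↔
    ∀ (n : ℕ) (k : Fin (n + 3)) (x : X.toSSet _⦋n + 2⦌),
      (∀ (m : ℕ) (γ : ⦋m⦌ ⟶ ⦋n + 2⦌), IsGood k γ → X.toSSet.map γ.op x ∈ X.marked m) →
      ∀ (m : ℕ) (γ : ⦋m⦌ ⟶ ⦋n + 2⦌), (∀ i ≠ k, i ∈ Set.range γ.toOrderHom) →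
        X.toSSet.map γ.op x ∈ X.marked m := by
  constructor
  · intro H n k x hx m γ hγ
    let f : admDelta' n k ⟶ X := ⟨SSet.yonedaEquiv.symm x, fun m α hα => by
      change X.toSSet.map (SSet.stdSimplex.objEquiv α).op x ∈ _
      rcases (mem_admDelta'_iff k α).1 hα with hα | hα
      · exact X.degenerate_le _ (map_mem_degenerate _ hα x)
      · exact hx _ _ hα⟩
    obtain ⟨g, hg⟩ := H n k f
    have := g.map_marked m (SSet.stdSimplex.objEquiv.symm γ)
      ((mem_admDelta''_iff k _).2 (Or.inr (Or.inr hγ)))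
    have e : g.map = SSet.yonedaEquiv.symm x := congrArg Hom.map hg
    rw [e] at this
    exact this
  · intro H n k f
    obtain ⟨x, hx⟩ := SSet.yonedaEquiv.symm.surjective f.map
    have key : ∀ m (α : (Δ[n + 2] : SSet.{u}) _⦋m⦌),
        f.map.app (op ⦋m⦌) α = X.toSSet.map (SSet.stdSimplex.objEquiv α).op x := fun m α => by
      rw [← hx]; rfl
    have hgood : ∀ (m : ℕ) (γ : ⦋m⦌ ⟶ ⦋n + 2⦌), IsGood k γ →
        X.toSSet.map γ.op x ∈ X.marked m := fun m γ hγ => by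
      have := f.map_marked m (SSet.stdSimplex.objEquiv.symm γ)
        ((mem_admDelta'_iff k _).2 (Or.inr hγ))
      rwa [key] at this
    refine ⟨⟨SSet.yonedaEquiv.symm x, fun m α hα => ?_⟩, hom_ext hx⟩
    change X.toSSet.map (SSet.stdSimplex.objEquiv α).op x ∈ _
    rcases (mem_admDelta''_iff k α).1 hα with h | h | h
    · exact X.degenerate_le _ (map_mem_degenerate _ h x)
    · exact hgood _ _ h
    · exact H n k x hgood m _ h

/-- `j` is a vertex of the face -/
def Hits {m N : ℕ} (γ : ⦋m⦌ ⟶ ⦋N⦌) (j : ℕ) : Prop := ∃ a, (γ.toOrderHom a : ℕ) = j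

lemma hits_iff {m N : ℕ} (γ : ⦋m⦌ ⟶ ⦋N⦌) (j : Fin (N + 1)) :
    j ∈ Set.range γ.toOrderHom ↔ Hits γ j := by
  simp [Hits, Fin.ext_iff]

lemma exists_glue {a b N : ℕ} (α : ⦋a⦌ ⟶ ⦋N⦌) (β : ⦋b⦌ ⟶ ⦋N⦌)
    (h : α.toOrderHom (Fin.last a) = β.toOrderHom 0) :
    ∃ γ : ⦋a + b⦌ ⟶ ⦋N⦌, front rfl ≫ γ = α ∧ back rfl ≫ γ = β ∧
      ∀ j, Hits γ j ↔ Hits α j ∨ Hits β j := by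
  have hα : ∀ i, α.toOrderHom i ≤ β.toOrderHom 0 := fun i => by
    rw [← h]; exact α.toOrderHom.monotone (Fin.le_last i)
  have hβ : ∀ i, β.toOrderHom 0 ≤ β.toOrderHom i := fun i => β.toOrderHom.monotone (Fin.zero_le i)
  let f : Fin (a + b + 1) → Fin (N + 1) := fun i =>
    if hi : (i : ℕ) ≤ a then α.toOrderHom ⟨i, Nat.lt_succ_of_le hi⟩
    else β.toOrderHom ⟨i - a, by change _ < b + 1; omega⟩
  have hf : Monotone f := by
    intro i j hij
    have hij' : (i : ℕ) ≤ j := hij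
    by_cases hj : (j : ℕ) ≤ a
    · simp only [f, hj, hij'.trans hj, dite_true]
      exact α.toOrderHom.monotone hij
    · by_cases hi : (i : ℕ) ≤ a
      · simp only [f, hi, hj, dite_true, dite_false]
        exact (hα _).trans (hβ _)
      · simp only [f, hi, hj, dite_false]
        exact β.toOrderHom.monotone (by simp [Fin.le_def]; omega)
  have h1 : ∀ i : Fin (a + 1), f ⟨i, by omega⟩ = α.toOrderHom i := fun i => by
    have hi : (i : ℕ) ≤ a := by omega
    simp [f, hi]
  have h2 : ∀ i : Fin (b + 1), f ⟨a + i, by omega⟩ = β.toOrderHom i := fun i => by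
    by_cases hi : (i : ℕ) = 0
    · have : i = 0 := by ext; simpa using hi
      subst this
      simp only [Fin.val_zero, add_zero, f, le_refl, dite_true]
      exact h
    · have : ¬ (a + (i : ℕ) ≤ a) := by omega
      simp [f, this]
  refine ⟨SimplexCategory.mkHom ⟨f, hf⟩, ?_, ?_, fun j => ⟨?_, ?_⟩⟩
  · exact hom_ext' fun i => congrArg Fin.val (h1 i)
  · exact hom_ext' fun i => congrArg Fin.val (h2 i)
  · rintro ⟨i, rfl⟩
    by_cases hi : (i : ℕ) ≤ a
    · exact Or.inl ⟨⟨i, Nat.lt_succ_of_le hi⟩, congrArg Fin.val (h1 ⟨i, by omega⟩).symm⟩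
    · have hi' : (i : ℕ) < a + b + 1 := i.2
      refine Or.inr ⟨⟨i - a, by change _ < b + 1; omega⟩, ?_⟩
      refine congrArg Fin.val (h2 ⟨i - a, by omega⟩).symm |>.trans ?_
      change _ = ((f i : Fin (N + 1)) : ℕ)
      congr
      change a + (i - a) = (i : ℕ)
      omega
  · rintro (⟨i, rfl⟩ | ⟨i, rfl⟩)
    · exact ⟨_, congrArg Fin.val (h1 i)⟩
    · exact ⟨_, congrArg Fin.val (h2 i)⟩

/-- goodness of a face of an interval -/
def GoodIn (c k d : ℕ) {m N : ℕ} (γ : ⦋m⦌ ⟶ ⦋N⦌) : Prop :=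
  (∀ j, c ≤ j → j ≤ d → j ≤ k + 1 → k ≤ j + 1 → Hits γ j) ∨
    ∃ j, j ≠ k ∧ c ≤ j ∧ j ≤ d ∧ ∀ i, c ≤ i → i ≤ d → i ≠ j → Hits γ i

lemma isGood_iff {n m : ℕ} (k : Fin (n + 3)) (γ : ⦋m⦌ ⟶ ⦋n + 2⦌) :
    IsGood k γ ↔ GoodIn 0 k (n + 2) γ := by
  refine or_congr ⟨fun H j _ h1 h2 h3 => ?_, fun H j h1 h2 => ?_⟩
    ⟨fun ⟨j, hj, H⟩ => ⟨j, by simpa [Fin.ext_iff] using hj, by omega, by omega,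
      fun i _ hi hij => ?_⟩, fun ⟨j, hj, _, h, H⟩ => ⟨⟨j, by omega⟩, by simpa [Fin.ext_iff] using hj,
      fun i hi => ?_⟩⟩
  · exact (hits_iff γ ⟨j, by omega⟩).1 (H _ h2 h3)
  · exact (hits_iff γ j).2 (H _ (by omega) (by omega) h1 h2)
  · exact (hits_iff γ ⟨i, by omega⟩).1 (H _ (by simpa [Fin.ext_iff] using hij))
  · exact (hits_iff γ i).2 (H _ (by omega) (by omega) (by simpa [Fin.ext_iff] using hi))

lemma IsPreComplicial.interval {X : MarkedSSet.{u}} (hX : IsPreComplicial X) {N : ℕ}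
    (x : X.toSSet _⦋N⦌) (c k d : ℕ) (hck : c ≤ k) (hkd : k ≤ d) (hd : d ≤ N) (hcd : c + 2 ≤ d)
    (H : ∀ (a : ℕ) (γ : ⦋a⦌ ⟶ ⦋N⦌), (∀ i, c ≤ (γ.toOrderHom i : ℕ) ∧ (γ.toOrderHom i : ℕ) ≤ d) →
      GoodIn c k d γ → X.toSSet.map γ.op x ∈ X.marked a)
    (a : ℕ) (γ : ⦋a⦌ ⟶ ⦋N⦌) (hγ : ∀ i, c ≤ (γ.toOrderHom i : ℕ) ∧ (γ.toOrderHom i : ℕ) ≤ d)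
    (hγ' : ∀ i, c ≤ i → i ≤ d → i ≠ k → Hits γ i) : X.toSSet.map γ.op x ∈ X.marked a := by
  obtain ⟨n, rfl⟩ : ∃ n, d = c + (n + 2) := ⟨d - c - 2, by omega⟩
  let e : ⦋n + 2⦌ ⟶ ⦋N⦌ := SimplexCategory.mkHom
    ⟨fun i => ⟨c + i, by omega⟩, fun i j hij => by simpa using hij⟩
  have he : ∀ i : Fin (n + 3), (e.toOrderHom i : ℕ) = c + i := fun _ => rfl
  have hits : ∀ {b : ℕ} (δ : ⦋b⦌ ⟶ ⦋n + 2⦌) (j : ℕ), Hits (δ ≫ e) (c + j) ↔ Hits δ j := by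
    intro b δ j
    refine exists_congr fun i => ?_
    rw [comp_val, he]
    omega
  let γ₀ : ⦋a⦌ ⟶ ⦋n + 2⦌ := SimplexCategory.mkHom
    ⟨fun i => ⟨γ.toOrderHom i - c, by have := hγ i; omega⟩, fun i j hij => by
      have h1 : (γ.toOrderHom i : ℕ) ≤ γ.toOrderHom j := γ.toOrderHom.monotone hij
      simp only [Fin.mk_le_mk]
      omega⟩
  have hγ₀ : γ₀ ≫ e = γ := hom_ext' fun i => by
    rw [comp_val, he]
    change c + (γ.toOrderHom i - c) = _
    have := hγ i
    omega
  have := (isPreComplicial_iff X).1 hX n ⟨k - c, by omega⟩ (X.toSSet.map e.op x)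
    (fun m δ hδ => by
      rw [← Functor.map_comp_apply, ← op_comp]
      refine H _ _ (fun i => ?_) ?_
      · rw [comp_val, he]
        have := (δ.toOrderHom i).2
        change _ < n + 3 at this
        omega
      · rw [isGood_iff] at hδ
        rcases hδ with hδ | ⟨j, hj, _, hj', hδ⟩
        · left
          intro j h1 h2 h3 h4
          obtain ⟨j, rfl⟩ := Nat.exists_eq_add_of_le h1
          simp only at hδ
          exact (hits δ j).2 (hδ j (by omega) (by omega) (by omega) (by omega))
        · right
          simp only at hj
          refine ⟨c + j, by omega, by omega, by omega, fun i h1 h2 h3 => ?_⟩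
          obtain ⟨i, rfl⟩ := Nat.exists_eq_add_of_le h1
          exact (hits δ i).2 (hδ i (by omega) (by omega) (by omega)))
    a γ₀ (fun i hi => by
      rw [hits_iff, ← hits, hγ₀]
      simp only [ne_eq, Fin.ext_iff] at hi
      exact hγ' _ (by omega) (by omega) (by omega))
  rwa [← Functor.map_comp_apply, ← op_comp, hγ₀] at this

lemma IsPreComplicial.gray {X Y : MarkedSSet.{u}} (hX : IsPreComplicial X)
    (hY : IsPreComplicial Y) : IsPreComplicial (gray X Y) := by
  rw [isPreComplicial_iff]
  rintro n k ⟨x, y⟩ H m γ hγ p q h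
  change X.toSSet.map (front h).op (X.toSSet.map γ.op x) ∈ _ ∨
    Y.toSSet.map (back h).op (Y.toSSet.map γ.op y) ∈ _
  simp only [← Functor.map_comp_apply, ← op_comp]
  -- the basic consequence of the hypothesis on good faces
  have G : ∀ {a b : ℕ} (α : ⦋a⦌ ⟶ ⦋n + 2⦌) (β : ⦋b⦌ ⟶ ⦋n + 2⦌),
      (α.toOrderHom (Fin.last a) : ℕ) = β.toOrderHom 0 →
      ((∀ j, j ≤ n + 2 → j ≤ k + 1 → k ≤ j + 1 → Hits α j ∨ Hits β j) ∨
        ∃ j : ℕ, j ≠ k ∧ j ≤ n + 2 ∧ ∀ i, i ≤ n + 2 → i ≠ j → Hits α i ∨ Hits β i) →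
      X.toSSet.map α.op x ∈ X.marked a ∨ Y.toSSet.map β.op y ∈ Y.marked b := by
    intro a b α β hαβ hg
    obtain ⟨δ, h1, h2, h3⟩ := exists_glue α β (Fin.ext hαβ)
    have := H _ δ ((isGood_iff k δ).2 (by
      refine hg.imp (fun H j _ h4 h5 h6 => (h3 j).2 (H j h4 h5 h6)) ?_
      rintro ⟨j, hj, hj', H⟩
      exact ⟨j, hj, by omega, hj', fun i _ hi hij => (h3 i).2 (H i hi hij)⟩)) a b rfl
    change X.toSSet.map (front rfl).op (X.toSSet.map δ.op x) ∈ _ ∨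
      Y.toSSet.map (back rfl).op (Y.toSSet.map δ.op y) ∈ _ at this
    simpa only [← Functor.map_comp_apply, ← op_comp, h1, h2] using this
  have hk : (k : ℕ) ≤ n + 2 := by omega
  set α := front h ≫ γ with hα
  set β := back h ≫ γ with hβ
  obtain ⟨v, hv⟩ : ∃ v : ℕ, v = γ.toOrderHom ⟨p, by change p < m + 1; omega⟩ := ⟨_, rfl⟩
  have hαl : (α.toOrderHom (Fin.last p) : ℕ) = v := by rw [hv]; rfl
  have hβ0 : (β.toOrderHom 0 : ℕ) = v := by rw [hv]; rfl
  have hv2 : v ≤ n + 2 := by rw [hv]; exact val_le _ _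
  have hαv : ∀ i, (α.toOrderHom i : ℕ) ≤ v := fun i => by
    rw [← hαl]; exact α.toOrderHom.monotone (Fin.le_last i)
  have hβv : ∀ i, v ≤ (β.toOrderHom i : ℕ) := fun i => by
    rw [← hβ0]; exact β.toOrderHom.monotone (Fin.zero_le i)
  have hαβ : ∀ j, j ≤ n + 2 → j ≠ k → Hits α j ∨ Hits β j := by
    intro j hj hjk
    obtain ⟨i, hi⟩ := (hits_iff γ ⟨j, by omega⟩).1 (hγ _ (by simpa [Fin.ext_iff] using hjk))
    by_cases hip : (i : ℕ) ≤ p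
    · exact Or.inl ⟨⟨i, Nat.lt_succ_of_le hip⟩, hi⟩
    · refine Or.inr ⟨⟨i - p, ?_⟩, ?_⟩
      · have := i.2
        change _ < m + 1 at this
        change _ < q + 1
        omega
      · refine Eq.trans ?_ hi
        rw [hβ, comp_val]
        congr 2
        ext
        simp
        omega
  have hα' : ∀ j, j ≤ v → j ≠ k → Hits α j := fun j hj hjk => by
    rcases hαβ j (by omega) hjk with h | ⟨i, hi⟩
    · exact h
    · have := hβv i
      exact ⟨Fin.last p, by omega⟩
  have hβ' : ∀ j, v ≤ j → j ≤ n + 2 → j ≠ k → Hits β j := fun j hj hj' hjk => by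
    rcases hαβ j (by omega) hjk with ⟨i, hi⟩ | h
    · have := hαv i
      exact ⟨0, by omega⟩
    · exact h
  by_contra hcon
  push Not at hcon
  obtain ⟨hx, hy⟩ := hcon
  -- restricting to a single vertex gives an unmarked simplex
  have Gl : ∀ {a : ℕ} (δ : ⦋a⦌ ⟶ ⦋n + 2⦌),
      ((∀ j, j ≤ n + 2 → j ≤ k + 1 → k ≤ j + 1 → Hits δ j) ∨
        ∃ j : ℕ, j ≠ k ∧ j ≤ n + 2 ∧ ∀ i, i ≤ n + 2 → i ≠ j → Hits δ i) →
      X.toSSet.map δ.op x ∈ X.marked a := by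
    intro a δ hδ
    refine (G δ (SimplexCategory.const ⦋0⦌ ⦋n + 2⦌ (δ.toOrderHom (Fin.last a))) rfl ?_).resolve_right
      (Y.not_marked_zero _)
    exact hδ.imp (fun h j h1 h2 h3 => Or.inl (h j h1 h2 h3))
      fun ⟨j, h1, h2, h3⟩ => ⟨j, h1, h2, fun i h4 h5 => Or.inl (h3 i h4 h5)⟩
  have Gr : ∀ {a : ℕ} (δ : ⦋a⦌ ⟶ ⦋n + 2⦌),
      ((∀ j, j ≤ n + 2 → j ≤ k + 1 → k ≤ j + 1 → Hits δ j) ∨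
        ∃ j : ℕ, j ≠ k ∧ j ≤ n + 2 ∧ ∀ i, i ≤ n + 2 → i ≠ j → Hits δ i) →
      Y.toSSet.map δ.op y ∈ Y.marked a := by
    intro a δ hδ
    refine (G (SimplexCategory.const ⦋0⦌ ⦋n + 2⦌ (δ.toOrderHom 0)) δ rfl ?_).resolve_left
      (X.not_marked_zero _)
    exact hδ.imp (fun h j h1 h2 h3 => Or.inr (h j h1 h2 h3))
      fun ⟨j, h1, h2, h3⟩ => ⟨j, h1, h2, fun i h4 h5 => Or.inr (h3 i h4 h5)⟩
  have hvk : v ≠ k := by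
    intro hvk
    have h1 : Hits α k := ⟨Fin.last p, by omega⟩
    rcases G α β (by omega) (Or.inl fun j h2 _ _ => by
      by_cases hjk : j = k
      · exact Or.inl (hjk ▸ h1)
      · exact hαβ j h2 hjk) with h | h
    · exact hx h
    · exact hy h
  rcases Nat.lt_or_gt_of_ne hvk with hlt | hgt
  · -- the removed vertex lies in the back face
    by_cases hc : ∃ (b : ℕ) (δ : ⦋b⦌ ⟶ ⦋n + 2⦌), (∀ i, v < (δ.toOrderHom i : ℕ)) ∧
        (∀ j, v < j → j ≤ n + 2 → Hits δ j) ∧ v + 1 = k ∧ Y.toSSet.map δ.op y ∉ Y.marked b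
    · obtain ⟨b, δ, h1, h2, h3, h4⟩ := hc
      have hδ0 : (δ.toOrderHom 0 : ℕ) = k := by
        obtain ⟨i, hi⟩ := h2 k (by omega) hk
        have h5 : (δ.toOrderHom 0 : ℕ) ≤ δ.toOrderHom i := δ.toOrderHom.monotone (Fin.zero_le i)
        have h6 := h1 0
        omega
      by_cases hk1 : (k : ℕ) = 1
      · exact h4 (Gr δ (Or.inr ⟨0, by omega, by omega, fun i h5 h6 => h2 i (by omega) h5⟩))
      · refine hx (hX.interval x 0 k k (by omega) le_rfl hk (by omega) ?_ p α
          (fun i => ⟨by omega, by have := hαv i; omega⟩) fun i _ h5 h6 => hα' i (by omega) h6)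
        intro a ε hε hg
        have hεk : Hits ε k := by
          rcases hg with hg | ⟨j, h5, _, h6, h7⟩
          · exact hg k (by omega) le_rfl (by omega) (by omega)
          · exact h7 k (by omega) le_rfl (by omega)
        have hεl : (ε.toOrderHom (Fin.last a) : ℕ) = k := by
          obtain ⟨i, hi⟩ := hεk
          have h5 : (ε.toOrderHom i : ℕ) ≤ ε.toOrderHom (Fin.last a) :=
            ε.toOrderHom.monotone (Fin.le_last i)
          have h6 := (hε (Fin.last a)).2
          omega
        refine (G ε δ (by omega) ?_).resolve_right h4
        rcases hg with hg | ⟨j, h5, _, h6, h7⟩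
        · left
          intro j h5 h6 h7
          by_cases hjk : j ≤ k
          · exact Or.inl (hg j (by omega) hjk h6 h7)
          · exact Or.inr (h2 j (by omega) h5)
        · right
          refine ⟨j, h5, by omega, fun i h8 h9 => ?_⟩
          by_cases hik : i ≤ k
          · exact Or.inl (h7 i (by omega) hik h9)
          · exact Or.inr (h2 i (by omega) h8)
    · push Not at hc
      by_cases hvn : v + 2 ≤ n + 2
      · refine hy (hY.interval y v k (n + 2) hlt.le hk le_rfl hvn ?_ q β
          (fun i => ⟨hβv i, val_le _ _⟩) hβ')
        intro a ε hε hg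
        rcases hg with hg | ⟨j, h5, h6, h7, h8⟩
        · exact Gr ε (Or.inl fun j h1 h2 h3 => hg j (by omega) h1 h2 h3)
        · by_cases hjv : Hits ε v
          · have hε0 : (ε.toOrderHom 0 : ℕ) = v := by
              obtain ⟨i, hi⟩ := hjv
              have h9 : (ε.toOrderHom 0 : ℕ) ≤ ε.toOrderHom i :=
                ε.toOrderHom.monotone (Fin.zero_le i)
              have h10 := (hε 0).1
              omega
            refine (G α ε (by omega) (Or.inr ⟨j, h5, h7, fun i h9 h10 => ?_⟩)).resolve_left hx
            by_cases hiv : v ≤ i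
            · exact Or.inr (h8 i hiv h9 h10)
            · exact Or.inl (hα' i (by omega) (by omega))
          · have hjv' : j = v := by
              by_contra hne
              exact hjv (h8 v le_rfl hv2 (Ne.symm hne))
            have h9 : ∀ i, v < (ε.toOrderHom i : ℕ) := fun i =>
              lt_of_le_of_ne (hε i).1 fun h => hjv ⟨i, h.symm⟩
            by_cases hk1 : v + 1 = k
            · exact hc a ε h9 (fun i h10 h11 => h8 i h10.le h11 (by omega)) hk1
            · exact Gr ε (Or.inl fun i h10 h11 h12 => h8 i (by omega) h10 (by omega))
      · have := hc 0 (SimplexCategory.const ⦋0⦌ ⦋n + 2⦌ k) (fun _ => hlt)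
          (fun j h1 h2 => ⟨0, by change (k : ℕ) = j; omega⟩) (by omega)
        exact Y.not_marked_zero _ this
  · by_cases hc : ∃ (b : ℕ) (δ : ⦋b⦌ ⟶ ⦋n + 2⦌), (∀ i, (δ.toOrderHom i : ℕ) < v) ∧
        (∀ j, j < v → Hits δ j) ∧ k + 1 = v ∧ X.toSSet.map δ.op x ∉ X.marked b
    · obtain ⟨b, δ, h1, h2, h3, h4⟩ := hc
      have hδl : (δ.toOrderHom (Fin.last b) : ℕ) = k := by
        obtain ⟨i, hi⟩ := h2 k (by omega)
        have h5 : (δ.toOrderHom i : ℕ) ≤ δ.toOrderHom (Fin.last b) :=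
          δ.toOrderHom.monotone (Fin.le_last i)
        have h6 := h1 (Fin.last b)
        omega
      by_cases hk1 : (k : ℕ) = n + 1
      · exact h4 (Gl δ (Or.inr ⟨n + 2, by omega, by omega, fun i h5 h6 => h2 i (by omega)⟩))
      · refine hy (hY.interval y k k (n + 2) le_rfl hk le_rfl (by omega) ?_ q β
          (fun i => ⟨by have := hβv i; omega, val_le _ _⟩) fun i h5 h6 h7 => hβ' i (by omega) h6 h7)
        intro a ε hε hg
        have hεk : Hits ε k := by
          rcases hg with hg | ⟨j, h5, h6, _, h7⟩
          · exact hg k le_rfl (by omega) (by omega) (by omega)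
          · exact h7 k le_rfl (by omega) (by omega)
        have hε0 : (ε.toOrderHom 0 : ℕ) = k := by
          obtain ⟨i, hi⟩ := hεk
          have h5 : (ε.toOrderHom 0 : ℕ) ≤ ε.toOrderHom i := ε.toOrderHom.monotone (Fin.zero_le i)
          have h6 := (hε 0).1
          omega
        refine (G δ ε (by omega) ?_).resolve_left h4
        rcases hg with hg | ⟨j, h5, h6, _, h7⟩
        · left
          intro j h5 h6 h7
          by_cases hjk : k ≤ j
          · exact Or.inr (hg j hjk h5 h6 h7)
          · exact Or.inl (h2 j (by omega))
        · right
          refine ⟨j, h5, by omega, fun i h8 h9 => ?_⟩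
          by_cases hik : k ≤ i
          · exact Or.inr (h7 i hik h8 h9)
          · exact Or.inl (h2 i (by omega))
    · push Not at hc
      by_cases hvn : 2 ≤ v
      · refine hx (hX.interval x 0 k v (by omega) hgt.le hv2 (by omega) ?_ p α
          (fun i => ⟨by omega, hαv i⟩) fun i _ => hα' i)
        intro a ε hε hg
        rcases hg with hg | ⟨j, h5, h6, h7, h8⟩
        · exact Gl ε (Or.inl fun j h1 h2 h3 => hg j (by omega) (by omega) h2 h3)
        · by_cases hjv : Hits ε v
          · have hεl : (ε.toOrderHom (Fin.last a) : ℕ) = v := by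
              obtain ⟨i, hi⟩ := hjv
              have h9 : (ε.toOrderHom i : ℕ) ≤ ε.toOrderHom (Fin.last a) :=
                ε.toOrderHom.monotone (Fin.le_last i)
              have h10 := (hε (Fin.last a)).2
              omega
            refine (G ε β (by omega) (Or.inr ⟨j, h5, by omega, fun i h9 h10 => ?_⟩)).resolve_right hy
            by_cases hiv : i ≤ v
            · exact Or.inl (h8 i (by omega) hiv h10)
            · exact Or.inr (hβ' i (by omega) h9 (by omega))
          · have hjv' : j = v := by
              by_contra hne
              exact hjv (h8 v (by omega) le_rfl (Ne.symm hne))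
            have h9 : ∀ i, (ε.toOrderHom i : ℕ) < v := fun i =>
              lt_of_le_of_ne (hε i).2 fun h => hjv ⟨i, h⟩
            by_cases hk1 : k + 1 = v
            · exact hc a ε h9 (fun i h10 => h8 i (by omega) h10.le (by omega)) hk1
            · exact Gl ε (Or.inl fun i h10 h11 h12 => h8 i (by omega) (by omega) (by omega))
      · have := hc 0 (SimplexCategory.const ⦋0⦌ ⦋n + 2⦌ k) (fun _ => hgt)
          (fun j h1 => ⟨0, by change (k : ℕ) = j; omega⟩) (by omega)
        exact X.not_marked_zero _ this

end MarkedSSet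

end

namespace MarkedSSet

section
open Simplicial

lemma isPreComplicial_point : IsPreComplicial point.{u} := by
  rw [isPreComplicial_iff]
  intro n k x _ m γ hγ
  obtain ⟨m, rfl⟩ : ∃ m', m = m' + 1 := ⟨m - 1, by have : n < m := lt_of_mem_range _ hγ; omega⟩
  exact point_marked _

instance : IsPreComplicial.{u}.IsMonoidal where
  prop_unit := isPreComplicial_point
  prop_tensor _ _ hX hY := IsPreComplicial.gray hX hY

lemma isPreComplicial_interval : IsPreComplicial (flat.{u} Δ[1]) := by
  rw [isPreComplicial_iff]
  intro n k x H m γ hγ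
  by_contra hcon
  change (Δ[1] : SSet.{u}) _⦋n + 2⦌ at x
  replace hcon : Function.Injective fun a => x (γ.toOrderHom a) := by
    by_contra h
    exact hcon ((stdSimplex_mem_degenerate_iff ((Δ[1] : SSet.{u}).map γ.op x)).2 h)
  have hm : n < m := lt_of_mem_range _ hγ
  have hm1 : m ≤ 1 := by
    have := Fintype.card_le_of_injective (α := Fin (m + 1)) (β := Fin 2) _ hcon
    simp at this
    omega
  obtain rfl : m = 1 := by omega
  obtain rfl : n = 0 := by omega
  -- every face of `x` other than the one opposite to `k` is constant
  have key : ∀ i : Fin 3, i ≠ k → x i = x k := by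
    intro i hik
    obtain ⟨j, hj, hj', hu⟩ : ∃ j : Fin 3, j ≠ k ∧ j ≠ i ∧ ∀ a ≠ j, a = i ∨ a = k :=
      (by decide : ∀ k i : Fin 3, i ≠ k → ∃ j : Fin 3, j ≠ k ∧ j ≠ i ∧ ∀ a ≠ j, a = i ∨ a = k)
        k i hik
    let δ : ⦋1⦌ ⟶ ⦋2⦌ := SimplexCategory.δ j
    have hδ : ∀ a, a ≠ j → ∃ b, δ.toOrderHom b = a := fun a ha => by
      have := Fin.range_succAbove j
      have h2 : a ∈ Set.range (j.succAbove) := by rw [this]; simpa using ha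
      exact h2
    have h1 := H 1 δ (Or.inr ⟨j, hj, fun i hi => hδ i hi⟩)
    replace h1 : ¬ Function.Injective fun a => x (δ.toOrderHom a) :=
      (stdSimplex_mem_degenerate_iff ((Δ[1] : SSet.{u}).map δ.op x)).1 h1
    have h3 : x (δ.toOrderHom 0) = x (δ.toOrderHom 1) := by
      by_contra hne
      apply h1
      intro a b hab
      fin_cases a <;> fin_cases b <;>
        first | rfl | (exact absurd hab hne) | (exact absurd hab.symm hne)
    have h4 : ∀ b, x (δ.toOrderHom b) = x (δ.toOrderHom 0) := fun b => by
      fin_cases b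
      · rfl
      · exact h3.symm
    obtain ⟨b, hb⟩ := hδ i hj'.symm
    obtain ⟨c, hc⟩ := hδ k hj.symm
    rw [← hb, ← hc, h4 b, h4 c]
  have h5 : ∀ i : Fin 3, x i = x k := fun i => by
    by_cases hi : i = k
    · rw [hi]
    · exact key i hi
  have := @hcon 0 1 ((h5 (γ.toOrderHom 0)).trans (h5 (γ.toOrderHom 1)).symm)
  exact absurd this (by decide)

end

end MarkedSSet

open MarkedSSet

/-- The category of pre-complicial sets, with the Gray tensor product inherited from marked
simplicial sets. -/
abbrev PreComp := (MarkedSSet.IsPreComplicial.{u}).FullSubcategory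

namespace PreComp

/-- The interval `Δ[1]`, minimally marked. -/
noncomputable def interval : PreComp.{u} :=
  ⟨flat (SSet.stdSimplex.obj (.mk 1)), isPreComplicial_interval⟩

/-- The `n`-th Gray tensor power of the interval. -/
noncomputable def cube : ℕ → PreComp.{u}
  | 0 => 𝟙_ PreComp
  | n + 1 => cube n ⊗ interval

/-- The `m`-simplices of `X`. -/
abbrev simplices (X : PreComp.{u}) (m : ℕ) : Type u := X.obj.toSSet.obj (op (.mk m))

/-- A simplex of the interval as a monotone map `[m] → {0,1}`. -/
def edge {m : ℕ} (s : interval.{u}.simplices m) (a : Fin (m + 1)) : Bool :=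
  decide ((SSet.stdSimplex.objEquiv s).toOrderHom a = 1)

/-- A simplex of the tensor power as a monotone map `[m] → {0,1}ⁿ`. -/
def vert : (n : ℕ) → {m : ℕ} → (cube.{u} n).simplices m → Fin (m + 1) → Fin n → Bool
  | 0, _, _, _ => fun i => i.elim0
  | n + 1, _, s, a => Fin.snoc (α := fun _ => Bool) (vert n s.1 a) (edge s.2 a)

section
open Simplicial

/-- The action of simplicial operators. -/
def act (X : PreComp.{u}) {m m' : ℕ} (g : ⦋m'⦌ ⟶ ⦋m⦌) (s : X.simplices m) : X.simplices m' :=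
  X.obj.toSSet.map g.op s

lemma edge_act {m m' : ℕ} (g : ⦋m'⦌ ⟶ ⦋m⦌) (s : interval.{u}.simplices m) (a : Fin (m' + 1)) :
    edge (interval.act g s) a = edge s (g.toOrderHom a) := rfl

lemma vert_act (n : ℕ) {m m' : ℕ} (g : ⦋m'⦌ ⟶ ⦋m⦌) (s : (cube.{u} n).simplices m)
    (a : Fin (m' + 1)) : vert n ((cube n).act g s) a = vert n s (g.toOrderHom a) := by
  induction n with
  | zero => rfl
  | succ n ih =>
    change Fin.snoc (α := fun _ => Bool) (vert n ((cube n).act g s.1) a) (edge (interval.act g s.2) a) =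
      Fin.snoc (α := fun _ => Bool) _ _
    rw [ih, edge_act]

lemma edge_mono {m : ℕ} (s : interval.{u}.simplices m) : Monotone (edge s) := by
  intro a b hab
  have := (SSet.stdSimplex.objEquiv s).toOrderHom.monotone hab
  simp only [edge, Bool.le_iff_imp, decide_eq_true_eq]
  intro h
  rw [h] at this
  exact le_antisymm (Fin.le_last _) this

lemma edge_injective {m : ℕ} {s t : interval.{u}.simplices m} (h : ∀ a, edge s a = edge t a) :
    s = t := by
  apply SSet.stdSimplex.objEquiv.injective
  apply hom_ext'
  intro a
  have := h a
  simp only [edge, decide_eq_decide] at this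
  have h1 := ((SSet.stdSimplex.objEquiv s).toOrderHom a).2
  have h2 := ((SSet.stdSimplex.objEquiv t).toOrderHom a).2
  rw [Fin.ext_iff, Fin.ext_iff] at this
  change _ < 2 at h1
  change _ < 2 at h2
  change _ = 1 ↔ _ = 1 at this
  omega

lemma exists_edge {m : ℕ} (f : Fin (m + 1) → Bool) (hf : Monotone f) :
    ∃ s : interval.{u}.simplices m, edge s = f := by
  refine ⟨SSet.stdSimplex.objEquiv.symm (SimplexCategory.mkHom
    ⟨fun a => if f a then 1 else 0, fun a b hab => ?_⟩), funext fun a => ?_⟩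
  · have := hf hab
    rw [Bool.le_iff_imp] at this
    by_cases ha : f a = true
    · simp [ha, this ha]
    · simp [ha]
  · simp only [edge, Equiv.apply_symm_apply]
    change decide ((if f a = true then (1 : Fin 2) else 0) = 1) = f a
    by_cases ha : f a = true
    · simp [ha]
    · simp [ha]

lemma vert_mono (n : ℕ) {m : ℕ} (s : (cube.{u} n).simplices m) : Monotone (vert n s) := by
  induction n with
  | zero => exact fun _ _ _ i => i.elim0
  | succ n ih =>
    intro a b hab i
    refine Fin.lastCases ?_ (fun i => ?_) i
    · simpa [vert] using edge_mono s.2 hab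
    · simpa [vert] using ih s.1 hab i

lemma vert_injective (n : ℕ) {m : ℕ} {s t : (cube.{u} n).simplices m}
    (h : ∀ a, vert n s a = vert n t a) : s = t := by
  induction n with
  | zero => rfl
  | succ n ih =>
    refine Prod.ext (ih fun a => ?_) (edge_injective fun a => ?_)
    · funext i
      simpa [vert] using congrFun (h a) i.castSucc
    · simpa [vert] using congrFun (h a) (Fin.last n)

lemma exists_vert (n : ℕ) {m : ℕ} (v : Fin (m + 1) → Fin n → Bool) (hv : Monotone v) :
    ∃ s : (cube.{u} n).simplices m, vert n s = v := by
  induction n with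
  | zero => exact ⟨PUnit.unit, funext fun a => funext fun i => i.elim0⟩
  | succ n ih =>
    obtain ⟨s, hs⟩ := ih (fun a i => v a i.castSucc) (fun a b hab i => hv hab _)
    obtain ⟨t, ht⟩ := exists_edge (fun a => v a (Fin.last n)) (fun a b hab => hv hab _)
    refine ⟨(s, t), funext fun a => funext fun i => ?_⟩
    refine Fin.lastCases ?_ (fun i => ?_) i
    · simpa [vert] using congrFun ht a
    · simpa [vert] using congrFun (congrFun hs a) i

lemma mem_interval_marked_iff {m : ℕ} (s : interval.{u}.simplices m) :
    s ∈ interval.obj.marked m ↔ ¬ (m = 0 ∨ m = 1 ∧ ∀ a : Fin (m + 1), edge s a = decide ((a : ℕ) = 1)) := by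
  refine (stdSimplex_mem_degenerate_iff _).trans (not_congr ?_)
  let s' : (Δ[1] : SSet.{u}) _⦋m⦌ := s
  change Function.Injective s' ↔ _
  have hs : ∀ a b, edge s a = edge s b ↔ s' a = s' b := by
    intro a b
    have h1 := ((SSet.stdSimplex.objEquiv s).toOrderHom a).2
    have h2 := ((SSet.stdSimplex.objEquiv s).toOrderHom b).2
    change _ < 2 at h1
    change _ < 2 at h2
    refine Iff.trans ?_ Fin.ext_iff.symm
    simp only [edge, decide_eq_decide]
    change ((SSet.stdSimplex.objEquiv s).toOrderHom a = 1 ↔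
      (SSet.stdSimplex.objEquiv s).toOrderHom b = 1) ↔
      (((SSet.stdSimplex.objEquiv s).toOrderHom a : Fin 2) : ℕ) =
        ((SSet.stdSimplex.objEquiv s).toOrderHom b : Fin 2)
    rw [Fin.ext_iff, Fin.ext_iff]
    change (_ = 1 ↔ _ = 1) ↔ _
    omega
  constructor
  · intro h
    have := Fintype.card_le_of_injective (α := Fin (m + 1)) (β := Fin 2) _ h
    simp at this
    rcases Nat.lt_or_ge m 1 with hm | hm
    · exact Or.inl (by omega)
    · obtain rfl : m = 1 := by omega
      refine Or.inr ⟨rfl, ?_⟩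
      have h01 : edge s 0 ≠ edge s 1 := fun h' => absurd (h ((hs 0 1).1 h')) (by decide)
      have hm := edge_mono s (show (0 : Fin 2) ≤ 1 by decide)
      intro a
      fin_cases a
      · revert h01 hm
        change edge s 0 ≠ edge s 1 → edge s 0 ≤ edge s 1 → edge s 0 = false
        cases edge s 0 <;> cases edge s 1 <;> decide
      · revert h01 hm
        change edge s 0 ≠ edge s 1 → edge s 0 ≤ edge s 1 → edge s 1 = true
        cases edge s 0 <;> cases edge s 1 <;> decide
  · rintro (rfl | ⟨rfl, h⟩) a b hab
    · exact Subsingleton.elim (α := Fin 1) _ _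
    · have := (hs a b).2 hab
      rw [h, h, decide_eq_decide] at this
      apply Fin.ext
      omega

/-- There are coordinates `i₁ < ... < iₘ` of which the `c`-th jumps exactly at step `c`. -/
def HasChain (n : ℕ) {m : ℕ} (v : Fin (m + 1) → Fin n → Bool) : Prop :=
  ∃ i : Fin m → Fin n, StrictMono i ∧
    ∀ c : Fin m, v c.castSucc (i c) = false ∧ v c.succ (i c) = true

lemma not_mem_cube_marked_iff (n : ℕ) {m : ℕ} (s : (cube.{u} n).simplices m) :
    s ∉ (cube n).obj.marked m ↔ HasChain n (vert n s) := by
  induction n generalizing m with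
  | zero =>
    constructor
    · intro h
      cases m with
      | zero => exact ⟨fun i => i.elim0, fun i => i.elim0, fun i => i.elim0⟩
      | succ m => exact absurd (point_marked _) h
    · rintro ⟨i, -⟩
      cases m with
      | zero => exact (cube 0).obj.not_marked_zero _
      | succ m => exact (i 0).elim0
  | succ n ih =>
    have key : s ∉ (cube (n + 1)).obj.marked m ↔ ∃ (p q : ℕ) (h : p + q = m),
        (cube n).act (front h) s.1 ∉ (cube n).obj.marked p ∧
        interval.act (back h) s.2 ∉ interval.obj.marked q := by
      change ¬ (∀ p q h, _ ∨ _) ↔ _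
      push Not
      rfl
    rw [key]
    simp only [ih, mem_interval_marked_iff, not_not]
    constructor
    · rintro ⟨p, q, h, ⟨i, hi, hi'⟩, hq⟩
      simp only [vert_act] at hi'
      rcases hq with rfl | ⟨rfl, hq⟩
      · obtain rfl : p = m := by omega
        refine ⟨fun c => (i c).castSucc, fun a b hab => hi hab, fun c => ?_⟩
        simp only [vert, Fin.snoc_castSucc]
        exact hi' c
      · obtain rfl : p + 1 = m := h
        simp only [edge_act] at hq
        refine ⟨fun c => Fin.lastCases (Fin.last n) (fun c => (i c).castSucc) c, ?_, fun c => ?_⟩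
        · intro a b
          refine Fin.lastCases ?_ (fun a => ?_) a <;> refine Fin.lastCases ?_ (fun b => ?_) b
          · intro h; exact absurd h (lt_irrefl _)
          · intro h; exact absurd h (not_lt.2 (Fin.le_last _))
          · intro h; simp [Fin.castSucc_lt_last]
          · intro h
            have : a < b := h
            simpa using hi this
        · refine Fin.lastCases ?_ (fun c => ?_) c
          · have h0 := hq 0
            have h1 := hq 1
            simp only [vert, Fin.lastCases_last, Fin.snoc_last]
            exact ⟨h0, h1⟩
          · simp only [vert, Fin.lastCases_castSucc, Fin.snoc_castSucc]
            exact hi' c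
    · rintro ⟨i, hi, hi'⟩
      have low : ∀ {p q : ℕ} (h : p ≤ m), (∀ c : Fin p, i (c.castLE h) ≠ Fin.last n) →
          ∀ h' : p + q = m, HasChain n (vert n ((cube n).act (front h') s.1)) := by
        intro p q h hc h'
        refine ⟨fun c => (i (c.castLE h)).castPred (hc c), fun a b hab => ?_, fun c => ?_⟩
        · rw [Fin.castPred_lt_castPred_iff]
          exact hi hab
        · rw [vert_act, vert_act]
          have := hi' (c.castLE h)
          obtain ⟨d, hd⟩ := Fin.exists_castSucc_eq.2 (hc c)
          simp only [← hd, Fin.castPred_castSucc]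
          rw [← hd] at this
          simp only [vert, Fin.snoc_castSucc] at this
          exact this
      by_cases hl : ∃ c, i c = Fin.last n
      · obtain ⟨c, hc⟩ := hl
        have hcm : (c : ℕ) + 1 = m := by
          by_contra hne
          have hlt : (c : ℕ) + 1 < m := by omega
          have : i c < i ⟨c + 1, hlt⟩ := hi (by simp [Fin.lt_def])
          rw [hc] at this
          exact absurd this (not_lt.2 (Fin.le_last _))
        refine ⟨c, 1, hcm, ?_, Or.inr ⟨rfl, fun a => ?_⟩⟩
        · refine low (p := c) (by omega) (fun d hd => ?_) hcm
          · have : i (d.castLE (by omega)) < i c := hi (by simp [Fin.lt_def])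
            rw [hd] at this
            exact absurd this (not_lt.2 (Fin.le_last _))
        · have := hi' c
          rw [hc] at this
          simp only [vert, Fin.snoc_last] at this
          rw [edge_act]
          refine Fin.cases ?_ (fun a => ?_) a
          · exact this.1
          · obtain rfl : a = 0 := Subsingleton.elim (α := Fin 1) _ _
            exact this.2
      · push Not at hl
        refine ⟨m, 0, rfl, ?_, Or.inl rfl⟩
        exact low (p := m) le_rfl (fun d => hl _) rfl

end

end PreComp

lemma IsBoxMap.monotone {m n : ℕ} {f : (Fin m → Bool) → (Fin n → Bool)} (hf : IsBoxMap f) :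
    Monotone f := by
  induction hf with
  | id n => exact fun _ _ h => h
  | comp _ _ hf hg => exact hg.comp hf
  | face i ε =>
    intro x y h j
    simp only [boxFace]
    split_ifs
    · exact h _
    · exact le_rfl
    · exact h _
  | degeneracy i =>
    intro x y h j
    simp only [boxDegeneracy]
    split_ifs
    · exact h _
    · exact h _
  | connection i ε =>
    intro x y h j
    simp only [boxConnection]
    split_ifs
    · exact h _
    · exact max_le_max (h _) (h _)
    · exact min_le_min (h _) (h _)
    · exact h _

/-- The coordinates of a map in the box category depend on successive blocks of variables. -/
lemma IsBoxMap.exists_block {m n : ℕ} {f : (Fin m → Bool) → (Fin n → Bool)} (hf : IsBoxMap f) :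
    ∃ B : Fin m → Fin n → Prop,
      (∀ i j i' j', B i j → B i' j' → j < j' → i < i') ∧
      ∀ x y j, f x j ≠ f y j → ∃ i, B i j ∧ x i ≠ y i := by
  induction hf with
  | id n => exact ⟨fun i j => i = j, by rintro i j i' j' rfl rfl h; exact h,
      fun x y j h => ⟨j, rfl, h⟩⟩
  | comp _ _ hf hg =>
    obtain ⟨B, hB, hB'⟩ := hf
    obtain ⟨C, hC, hC'⟩ := hg
    refine ⟨fun i k => ∃ j, B i j ∧ C j k, ?_, fun x y k h => ?_⟩
    · rintro i k i' k' ⟨j, h1, h2⟩ ⟨j', h1', h2'⟩ h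
      exact hB _ _ _ _ h1 h1' (hC _ _ _ _ h2 h2' h)
    · obtain ⟨j, hj, hj'⟩ := hC' _ _ _ h
      obtain ⟨i, hi, hi'⟩ := hB' _ _ _ hj'
      exact ⟨i, ⟨j, hi, hj⟩, hi'⟩
  | @face n k ε =>
    refine ⟨fun i j => ((j : ℕ) < k ∧ (i : ℕ) = j) ∨ ((k : ℕ) < j ∧ (i : ℕ) + 1 = j), ?_, ?_⟩
    · intro i j i' j' h h' hj
      rw [Fin.lt_def] at hj ⊢
      omega
    · intro x y j h
      simp only [boxFace] at h
      split_ifs at h with h1 h2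
      · exact ⟨_, Or.inl ⟨h1, rfl⟩, h⟩
      · exact absurd rfl h
      · exact ⟨_, Or.inr ⟨by omega, by simp only; omega⟩, h⟩
  | @degeneracy n k =>
    refine ⟨fun i j => ((j : ℕ) < k ∧ (i : ℕ) = j) ∨ ((k : ℕ) ≤ j ∧ (i : ℕ) = j + 1), ?_, ?_⟩
    · intro i j i' j' h h' hj
      rw [Fin.lt_def] at hj ⊢
      omega
    · intro x y j h
      simp only [boxDegeneracy] at h
      split_ifs at h with h1
      · exact ⟨_, Or.inl ⟨h1, rfl⟩, h⟩
      · exact ⟨_, Or.inr ⟨by omega, rfl⟩, h⟩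
  | @connection n k ε =>
    refine ⟨fun i j => ((j : ℕ) < k ∧ (i : ℕ) = j) ∨ ((j : ℕ) = k ∧ ((i : ℕ) = k ∨ (i : ℕ) = k + 1)) ∨
      ((k : ℕ) < j ∧ (i : ℕ) = j + 1), ?_, ?_⟩
    · intro i j i' j' h h' hj
      rw [Fin.lt_def] at hj ⊢
      omega
    · intro x y j h
      by_cases h1 : (j : ℕ) < k
      · simp only [boxConnection, h1, if_true] at h
        exact ⟨_, Or.inl ⟨h1, rfl⟩, h⟩
      · by_cases h2 : (j : ℕ) = k
        · simp only [boxConnection, h2, lt_irrefl, if_false, if_true] at h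
          by_contra hcon
          push Not at hcon
          have e1 := hcon ⟨k, by omega⟩ (Or.inr (Or.inl ⟨h2, Or.inl rfl⟩))
          have e2 := hcon ⟨k + 1, by omega⟩ (Or.inr (Or.inl ⟨h2, Or.inr rfl⟩))
          rw [e1, e2] at h
          exact h rfl
        · simp only [boxConnection, h1, h2, if_false] at h
          exact ⟨_, Or.inr (Or.inr ⟨by omega, rfl⟩), h⟩

namespace PreComp

section
open Simplicial

lemma HasChain.of_isBoxMap {n n' : ℕ} {f : (Fin n → Bool) → (Fin n' → Bool)} (hf : IsBoxMap f)
    {m : ℕ} {v : Fin (m + 1) → Fin n → Bool} (hv : Monotone v)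
    (h : HasChain n' (fun a => f (v a))) : HasChain n v := by
  obtain ⟨B, hB, hB'⟩ := hf.exists_block
  obtain ⟨i, hi, hi'⟩ := h
  have (c : Fin m) : ∃ j, B j (i c) ∧ v c.castSucc j ≠ v c.succ j :=
    hB' _ _ _ (fun h => Bool.false_ne_true ((hi' c).1.symm.trans (h.trans (hi' c).2)))
  choose j hj hj' using this
  refine ⟨j, fun a b hab => hB _ _ _ _ (hj a) (hj b) (hi hab), fun c => ?_⟩
  have h1 := hv (Fin.castSucc_lt_succ (i := c)).le (j c)
  have h2 := hj' c
  revert h1 h2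
  cases v c.castSucc (j c) <;> cases v c.succ (j c) <;> simp

/-- The simplex of the tensor power given by a monotone map `[m] → {0,1}ⁿ`. -/
noncomputable def ofVert (n : ℕ) {m : ℕ} (v : Fin (m + 1) → Fin n → Bool) (hv : Monotone v) :
    (cube.{u} n).simplices m := (exists_vert n v hv).choose

@[simp] lemma vert_ofVert (n : ℕ) {m : ℕ} (v : Fin (m + 1) → Fin n → Bool) (hv : Monotone v) :
    vert n (ofVert.{u} n v hv) = v := (exists_vert n v hv).choose_spec

lemma vert_act' (n : ℕ) {Δ Δ' : SimplexCategoryᵒᵖ} (g : Δ ⟶ Δ') (s : (cube.{u} n).obj.toSSet.obj Δ)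
    (a : Fin (Δ'.unop.len + 1)) :
    vert n (m := Δ'.unop.len) ((cube n).obj.toSSet.map g s) a =
      vert n (m := Δ.unop.len) s (g.unop.toOrderHom a) :=
  vert_act n (m := Δ.unop.len) (m' := Δ'.unop.len) g.unop s a

/-- The map of tensor powers induced by a map in the box category: it acts by it on vertices. -/
noncomputable def cubeMap {a b : Box} (f : a ⟶ b) : cube.{u} a.dim ⟶ cube b.dim :=
  ObjectProperty.homMk
    { map :=
        { app := fun Δ => TypeCat.ofHom fun s => ofVert b.dim (m := Δ.unop.len)
            (fun i => f.toFun (vert a.dim (m := Δ.unop.len) s i))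
            (f.isBoxMap.monotone.comp (vert_mono _ _))
          naturality := fun Δ Δ' g => by
            ext s
            refine vert_injective b.dim (m := Δ'.unop.len) fun i => ?_
            refine (congrFun (vert_ofVert b.dim _
              (f.isBoxMap.monotone.comp (vert_mono _ _))) i).trans ?_
            refine Eq.trans ?_ (vert_act' b.dim g _ i).symm
            refine Eq.trans ?_ (congrFun (vert_ofVert b.dim _
              (f.isBoxMap.monotone.comp (vert_mono _ _))) _).symm
            exact congrArg _ (vert_act' _ g s i) }
      map_marked := fun m s hs => by
        by_contra hcon
        rw [not_mem_cube_marked_iff] at hcon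
        refine absurd hs ((not_mem_cube_marked_iff _ _).2 ?_)
        refine HasChain.of_isBoxMap f.isBoxMap (vert_mono _ _) ?_
        have := vert_ofVert.{u} b.dim (fun i => f.toFun (vert a.dim s i))
            (f.isBoxMap.monotone.comp (vert_mono _ _))
        rw [← this]
        exact hcon }

/-- The action of a map on simplices. -/
def ap {X Y : PreComp.{u}} (f : X ⟶ Y) {m : ℕ} (s : X.simplices m) : Y.simplices m :=
  f.hom.map.app (op ⦋m⦌) s

lemma ap_act {X Y : PreComp.{u}} (f : X ⟶ Y) {m m' : ℕ} (g : ⦋m'⦌ ⟶ ⦋m⦌) (s : X.simplices m) :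
    ap f (X.act g s) = Y.act g (ap f s) :=
  NatTrans.naturality_apply f.hom.map g.op s

lemma ap_comp {X Y Z : PreComp.{u}} (f : X ⟶ Y) (g : Y ⟶ Z) {m : ℕ} (s : X.simplices m) :
    ap (f ≫ g) s = ap g (ap f s) := rfl

lemma ap_id {X : PreComp.{u}} {m : ℕ} (s : X.simplices m) : ap (𝟙 X) s = s := rfl

lemma hom_ext {X Y : PreComp.{u}} {f g : X ⟶ Y} (h : ∀ m (s : X.simplices m), ap f s = ap g s) :
    f = g := by
  apply ObjectProperty.hom_ext
  apply MarkedSSet.hom_ext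
  ext Δ s
  exact h Δ.unop.len s

@[simp] lemma vert_cubeMap {a b : Box} (f : a ⟶ b) {m : ℕ} (s : (cube.{u} a.dim).simplices m)
    (i : Fin (m + 1)) : vert b.dim (ap (cubeMap f) s) i = f.toFun (vert a.dim s i) :=
  congrFun (vert_ofVert b.dim _ (f.isBoxMap.monotone.comp (vert_mono _ _))) i

/-- The functor `[1]ⁿ ↦ (Δ[1])^{⊗ n}`. -/
noncomputable def cubes : Box ⥤ PreComp.{u} where
  obj a := cube a.dim
  map f := cubeMap f
  map_id a := hom_ext fun m s => vert_injective _ fun i => by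
    rw [vert_cubeMap]
    rfl
  map_comp f g := hom_ext fun m s => vert_injective _ fun i => by
    rw [vert_cubeMap, ap_comp, vert_cubeMap, vert_cubeMap]
    rfl

end

end PreComp

namespace Box

/-- The tensor product of maps between standard objects. -/
def par {k l k' l' : ℕ} (f : (⟨k⟩ : Box) ⟶ ⟨k'⟩) (g : (⟨l⟩ : Box) ⟶ ⟨l'⟩) :
    (⟨k + l⟩ : Box) ⟶ ⟨k' + l'⟩ :=
  ⟨boxTensor f.toFun g.toFun, f.isBoxMap.tensor g.isBoxMap⟩

end Box

/-- The category of cubical sets, presheaves on the box category, with the geometric product: Day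
convolution of the monoidal structure of the box category. -/
abbrev CSet := DayFunctor Boxᵒᵖ (Type u)

namespace CSet

open LawfulDayConvolutionMonoidalCategoryStruct

/-- The `n`-cubes of `X`. -/
abbrev cubes (X : CSet.{u}) (n : ℕ) : Type u := X.functor.obj (op ⟨n⟩)

/-- The action of the maps of the box category. -/
def act (X : CSet.{u}) {m n : ℕ} (f : (⟨m⟩ : Box) ⟶ ⟨n⟩) (x : X.cubes n) : X.cubes m :=
  X.functor.map f.op x

/-- The action of a cubical map on cubes. -/
def ap {X Y : CSet.{u}} (f : X ⟶ Y) {n : ℕ} (x : X.cubes n) : Y.cubes n :=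
  f.natTrans.app (op ⟨n⟩) x

lemma act_act (X : CSet.{u}) {l m n : ℕ} (f : (⟨l⟩ : Box) ⟶ ⟨m⟩) (g : (⟨m⟩ : Box) ⟶ ⟨n⟩)
    (x : X.cubes n) : X.act f (X.act g x) = X.act (f ≫ g) x := by
  simp [act]

lemma act_id (X : CSet.{u}) {n : ℕ} (x : X.cubes n) : X.act (𝟙 _) x = x := by
  simp [act]

lemma ap_act {X Y : CSet.{u}} (f : X ⟶ Y) {m n : ℕ} (g : (⟨m⟩ : Box) ⟶ ⟨n⟩)
    (x : X.cubes n) : ap f (X.act g x) = Y.act g (ap f x) :=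
  NatTrans.naturality_apply f.natTrans g.op x

lemma ap_comp {X Y Z : CSet.{u}} (f : X ⟶ Y) (g : Y ⟶ Z) {n : ℕ} (x : X.cubes n) :
    ap (f ≫ g) x = ap g (ap f x) := rfl

lemma ap_id (X : CSet.{u}) {n : ℕ} (x : X.cubes n) : ap (𝟙 X) x = x := rfl

lemma hom_ext {X Y : CSet.{u}} {f g : X ⟶ Y} (h : ∀ n (x : X.cubes n), ap f x = ap g x) :
    f = g := by
  apply DayFunctor.hom_ext
  ext ⟨⟨n⟩⟩ x
  exact h n x

/-- The degenerate cubes, the images of the degeneracies and the connections. -/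
def degenerate (X : CSet.{u}) (m : ℕ) : Set (X.cubes m) :=
  {c | ∃ (n : ℕ) (f : (⟨m⟩ : Box) ⟶ ⟨n⟩) (_ : IsElemEpi f.toFun) (x : X.cubes n), c = X.act f x}

lemma degenerate_zero (X : CSet.{u}) : X.degenerate 0 = ∅ := by
  ext c
  simp only [Set.mem_empty_iff_false, iff_false]
  rintro ⟨n, ⟨f, _⟩, hf, -⟩
  have : ∀ m n (f : (Fin m → Bool) → (Fin n → Bool)), IsElemEpi f → m ≠ 0 := by
    rintro m n f (_ | _) <;> omega
  exact this _ _ _ hf rfl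

lemma ap_mem_degenerate {X Y : CSet.{u}} (f : X ⟶ Y) {n : ℕ} {x : X.cubes n}
    (hx : x ∈ X.degenerate n) : ap f x ∈ Y.degenerate n := by
  obtain ⟨m, g, hg, y, rfl⟩ := hx
  exact ⟨m, g, hg, ap f y, ap_act _ _ _⟩

/-- The `(k + l)`-cube `x ⊗ y` of the geometric product. -/
noncomputable def tmul {X Y : CSet.{u}} {k l : ℕ} (x : X.cubes k) (y : Y.cubes l) :
    (X ⊗ Y : CSet.{u}).cubes (k + l) :=
  (DayFunctor.η X Y).app (op ⟨k⟩, op ⟨l⟩) (x, y)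

lemma tmul_act {X Y : CSet.{u}} {k l k' l' : ℕ} (f : (⟨k'⟩ : Box) ⟶ ⟨k⟩) (g : (⟨l'⟩ : Box) ⟶ ⟨l⟩)
    (x : X.cubes k) (y : Y.cubes l) :
    tmul (X.act f x) (Y.act g y) = (X ⊗ Y : CSet.{u}).act (Box.par f g) (tmul x y) := by
  let p : (externalProductBifunctor _ _ _ |>.obj (X.functor, Y.functor)).obj
    (op (⟨k⟩ : Box), op (⟨l⟩ : Box)) := (⟨x, y⟩ : X.cubes k × Y.cubes l)
  exact NatTrans.naturality_apply (DayFunctor.η X Y) (X := (op ⟨k⟩, op ⟨l⟩))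
    (Y := (op ⟨k'⟩, op ⟨l'⟩)) (f.op, g.op) p

lemma ap_tmul {X Y X' Y' : CSet.{u}} (f : X ⟶ X') (g : Y ⟶ Y') {k l : ℕ} (x : X.cubes k)
    (y : Y.cubes l) : ap (f ⊗ₘ g) (tmul x y) = tmul (ap f x) (ap g y) := by
  let p : (externalProductBifunctor _ _ _ |>.obj (X.functor, Y.functor)).obj
    (op (⟨k⟩ : Box), op (⟨l⟩ : Box)) := (⟨x, y⟩ : X.cubes k × Y.cubes l)
  exact ConcreteCategory.congr_hom
    (convolutionExtensionUnit_comp_ι_map_tensorHom_app Boxᵒᵖ (Type u) f g (op ⟨k⟩) (op ⟨l⟩)) p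

lemma exists_act_tmul {X Y : CSet.{u}} {n : ℕ} (c : (X ⊗ Y : CSet.{u}).cubes n) :
    ∃ (k l : ℕ) (f : (⟨n⟩ : Box) ⟶ ⟨k + l⟩) (x : X.cubes k) (y : Y.cubes l),
      c = (X ⊗ Y : CSet.{u}).act f (tmul x y) := by
  obtain ⟨⟨⟨⟨⟨k⟩⟩, ⟨⟨l⟩⟩⟩, _, f⟩, z, hz⟩ := Limits.Types.jointly_surjective_of_isColimit
    (isPointwiseLeftKanExtensionConvolutionExtensionUnit (C := Boxᵒᵖ) (V := Type u) X Y (op ⟨n⟩)) c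
  let p : X.cubes k × Y.cubes l := z
  exact ⟨k, l, f.unop, p.1, p.2, hz.symm⟩

lemma exists_tmul {X Y : CSet.{u}} {n : ℕ} (c : (X ⊗ Y : CSet.{u}).cubes n) :
    ∃ (k l : ℕ) (h : n = k + l) (x : X.cubes k) (y : Y.cubes l),
      c = (X ⊗ Y : CSet.{u}).act (Box.castIso h).hom (tmul x y) := by
  obtain ⟨k, l, f, x, y, rfl⟩ := exists_act_tmul c
  obtain ⟨k', l', h, f₁, f₂, hf₁, hf₂, hf⟩ := f.isBoxMap.exists_tensor (k := k) (l := l) rfl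
  refine ⟨k', l', h.symm, X.act ⟨f₁, hf₁⟩ x, Y.act ⟨f₂, hf₂⟩ y, ?_⟩
  rw [tmul_act, act_act]
  congr 1
  exact Box.Hom.ext hf

lemma tmul_mem_degenerate_left {X Y : CSet.{u}} {k l : ℕ} {x : X.cubes k} (hx : x ∈ X.degenerate k)
    (y : Y.cubes l) : tmul x y ∈ (X ⊗ Y : CSet.{u}).degenerate (k + l) := by
  obtain ⟨k', f, hf, x, rfl⟩ := hx
  refine ⟨k' + l, Box.par f (𝟙 _), hf.tensor_id l, tmul x y, ?_⟩
  rw [← tmul_act, act_id]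

lemma tmul_mem_degenerate_right {X Y : CSet.{u}} {k l : ℕ} (x : X.cubes k) {y : Y.cubes l}
    (hy : y ∈ Y.degenerate l) : tmul x y ∈ (X ⊗ Y : CSet.{u}).degenerate (k + l) := by
  obtain ⟨l', f, hf, y, rfl⟩ := hy
  refine ⟨k + l', Box.par (𝟙 _) f, hf.id_tensor k, tmul x y, ?_⟩
  rw [← tmul_act, act_id]

lemma associator_tmul {X Y Z : CSet.{u}} {k l m : ℕ} (x : X.cubes k) (y : Y.cubes l)
    (z : Z.cubes m) : ap (α_ X Y Z).hom (tmul (tmul x y) z) =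
      (X ⊗ Y ⊗ Z : CSet.{u}).act (Box.castIso (Nat.add_assoc k l m)).hom (tmul x (tmul y z)) := by
  exact ConcreteCategory.congr_hom (associator_hom_unit_unit (Type u) X Y Z (op (⟨k⟩ : Box))
    (op (⟨l⟩ : Box)) (op (⟨m⟩ : Box))) (⟨⟨x, y⟩, z⟩ : (X.cubes k × Y.cubes l) × Z.cubes m)

/-- The unique `0`-cube of the unit. -/
noncomputable def one : (𝟙_ CSet.{u}).cubes 0 := ν Boxᵒᵖ (Type u) PUnit.unit

lemma exists_one {n : ℕ} (c : (𝟙_ CSet.{u}).cubes n) :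
    ∃ f : (⟨n⟩ : Box) ⟶ ⟨0⟩, c = (𝟙_ CSet.{u}).act f one := by
  obtain ⟨⟨_, _, f⟩, z, hz⟩ := Limits.Types.jointly_surjective_of_isColimit
    (isPointwiseLeftKanExtensionUnitUnit Boxᵒᵖ (Type u) CSet (op ⟨n⟩)) c
  exact ⟨f.unop, hz.symm⟩

lemma mem_degenerate_unit {n : ℕ} (c : (𝟙_ CSet.{u}).cubes (n + 1)) :
    c ∈ (𝟙_ CSet.{u}).degenerate (n + 1) := by
  obtain ⟨f, rfl⟩ := exists_one c
  have hd := IsElemEpi.degeneracy (n := n) 0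
  let e : (⟨n + 1⟩ : Box) ⟶ ⟨n⟩ := ⟨_, hd.isBoxMap⟩
  let d : (⟨n⟩ : Box) ⟶ ⟨n + 1⟩ := ⟨boxFace 0 false, .face 0 false⟩
  refine ⟨n, e, hd, (𝟙_ CSet.{u}).act (d ≫ f) one, ?_⟩
  rw [act_act]
  congr 1
  exact Box.hom_ext fun x j => j.elim0

lemma unit_zero (c : (𝟙_ CSet.{u}).cubes 0) : c = one := by
  obtain ⟨f, rfl⟩ := exists_one c
  have : f = 𝟙 _ := Box.hom_ext fun x j => j.elim0
  rw [this, act_id]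

lemma leftUnitor_tmul {X : CSet.{u}} {k : ℕ} (x : X.cubes k) :
    ap (λ_ X).hom (tmul one x) = X.act (Box.castIso (Nat.zero_add k)).hom x := by
  exact ConcreteCategory.congr_hom (leftUnitor_hom_unit_app (Type u) X (op (⟨k⟩ : Box)))
    (⟨PUnit.unit, x⟩ : PUnit × X.cubes k)

lemma rightUnitor_tmul {X : CSet.{u}} {k : ℕ} (x : X.cubes k) :
    ap (ρ_ X).hom (tmul x one) = X.act (Box.castIso (Nat.add_zero k)).hom x := by
  exact ConcreteCategory.congr_hom (rightUnitor_hom_unit_app (Type u) X (op (⟨k⟩ : Box)))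
    (⟨x, PUnit.unit⟩ : X.cubes k × PUnit)

end CSet

/-- A marked cubical set: a cubical set with a set of marked cubes of positive dimension containing
all degenerate ones. -/
structure MarkedCSet where
  toCSet : CSet.{u}
  marked (n : ℕ) : Set (toCSet.cubes n)
  not_marked_zero (x : toCSet.cubes 0) : x ∉ marked 0
  degenerate_le (n : ℕ) : toCSet.degenerate n ⊆ marked n

namespace MarkedCSet

open CSet

/-- A map of marked cubical sets is a cubical map preserving marked cubes. -/
@[ext]
structure Hom (X Y : MarkedCSet.{u}) where
  map : X.toCSet ⟶ Y.toCSet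
  map_marked (n : ℕ) (x : X.toCSet.cubes n) (hx : x ∈ X.marked n) : ap map x ∈ Y.marked n

instance : Category MarkedCSet.{u} where
  Hom := Hom
  id X := ⟨𝟙 _, fun _ _ hx => hx⟩
  comp f g := ⟨f.map ≫ g.map, fun n x hx => g.map_marked n _ (f.map_marked n x hx)⟩

@[ext]
lemma hom_ext {X Y : MarkedCSet.{u}} {f g : X ⟶ Y} (h : f.map = g.map) : f = g :=
  Hom.ext h

@[simp] lemma id_map (X : MarkedCSet.{u}) : Hom.map (𝟙 X) = 𝟙 X.toCSet := rfl
@[simp] lemma comp_map {X Y Z : MarkedCSet.{u}} (f : X ⟶ Y) (g : Y ⟶ Z) :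
    (f ≫ g).map = f.map ≫ g.map := rfl

/-- The underlying cubical set. -/
@[simps]
def forget : MarkedCSet.{u} ⥤ CSet.{u} where
  obj X := X.toCSet
  map f := f.map

instance : forget.{u}.Faithful where
  map_injective h := hom_ext h

/-- The minimal marking. -/
def flat (X : CSet.{u}) : MarkedCSet.{u} where
  toCSet := X
  marked n := X.degenerate n
  not_marked_zero x := by simp [degenerate_zero]
  degenerate_le n := le_rfl

/-- An isomorphism of cubical sets that preserves markings in both directions. -/
def isoMk {X Y : MarkedCSet.{u}} (e : X.toCSet ≅ Y.toCSet)
    (h : ∀ n (x : X.toCSet.cubes n), x ∈ X.marked n → ap e.hom x ∈ Y.marked n)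
    (h' : ∀ n (x : Y.toCSet.cubes n), x ∈ Y.marked n → ap e.inv x ∈ X.marked n) : X ≅ Y where
  hom := ⟨e.hom, h⟩
  inv := ⟨e.inv, h'⟩

/-- The marked cubes of the lax Gray tensor product: the degenerate ones and the `x ⊗ y` with `x`
marked or `y` marked. -/
inductive GrayMarked (X Y : MarkedCSet.{u}) :
    (n : ℕ) → (X.toCSet ⊗ Y.toCSet : CSet.{u}).cubes n → Prop
  | degenerate {n : ℕ} (c : (X.toCSet ⊗ Y.toCSet : CSet.{u}).cubes n)
      (hc : c ∈ (X.toCSet ⊗ Y.toCSet : CSet.{u}).degenerate n) : GrayMarked X Y n c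
  | left {k l : ℕ} (x : X.toCSet.cubes k) (y : Y.toCSet.cubes l) (hx : x ∈ X.marked k) :
      GrayMarked X Y (k + l) (tmul x y)
  | right {k l : ℕ} (x : X.toCSet.cubes k) (y : Y.toCSet.cubes l) (hy : y ∈ Y.marked l) :
      GrayMarked X Y (k + l) (tmul x y)

lemma GrayMarked.of_eq {X Y : MarkedCSet.{u}} {n : ℕ}
    {c c' : (X.toCSet ⊗ Y.toCSet : CSet.{u}).cubes n} (h : c = c') (hc : GrayMarked X Y n c') :
    GrayMarked X Y n c := h ▸ hc

lemma mem_of_eq (X : MarkedCSet.{u}) {n : ℕ} {x y : X.toCSet.cubes n} (h : x = y)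
    (hy : y ∈ X.marked n) : x ∈ X.marked n := h ▸ hy

/-- Transport along an equality of dimensions. -/
lemma GrayMarked.cast {X Y : MarkedCSet.{u}} {m n : ℕ} (h : m = n)
    {c : (X.toCSet ⊗ Y.toCSet : CSet.{u}).cubes n} (hc : GrayMarked X Y n c) :
    GrayMarked X Y m ((X.toCSet ⊗ Y.toCSet : CSet.{u}).act (Box.castIso h).hom c) := by
  subst h
  have : (Box.castIso (rfl : m = m)).hom = 𝟙 _ := rfl
  rwa [this, act_id]

lemma GrayMarked.pos {X Y : MarkedCSet.{u}} {n : ℕ}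
    {c : (X.toCSet ⊗ Y.toCSet : CSet.{u}).cubes n} (hc : GrayMarked X Y n c) : n ≠ 0 := by
  cases hc with
  | degenerate _ hc =>
    rintro rfl
    rw [degenerate_zero] at hc
    exact hc
  | @left k l x y hx =>
    intro h
    obtain rfl : k = 0 := by omega
    exact X.not_marked_zero x hx
  | @right k l x y hy =>
    intro h
    obtain rfl : l = 0 := by omega
    exact Y.not_marked_zero y hy

/-- The lax Gray tensor product: the geometric product with the marking above. -/
noncomputable def gray (X Y : MarkedCSet.{u}) : MarkedCSet.{u} where
  toCSet := X.toCSet ⊗ Y.toCSet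
  marked n := {c | GrayMarked X Y n c}
  not_marked_zero c hc := hc.pos rfl
  degenerate_le n c hc := .degenerate c hc

/-- The lax Gray tensor product of two maps. -/
noncomputable def grayMap {X Y X' Y' : MarkedCSet.{u}} (f : X ⟶ X') (g : Y ⟶ Y') :
    gray X Y ⟶ gray X' Y' where
  map := f.map ⊗ₘ g.map
  map_marked n c hc := by
    cases hc with
    | degenerate _ hc => exact .degenerate _ (ap_mem_degenerate _ hc)
    | left x y hx =>
      refine GrayMarked.of_eq (ap_tmul _ _ _ _) ?_
      exact .left _ _ (f.map_marked _ x hx)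
    | right x y hy =>
      refine GrayMarked.of_eq (ap_tmul _ _ _ _) ?_
      exact .right _ _ (g.map_marked _ y hy)

lemma associator_marked {X Y Z : MarkedCSet.{u}} (n : ℕ)
    (c : (gray (gray X Y) Z).toCSet.cubes n) (hc : c ∈ (gray (gray X Y) Z).marked n) :
    ap (α_ X.toCSet Y.toCSet Z.toCSet).hom c ∈ (gray X (gray Y Z)).marked n := by
  cases hc with
  | degenerate _ hc => exact .degenerate _ (ap_mem_degenerate _ hc)
  | left w z hw =>
    cases hw with
    | degenerate _ hw =>
      exact .degenerate _ (ap_mem_degenerate _ (tmul_mem_degenerate_left hw z))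
    | left x y hx =>
      refine GrayMarked.of_eq (X := X) (Y := gray Y Z) (associator_tmul _ _ _) ?_
      exact GrayMarked.cast (X := X) (Y := gray Y Z) _ (GrayMarked.left (X := X) (Y := gray Y Z) x (tmul y z) hx)
    | right x y hy =>
      refine GrayMarked.of_eq (X := X) (Y := gray Y Z) (associator_tmul _ _ _) ?_
      exact GrayMarked.cast (X := X) (Y := gray Y Z) _ (GrayMarked.right (X := X) (Y := gray Y Z) x (tmul y z)
        (GrayMarked.left y z hy))
  | @right k l w z hz =>
    obtain ⟨k, k', h, x, y, rfl⟩ := exists_tmul w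
    subst h
    have : (Box.castIso (rfl : k + k' = k + k')).hom = 𝟙 _ := rfl
    rw [this, act_id]
    refine GrayMarked.of_eq (X := X) (Y := gray Y Z) (associator_tmul _ _ _) ?_
    exact GrayMarked.cast (X := X) (Y := gray Y Z) _ (GrayMarked.right (X := X) (Y := gray Y Z) x (tmul y z)
      (GrayMarked.right y z hz))

lemma inv_associator_tmul {X Y Z : CSet.{u}} {k l m : ℕ} (x : X.cubes k) (y : Y.cubes l)
    (z : Z.cubes m) : ap (α_ X Y Z).inv (tmul x (tmul y z)) =
      ((X ⊗ Y) ⊗ Z : CSet.{u}).act (Box.castIso (Nat.add_assoc k l m)).inv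
        (tmul (tmul x y) z) := by
  have h := associator_tmul x y z
  have h2 := congrArg (ap (α_ X Y Z).inv) h
  rw [← CSet.ap_comp, Iso.hom_inv_id, CSet.ap_id, ap_act] at h2
  rw [h2, act_act, Iso.inv_hom_id, act_id]

lemma GrayMarked.cast' {X Y : MarkedCSet.{u}} {m n : ℕ} (h : m = n)
    {c : (X.toCSet ⊗ Y.toCSet : CSet.{u}).cubes m} (hc : GrayMarked X Y m c) :
    GrayMarked X Y n ((X.toCSet ⊗ Y.toCSet : CSet.{u}).act (Box.castIso h).inv c) :=
  hc.cast h.symm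

lemma inv_associator_marked {X Y Z : MarkedCSet.{u}} (n : ℕ)
    (c : (gray X (gray Y Z)).toCSet.cubes n) (hc : c ∈ (gray X (gray Y Z)).marked n) :
    ap (α_ X.toCSet Y.toCSet Z.toCSet).inv c ∈ (gray (gray X Y) Z).marked n := by
  cases hc with
  | degenerate _ hc => exact .degenerate _ (ap_mem_degenerate _ hc)
  | @left k l x w hx =>
    obtain ⟨k, k', h, y, z, rfl⟩ := exists_tmul w
    subst h
    have : (Box.castIso (rfl : k + k' = k + k')).hom = 𝟙 _ := rfl
    rw [this, act_id]
    refine GrayMarked.of_eq (X := gray X Y) (Y := Z) (inv_associator_tmul _ _ _) ?_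
    exact GrayMarked.cast' (X := gray X Y) (Y := Z) _ (GrayMarked.left (X := gray X Y) (Y := Z) (tmul x y) z
      (GrayMarked.left x y hx))
  | @right k l x w hw =>
    cases hw with
    | degenerate _ hw =>
      exact .degenerate _ (ap_mem_degenerate _ (tmul_mem_degenerate_right x hw))
    | left y z hy =>
      refine GrayMarked.of_eq (X := gray X Y) (Y := Z) (inv_associator_tmul _ _ _) ?_
      exact GrayMarked.cast' (X := gray X Y) (Y := Z) _ (GrayMarked.left (X := gray X Y) (Y := Z) (tmul x y) z
        (GrayMarked.right x y hy))
    | right y z hz =>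
      refine GrayMarked.of_eq (X := gray X Y) (Y := Z) (inv_associator_tmul _ _ _) ?_
      exact GrayMarked.cast' (X := gray X Y) (Y := Z) _ (GrayMarked.right (X := gray X Y) (Y := Z) (tmul x y) z hz)

/-- The unit, the minimally marked `0`-cube. -/
noncomputable def point : MarkedCSet.{u} := flat (𝟙_ CSet.{u})

lemma cast_mem (X : MarkedCSet.{u}) {m n : ℕ} (h : m = n) {x : X.toCSet.cubes n}
    (hx : x ∈ X.marked n) : X.toCSet.act (Box.castIso h).hom x ∈ X.marked m := by
  subst h
  have : (Box.castIso (rfl : m = m)).hom = 𝟙 _ := rfl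
  rwa [this, act_id]

lemma leftUnitor_marked {X : MarkedCSet.{u}} (n : ℕ) (c : (gray point X).toCSet.cubes n)
    (hc : c ∈ (gray point X).marked n) : ap (λ_ X.toCSet).hom c ∈ X.marked n := by
  cases hc with
  | degenerate _ hc => exact X.degenerate_le _ (ap_mem_degenerate _ hc)
  | left x y hx =>
    exact X.degenerate_le _ (ap_mem_degenerate _ (tmul_mem_degenerate_left hx y))
  | @right k l x y hy =>
    cases k with
    | zero =>
      obtain rfl := unit_zero x
      refine mem_of_eq X (leftUnitor_tmul _) ?_
      exact cast_mem _ _ hy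
    | succ k =>
      exact X.degenerate_le _
        (ap_mem_degenerate _ (tmul_mem_degenerate_left (mem_degenerate_unit x) y))

lemma rightUnitor_marked {X : MarkedCSet.{u}} (n : ℕ) (c : (gray X point).toCSet.cubes n)
    (hc : c ∈ (gray X point).marked n) : ap (ρ_ X.toCSet).hom c ∈ X.marked n := by
  cases hc with
  | degenerate _ hc => exact X.degenerate_le _ (ap_mem_degenerate _ hc)
  | right x y hy =>
    exact X.degenerate_le _ (ap_mem_degenerate _ (tmul_mem_degenerate_right x hy))
  | @left k l x y hx =>
    cases l with
    | zero =>
      obtain rfl := unit_zero y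
      refine mem_of_eq X (rightUnitor_tmul _) ?_
      exact cast_mem _ _ hx
    | succ l =>
      exact X.degenerate_le _
        (ap_mem_degenerate _ (tmul_mem_degenerate_right x (mem_degenerate_unit y)))

lemma inv_leftUnitor_marked {X : MarkedCSet.{u}} (n : ℕ) (x : X.toCSet.cubes n)
    (hx : x ∈ X.marked n) : ap (λ_ X.toCSet).inv x ∈ (gray point X).marked n := by
  have h := congrArg (ap (λ_ X.toCSet).inv) (leftUnitor_tmul x)
  rw [← CSet.ap_comp, Iso.hom_inv_id, CSet.ap_id, ap_act] at h
  have h2 := congrArg ((𝟙_ CSet.{u} ⊗ X.toCSet).act (Box.castIso (Nat.zero_add n)).inv) h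
  rw [act_act, Iso.inv_hom_id, act_id] at h2
  rw [← h2]
  exact GrayMarked.cast' (X := point) (Y := X) _ (GrayMarked.right (X := point) (Y := X) one x hx)

lemma inv_rightUnitor_marked {X : MarkedCSet.{u}} (n : ℕ) (x : X.toCSet.cubes n)
    (hx : x ∈ X.marked n) : ap (ρ_ X.toCSet).inv x ∈ (gray X point).marked n := by
  have h := congrArg (ap (ρ_ X.toCSet).inv) (rightUnitor_tmul x)
  rw [← CSet.ap_comp, Iso.hom_inv_id, CSet.ap_id, ap_act] at h
  have h2 := congrArg ((X.toCSet ⊗ 𝟙_ CSet.{u}).act (Box.castIso (Nat.add_zero n)).inv) h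
  rw [act_act, Iso.inv_hom_id, act_id] at h2
  rw [← h2]
  exact GrayMarked.cast' (X := X) (Y := point) _ (GrayMarked.left (X := X) (Y := point) x one hx)

noncomputable instance : MonoidalCategoryStruct MarkedCSet.{u} where
  tensorObj := gray
  tensorHom := grayMap
  whiskerLeft X _ _ f := grayMap (𝟙 X) f
  whiskerRight f Y := grayMap f (𝟙 Y)
  tensorUnit := point
  associator X Y Z := isoMk (α_ X.toCSet Y.toCSet Z.toCSet) associator_marked inv_associator_marked
  leftUnitor X := isoMk (λ_ X.toCSet) leftUnitor_marked inv_leftUnitor_marked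
  rightUnitor X := isoMk (ρ_ X.toCSet) rightUnitor_marked inv_rightUnitor_marked

noncomputable instance : MonoidalCategory MarkedCSet.{u} :=
  Monoidal.induced forget
    { μIso := fun X Y => Iso.refl _
      εIso := Iso.refl _
      whiskerLeft_eq := fun X _ _ f => by
        change (𝟙 X.toCSet ⊗ₘ f.map) = 𝟙 _ ≫ (X.toCSet ◁ f.map) ≫ 𝟙 _
        simp
      whiskerRight_eq := fun f Y => by
        change (f.map ⊗ₘ 𝟙 Y.toCSet) = 𝟙 _ ≫ (f.map ▷ Y.toCSet) ≫ 𝟙 _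
        simp
      tensorHom_eq := fun f g => by
        change (f.map ⊗ₘ g.map) = 𝟙 _ ≫ (f.map ⊗ₘ g.map) ≫ 𝟙 _
        simp
      associator_eq := fun X Y Z => by
        change (α_ X.toCSet Y.toCSet Z.toCSet).hom = 𝟙 ((X.toCSet ⊗ Y.toCSet) ⊗ Z.toCSet) ≫
          (𝟙 (X.toCSet ⊗ Y.toCSet) ▷ Z.toCSet) ≫ (α_ X.toCSet Y.toCSet Z.toCSet).hom ≫
          (𝟙 X.toCSet ⊗ₘ 𝟙 (Y.toCSet ⊗ Z.toCSet)) ≫ 𝟙 _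
        simp
      leftUnitor_eq := fun X => by
        change (λ_ X.toCSet).hom = 𝟙 (𝟙_ CSet.{u} ⊗ X.toCSet) ≫ (𝟙 (𝟙_ CSet.{u}) ▷ X.toCSet) ≫
          (λ_ X.toCSet).hom
        simp
      rightUnitor_eq := fun X => by
        change (ρ_ X.toCSet).hom = 𝟙 (X.toCSet ⊗ 𝟙_ CSet.{u}) ≫ (X.toCSet ◁ 𝟙 (𝟙_ CSet.{u})) ≫
          (ρ_ X.toCSet).hom
        simp }

end MarkedCSet

lemma IsElemEpi.lt {m n : ℕ} {f : (Fin m → Bool) → (Fin n → Bool)} (hf : IsElemEpi f) : n < m := by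
  cases hf <;> omega

namespace PreComp

/-- Simplices of dimension `> n` of the `n`-th tensor power are marked. -/
lemma mem_cube_marked_of_lt {n m : ℕ} (h : n < m) (s : (cube.{u} n).simplices m) :
    s ∈ (cube n).obj.marked m := by
  by_contra hs
  obtain ⟨i, hi, -⟩ := (not_mem_cube_marked_iff n s).1 hs
  have := Fintype.card_le_of_injective i hi.injective
  simp at this
  omega

/-- The triangulation of the marked `n`-cube, `n ≥ 1`: the `(n - 1)`-truncation of the tensor power. -/
noncomputable def markedCube (n : ℕ) : MarkedSSet.{u} := MarkedSSet.trunc (n - 1) (cube n).obj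

/-- The cubical set of maps from the tensor powers of the interval to `Y`. -/
noncomputable def singCSet (Y : PreComp.{u}) : CSet.{u} where
  functor := cubes.op ⋙ yoneda.obj Y

lemma singCSet_act (Y : PreComp.{u}) {m n : ℕ} (f : (⟨m⟩ : Box) ⟶ ⟨n⟩)
    (s : Y.singCSet.cubes n) : Y.singCSet.act f s = (cubeMap f ≫ s : cube m ⟶ Y) := rfl

/-- The marked cubical set of maps `f : (Δ[1])^{⊗ n} ⟶ Y`; such an `f` is marked if `n ≥ 1` and it extends
to the triangulation of the marked `n`-cube. -/
noncomputable def sing (Y : PreComp.{u}) : MarkedCSet.{u} where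
  toCSet := Y.singCSet
  marked n := {f | n ≠ 0 ∧ ∃ g : markedCube n ⟶ Y.obj, g.map = (show cube n ⟶ Y from f).hom.map}
  not_marked_zero _ h := h.1 rfl
  degenerate_le m := by
    rintro _ ⟨n, e, he, f, rfl⟩
    have hnm : n < m := he.lt
    refine ⟨by omega, ⟨(cubeMap e ≫ (show cube n ⟶ Y from f)).hom.map, fun r s hs => ?_⟩, rfl⟩
    rcases hs with hs | hs
    · exact (cubeMap e ≫ (show cube n ⟶ Y from f)).hom.map_marked r s hs
    · exact (show cube n ⟶ Y from f).hom.map_marked r (ap (cubeMap e) s)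
        (mem_cube_marked_of_lt (by omega) _)

/-- Functoriality of the above. -/
noncomputable def singMap {Y Z : PreComp.{u}} (h : Y ⟶ Z) : Y.sing ⟶ Z.sing where
  map := ⟨Functor.whiskerLeft cubes.op (yoneda.map h)⟩
  map_marked n f := by
    rintro ⟨hn, g, hg⟩
    exact ⟨hn, g ≫ h.hom, by rw [MarkedSSet.comp_map, hg]; rfl⟩

end PreComp

open PreComp

/-- The right adjoint of the triangulation. -/
noncomputable def cubicalNerve : PreComp.{u} ⥤ MarkedCSet.{u} where
  obj Y := Y.sing
  map h := singMap h
  map_id Y := by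
    apply MarkedCSet.hom_ext
    apply CSet.hom_ext
    intro n x
    exact Category.comp_id (X := cube n) (Y := Y) x
  map_comp g h := by
    apply MarkedCSet.hom_ext
    apply CSet.hom_ext
    intro n x
    exact (Category.assoc (W := cube n) x g h).symm

namespace MarkedSSet

/-- The pre-complicial reflection: the smallest pre-complicial marking containing the given one. -/
def preReflection (X : MarkedSSet.{u}) : MarkedSSet.{u} where
  toSSet := X.toSSet
  marked n := {x | ∀ (M : (m : ℕ) → Set (X.toSSet.obj (op (.mk m))))
    (h₀ : ∀ x, x ∉ M 0) (h₁ : ∀ m, X.toSSet.degenerate m ⊆ M m),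
    (∀ m, X.marked m ⊆ M m) → IsPreComplicial ⟨X.toSSet, M, h₀, h₁⟩ → x ∈ M n}
  not_marked_zero x hx := by
    refine absurd (hx (fun m => {_x | m ≠ 0}) (fun x h => h rfl) (fun m x hx => ?_)
      (fun m x hx => ?_) ?_) (fun h => h rfl)
    · rintro rfl
      simp at hx
    · rintro rfl
      exact X.not_marked_zero _ hx
    · rw [isPreComplicial_iff]
      intro n k x _ m γ hγ
      have : n < m := lt_of_mem_range _ hγ
      intro h
      omega
  degenerate_le n x hx M h₀ h₁ _ _ := h₁ n hx

lemma preReflection_isPreComplicial (X : MarkedSSet.{u}) : IsPreComplicial (preReflection X) := by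
  rw [isPreComplicial_iff]
  intro n k x H m γ hγ M h₀ h₁ hM hM'
  exact (isPreComplicial_iff _).1 hM' n k x (fun m γ hγ => H m γ hγ M h₀ h₁ hM hM') m γ hγ

lemma marked_le_preReflection (X : MarkedSSet.{u}) (n : ℕ) :
    X.marked n ⊆ (preReflection X).marked n :=
  fun _ hx _ _ _ hM _ => hM n hx

/-- The universal property of the pre-complicial reflection. -/
def preLift {X Y : MarkedSSet.{u}} (hY : IsPreComplicial Y) (f : X ⟶ Y) : preReflection X ⟶ Y where
  map := f.map
  map_marked n x hx := by
    refine hx (fun m => {x | f.map.app _ x ∈ Y.marked m}) (fun x => Y.not_marked_zero _)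
      (fun m x hx => Y.degenerate_le _ (SSet.degenerate_app_apply hx f.map)) (fun m x hx => f.map_marked m x hx) ?_
    rw [isPreComplicial_iff] at hY ⊢
    intro n k x H m γ hγ
    have := hY n k (f.map.app _ x) (fun m γ hγ => by
      have := H m γ hγ
      rw [← NatTrans.naturality_apply]
      exact this) m γ hγ
    rw [← NatTrans.naturality_apply] at this
    exact this

end MarkedSSet

/-- The relation defining the coend of `X_n × (Δ[1])^n` over the box category. -/
inductive TRel (X : CSet.{u}) (Δ : SimplexCategoryᵒᵖ) :
    (Σ n : ℕ, X.cubes n × (cube.{u} n).obj.toSSet.obj Δ) →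
      (Σ n : ℕ, X.cubes n × (cube.{u} n).obj.toSSet.obj Δ) → Prop
  | mk {m n : ℕ} (f : (⟨m⟩ : Box) ⟶ ⟨n⟩) (x : X.cubes n) (φ : (cube.{u} m).obj.toSSet.obj Δ) :
      TRel X Δ ⟨m, X.act f x, φ⟩ ⟨n, x, (cubeMap f).hom.map.app Δ φ⟩

/-- The underlying simplicial set of the triangulation: the coend of `X_n × (Δ[1])^n`. -/
noncomputable def tSSet (X : CSet.{u}) : SSet.{u} where
  obj Δ := Quot (TRel X Δ)
  map {Δ Δ'} g := TypeCat.ofHom (Quot.map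
    (fun z => ⟨z.1, z.2.1, (cube z.1).obj.toSSet.map g z.2.2⟩) (by
      rintro _ _ ⟨f, x, φ⟩
      rw [← NatTrans.naturality_apply]
      exact TRel.mk f x _))
  map_id Δ := by
    ext ⟨z⟩
    exact congrArg (fun t => Quot.mk (TRel X Δ) ⟨z.1, z.2.1, t⟩)
      (ConcreteCategory.congr_hom ((cube.{u} z.1).obj.toSSet.map_id Δ) z.2.2)
  map_comp f g := by
    ext ⟨z⟩
    exact congrArg (fun t => Quot.mk (TRel X _) ⟨z.1, z.2.1, t⟩)
      (ConcreteCategory.congr_hom ((cube.{u} z.1).obj.toSSet.map_comp f g) z.2.2)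

/-- The simplex `[x, φ]`. -/
def tmk {X : CSet.{u}} {n m : ℕ} (x : X.cubes n) (φ : (cube.{u} n).simplices m) :
    (tSSet X).obj (op (.mk m)) := Quot.mk _ ⟨n, x, φ⟩

lemma tmk_act {X : CSet.{u}} {k n m : ℕ} (f : (⟨k⟩ : Box) ⟶ ⟨n⟩) (x : X.cubes n)
    (φ : (cube.{u} k).simplices m) : tmk (X.act f x) φ = tmk x (ap (cubeMap f) φ) :=
  Quot.sound (TRel.mk f x φ)

lemma exists_tmk {X : CSet.{u}} {m : ℕ} (z : (tSSet X).obj (op (.mk m))) :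
    ∃ (n : ℕ) (x : X.cubes n) (φ : (cube.{u} n).simplices m), tmk x φ = z := by
  obtain ⟨⟨n, x, φ⟩, rfl⟩ := Quot.exists_rep z
  exact ⟨n, x, φ, rfl⟩

lemma map_tmk {X : CSet.{u}} {n m m' : ℕ} (g : SimplexCategory.mk m' ⟶ .mk m) (x : X.cubes n)
    (φ : (cube.{u} n).simplices m) : (tSSet X).map g.op (tmk x φ) = tmk x ((cube n).act g φ) := rfl

/-- The map induced on coends. -/
noncomputable def tSSetMap {X Y : CSet.{u}} (f : X ⟶ Y) : tSSet X ⟶ tSSet Y where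
  app Δ := TypeCat.ofHom (Quot.map (fun z => ⟨z.1, CSet.ap f z.2.1, z.2.2⟩) (by
    rintro _ _ ⟨g, x, φ⟩
    rw [CSet.ap_act]
    exact TRel.mk g _ φ))
  naturality Δ Δ' g := by
    ext ⟨z⟩
    rfl

lemma tSSetMap_tmk {X Y : CSet.{u}} (f : X ⟶ Y) {n m : ℕ} (x : X.cubes n)
    (φ : (cube.{u} n).simplices m) : (tSSetMap f).app _ (tmk x φ) = tmk (CSet.ap f x) φ := rfl

/-- The colimit, in marked simplicial sets, of the triangulations of the cubes and the marked cubes of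
`X`: `[x, φ]` is marked if `φ` is marked in the tensor power, or `x` is marked and `φ` is marked in the
triangulation of the marked cube. -/
noncomputable def tMarked (X : MarkedCSet.{u}) : MarkedSSet.{u} where
  toSSet := tSSet X.toCSet
  marked m := {z | ∃ (n : ℕ) (x : X.toCSet.cubes n) (φ : (cube.{u} n).simplices m), tmk x φ = z ∧
    (φ ∈ (cube n).obj.marked m ∨ x ∈ X.marked n ∧ φ ∈ (markedCube n).marked m)}
  not_marked_zero := by
    rintro _ ⟨n, x, φ, rfl, h | ⟨-, h⟩⟩
    · exact (cube n).obj.not_marked_zero _ h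
    · exact (markedCube n).not_marked_zero _ h
  degenerate_le m := by
    rintro _ ⟨k, hk, g, z, rfl⟩
    obtain ⟨n, x, φ, rfl⟩ := exists_tmk z
    exact ⟨n, x, (cube n).act g φ, rfl, Or.inl ((cube n).obj.degenerate_le _ ⟨k, hk, g, φ, rfl⟩)⟩

/-- Functoriality of the above. -/
noncomputable def tMarkedMap {X Y : MarkedCSet.{u}} (f : X ⟶ Y) : tMarked X ⟶ tMarked Y where
  map := tSSetMap f.map
  map_marked m := by
    rintro _ ⟨n, x, φ, rfl, h⟩
    exact ⟨n, CSet.ap f.map x, φ, rfl, h.imp_right (And.imp_left (f.map_marked n x))⟩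

/-- The triangulation of `X`: the pre-complicial reflection of the colimit above. -/
noncomputable def tObj (X : MarkedCSet.{u}) : PreComp.{u} :=
  ⟨MarkedSSet.preReflection (tMarked X), MarkedSSet.preReflection_isPreComplicial _⟩

/-- The universal property of the triangulation. -/
noncomputable def tLift {X : MarkedCSet.{u}} {Y : PreComp.{u}} (f : tMarked X ⟶ Y.obj) :
    tObj X ⟶ Y :=
  ObjectProperty.homMk (MarkedSSet.preLift Y.property f)

/-- The unit of the pre-complicial reflection. -/
noncomputable def toPre (X : MarkedSSet.{u}) : X ⟶ MarkedSSet.preReflection X where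
  map := 𝟙 _
  map_marked n x hx := MarkedSSet.marked_le_preReflection X n hx

lemma tObj_hom_ext {X : MarkedCSet.{u}} {Y : PreComp.{u}} {f g : tObj X ⟶ Y}
    (h : ∀ (n m : ℕ) (x : X.toCSet.cubes n) (φ : (cube.{u} n).simplices m),
      ap (X := tObj X) f (tmk x φ) = ap (X := tObj X) g (tmk x φ)) : f = g := by
  apply PreComp.hom_ext
  intro m s
  obtain ⟨n, x, φ, rfl⟩ := exists_tmk s
  exact h n m x φ

/-- The triangulation functor from marked cubical sets to pre-complicial sets. -/
noncomputable def triangulation : MarkedCSet.{u} ⥤ PreComp.{u} where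
  obj X := tObj X
  map {X Y} f := tLift (tMarkedMap f ≫ toPre (tMarked Y))
  map_id X := tObj_hom_ext fun _ _ _ _ => rfl
  map_comp f g := tObj_hom_ext fun _ _ _ _ => rfl

/-- The map `(Δ[1])^{⊗ n} ⟶ T X` induced by an `n`-cube `x`. -/
noncomputable def cell {X : MarkedCSet.{u}} {n : ℕ} (x : X.toCSet.cubes n) :
    cube.{u} n ⟶ tObj X :=
  ObjectProperty.homMk
    { map :=
        { app := fun Δ => TypeCat.ofHom fun φ => Quot.mk _ ⟨n, x, φ⟩
          naturality := fun Δ Δ' g => rfl }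
      map_marked := fun m φ hφ =>
        MarkedSSet.marked_le_preReflection _ _ ⟨n, x, φ, rfl, Or.inl hφ⟩ }

lemma ap_cell {X : MarkedCSet.{u}} {n m : ℕ} (x : X.toCSet.cubes n)
    (φ : (cube.{u} n).simplices m) : ap (cell x) φ = tmk x φ := rfl

/-- From maps out of the triangulation to maps into the nerve. -/
noncomputable def transpose {X : MarkedCSet.{u}} {Y : PreComp.{u}} (h : tObj X ⟶ Y) : X ⟶ Y.sing where
  map := ⟨{ app := fun a => TypeCat.ofHom fun x => (cell (n := a.unop.dim) x ≫ h : cube a.unop.dim ⟶ Y)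
            naturality := fun a b g => by
              ext x
              apply PreComp.hom_ext (X := cube b.unop.dim)
              intro m s
              exact congrArg (ap (X := tObj X) h)
                (tmk_act (k := b.unop.dim) (n := a.unop.dim) g.unop x s) }⟩
  map_marked n x hx := by
    refine ⟨?_, ⟨(cell x ≫ h).hom.map, fun m φ hφ => ?_⟩, rfl⟩
    · rintro rfl
      exact X.not_marked_zero x hx
    · exact h.hom.map_marked m (tmk x φ)
        (MarkedSSet.marked_le_preReflection _ _ ⟨n, x, φ, rfl, Or.inr ⟨hx, hφ⟩⟩)

/-- The value of `k` on `x`, as a map out of the tensor power. -/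
noncomputable def cubeAp {X : MarkedCSet.{u}} {Y : PreComp.{u}} (k : X ⟶ Y.sing) {n : ℕ} (x : X.toCSet.cubes n) :
    cube.{u} n ⟶ Y := CSet.ap k.map x

/-- From maps into the nerve to maps out of the triangulation. -/
noncomputable def untranspose {X : MarkedCSet.{u}} {Y : PreComp.{u}} (k : X ⟶ Y.sing) :
    tObj X ⟶ Y :=
  tLift
    { map :=
        { app := fun Δ => TypeCat.ofHom (Quot.lift
            (fun z => (cubeAp k z.2.1).hom.map.app Δ z.2.2) (by
              rintro _ _ ⟨g, x, φ⟩
              have h : cubeAp k (X.toCSet.act g x) = cubeMap g ≫ cubeAp k x :=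
                CSet.ap_act k.map g x
              change (cubeAp k (X.toCSet.act g x)).hom.map.app Δ φ = _
              rw [h]
              rfl))
          naturality := fun Δ Δ' g => by
            ext ⟨z⟩
            exact NatTrans.naturality_apply (cubeAp k z.2.1).hom.map g z.2.2 }
      map_marked := by
        rintro m _ ⟨n, x, φ, rfl, h | ⟨hx, h⟩⟩
        · exact (cubeAp k x).hom.map_marked m φ h
        · obtain ⟨-, g, hg⟩ := k.map_marked n x hx
          have := g.map_marked m φ h
          rw [hg] at this
          exact this }

/-- The adjunction between triangulation and nerve. -/
noncomputable def triangulationAdj : triangulation.{u} ⊣ cubicalNerve.{u} :=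
  Adjunction.mkOfHomEquiv
    { homEquiv := fun X Y =>
        { toFun := fun h => transpose h
          invFun := fun k => untranspose k
          left_inv := fun h => tObj_hom_ext fun _ _ _ _ => rfl
          right_inv := fun k => by
            apply MarkedCSet.hom_ext
            apply CSet.hom_ext
            intro n x
            apply PreComp.hom_ext (X := cube n)
            intro m s
            rfl }
      homEquiv_naturality_left_symm := fun f g => tObj_hom_ext fun _ _ _ _ => rfl
      homEquiv_naturality_right := fun f g => by
        apply MarkedCSet.hom_ext
        apply CSet.hom_ext
        intro n x
        apply PreComp.hom_ext (X := cube n)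
        intro m s
        rfl }

/-- The simplex `(φ, ψ)` of `(Δ[1])^{⊗ (k + l)}`; the coordinates of `φ` come first. -/
noncomputable def pair {k l m : ℕ} (φ : (cube.{u} k).simplices m) (ψ : (cube.{u} l).simplices m) :
    (cube.{u} (k + l)).simplices m :=
  ofVert (k + l) (fun a => Fin.append (vert k φ a) (vert l ψ a)) (fun a b h i => by
    refine Fin.addCases (fun i => ?_) (fun i => ?_) i
    · simpa using vert_mono k φ h i
    · simpa using vert_mono l ψ h i)

/-- The simplex `[x, φ]` of the triangulation of `X`. -/
noncomputable def tSimplex {X : MarkedCSet.{u}} {n m : ℕ} (x : X.toCSet.cubes n) (φ : (cube.{u} n).simplices m) :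
    (triangulation.obj X).simplices m := tmk x φ

/-- The simplex `(s, t)` of a Gray tensor product. -/
noncomputable def prodMk {X Y : PreComp.{u}} {m : ℕ} (s : X.simplices m) (t : Y.simplices m) :
  (X ⊗ Y).simplices m := (s, t)

/-! ### Reformulations of the lifting property -/

section
open Simplicial

namespace MarkedSSet

/-! On underlying simplicial sets the comparison is a bijection for formal reasons. The geometric
product is a Day convolution and the triangulation is a coend, while a simplex of the `(k + l)`-cube
is the same thing as a pair of simplices of the `k`-cube and the `l`-cube. The inverse sends `[x ⊗
y, s]` to `([x, s₁], [y, s₂])`, where `s₁` and `s₂` are the two blocks of coordinates of `s`. All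
the content lies in the markings.

The inverse preserves markings by the universal property of the triangulation. Only the cubes `x ⊗
y` matter, and for `x` or `y` marked a count of dimensions suffices (`cellPair_mem_marked`).

For the comparison map itself, the source involves two pre-complicial reflections, whose marked
simplices have no explicit description. A simplex of a cube is unmarked exactly if it has a chain,
that is, increasing coordinates of which the `c`-th one jumps at step `c`. The basic fact is
`marked_of_chainFaces`: for a map from a cube to a pre-complicial `W`, a simplex has marked image as
soon as the nondegenerate faces spanned by its chains do. A step in which several coordinates jump
is split by an intermediate vertex at which only the larger ones have jumped. Faces through the new
vertex and both its neighbours jump in the wrong order, so they have no chain and are marked, and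
the lifting property reduces the simplex to two simpler ones.

The map `{0,1}ᵐ → [m]` taking a vertex to its largest nonzero coordinate carries this fact over to
products (`IsMediating.marked_of_cyl`): the image of a pair `(a, b)` is marked once those of all
cylinders are, the paths that first run through a front face of `a` and then through the
complementary back face of `b`. It therefore suffices that every cylinder on a marked `a`, or on a
marked `b`, has marked image. The simplices with this property are themselves the marked simplices
of a pre-complicial marking, up to vertices (`IsMediating.leftMarked_δ`,
`IsMediating.rightMarked_δ`). So the property passes from the generating marked simplices to the
reflections, and no description of the reflections is needed.

For a generator `[x, φ]`, `marked_of_chainFaces` applies once more. A chain face of a cylinder of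
dimension `p + q` over `x ⊗ y` is the top simplex of `x' ⊗ y'` for faces `x'` of dimension `p` and
`y'` of dimension `q`. If `[x, φ]` is marked because `x` is, dimensions force `x' = x`, so `x' ⊗ y'`
is a marked cube (`tmk_pair_cyl_mem`). The coherence conditions are checked on representatives. -/

lemma map_marked_of_forall_ne {X : MarkedSSet.{u}} {N : ℕ} (x : X.toSSet _⦋N + 1⦌) (j : Fin (N + 2))
    (hj : X.toSSet.map (SimplexCategory.δ j).op x ∈ X.marked N)
    (hall : ∀ (m : ℕ) (γ : ⦋m⦌ ⟶ ⦋N + 1⦌), (∀ i, i ∈ Set.range γ.toOrderHom) →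
      X.toSSet.map γ.op x ∈ X.marked m)
    {m : ℕ} (γ : ⦋m⦌ ⟶ ⦋N + 1⦌) (hγ : ∀ i ≠ j, i ∈ Set.range γ.toOrderHom) :
    X.toSSet.map γ.op x ∈ X.marked m := by
  by_cases hinj : Function.Injective γ.toOrderHom
  · by_cases hr : j ∈ Set.range γ.toOrderHom
    · refine hall m γ fun i => ?_
      by_cases hij : i = j
      · rwa [hij]
      · exact hγ i hij
    -- An injective operator that misses `j` has exactly the other vertices as its image, so it is
    -- the face `δ j`.
    · have hrange : Set.range γ.toOrderHom = Set.range j.succAbove := by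
        rw [Fin.range_succAbove]
        ext i
        exact ⟨fun hi hij => hr (by rwa [← Set.mem_singleton_iff.1 hij]), fun hi => hγ i hi⟩
      have hcard : m + 1 = N + 1 := by
        have h1 := Set.ncard_range_of_injective hinj
        have h2 := Set.ncard_range_of_injective (Fin.succAbove_right_injective (p := j))
        rw [hrange, h2] at h1
        simpa using h1.symm
      obtain rfl : m = N := by omega
      have : γ = SimplexCategory.δ j := by
        apply hom_ext'
        intro i
        have h1 : StrictMono (γ.toOrderHom : Fin (m + 1) → Fin (m + 2)) :=
          γ.toOrderHom.monotone.strictMono_of_injective hinj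
        exact congrArg Fin.val (congrFun ((StrictMono.range_inj h1 (Fin.strictMono_succAbove j)).1 hrange) i)
      rwa [this]
  · exact X.degenerate_le _ (map_mem_degenerate _ hinj x)

/-- A reformulation of the lifting property: it suffices that the faces containing `k - 1`, `k` and
`k + 1` and the two faces adjacent to the `k`-th one are marked. -/
lemma IsPreComplicial.marked_δ {X : MarkedSSet.{u}} (hX : IsPreComplicial X) {n : ℕ}
    (k : Fin (n + 3)) (x : X.toSSet _⦋n + 2⦌)
    (h1 : ∀ (m : ℕ) (γ : ⦋m⦌ ⟶ ⦋n + 2⦌),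
      (∀ j : ℕ, j ≤ n + 2 → j ≤ k + 1 → k ≤ j + 1 → Hits γ j) → X.toSSet.map γ.op x ∈ X.marked m)
    (h2 : ∀ j : Fin (n + 3), (j : ℕ) = k + 1 ∨ (j : ℕ) + 1 = k →
      X.toSSet.map (SimplexCategory.δ j).op x ∈ X.marked (n + 1)) :
    X.toSSet.map (SimplexCategory.δ k).op x ∈ X.marked (n + 1) := by
  have hall : ∀ (m : ℕ) (γ : ⦋m⦌ ⟶ ⦋n + 2⦌), (∀ i, i ∈ Set.range γ.toOrderHom) →
      X.toSSet.map γ.op x ∈ X.marked m := fun m γ hγ =>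
    h1 m γ fun j hj _ _ => (hits_iff γ ⟨j, by omega⟩).1 (hγ _)
  refine (isPreComplicial_iff X).1 hX n k x ?_ _ _ fun i hi => ?_
  · rintro m γ (hγ | ⟨j, hj, hγ⟩)
    · exact h1 m γ fun j hj h h' => (hits_iff γ ⟨j, by omega⟩).1 (hγ _ h h')
    · by_cases hadj : (j : ℕ) = k + 1 ∨ (j : ℕ) + 1 = k
      · exact map_marked_of_forall_ne x j (h2 j hadj) hall γ hγ
      -- A face lacking at most a vertex that is neither `k` nor adjacent to `k` still contains `k -
      -- 1`, `k` and `k + 1`.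
      · refine h1 m γ fun i hi h h' => (hits_iff γ ⟨i, by omega⟩).1 (hγ _ ?_)
        have : (j : ℕ) ≠ k := fun h => hj (Fin.ext h)
        simp only [ne_eq, Fin.ext_iff]
        omega
  · have : i ∈ Set.range k.succAbove := by rw [Fin.range_succAbove]; exact hi
    exact this

/-- It suffices to check the lifting property on the face opposite to `k`. -/
lemma isPreComplicial_of_δ {X : MarkedSSet.{u}}
    (H : ∀ (n : ℕ) (k : Fin (n + 3)) (x : X.toSSet _⦋n + 2⦌),
      (∀ (m : ℕ) (γ : ⦋m⦌ ⟶ ⦋n + 2⦌), IsGood k γ → X.toSSet.map γ.op x ∈ X.marked m) →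
      X.toSSet.map (SimplexCategory.δ k).op x ∈ X.marked (n + 1)) : IsPreComplicial X := by
  rw [isPreComplicial_iff]
  intro n k x hx m γ hγ
  exact map_marked_of_forall_ne x k (H n k x hx)
    (fun m γ hγ => hx m γ (Or.inl fun j _ _ => hγ j)) γ hγ

end MarkedSSet

/-! ### Splitting a step of a simplex of the cube -/

namespace PreComp

lemma act_ofVert {n m m' : ℕ} (g : ⦋m'⦌ ⟶ ⦋m⦌) (v : Fin (m + 1) → Fin n → Bool) (hv : Monotone v) :
    (cube.{u} n).act g (ofVert n v hv) =
      ofVert n (fun a => v (g.toOrderHom a)) (hv.comp g.toOrderHom.monotone) :=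
  vert_injective n fun a => by simp [vert_act]

lemma ofVert_vert {n m : ℕ} (s : (cube.{u} n).simplices m) :
    ofVert n (vert n s) (vert_mono n s) = s :=
  vert_injective n fun a => by simp

lemma ofVert_congr {n m : ℕ} {v w : Fin (m + 1) → Fin n → Bool} (h : v = w) (hv : Monotone v)
    (hw : Monotone w) : ofVert.{u} n v hv = ofVert n w hw := by
  subst h; rfl

lemma map_ofVert {n m m' : ℕ} {W : MarkedSSet.{u}} (f : (cube.{u} n).obj ⟶ W) (g : ⦋m'⦌ ⟶ ⦋m⦌)
    (v : Fin (m + 1) → Fin n → Bool) (hv : Monotone v) :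
    W.toSSet.map g.op (f.map.app _ (ofVert n v hv)) =
      f.map.app _ (ofVert n (fun a => v (g.toOrderHom a)) (hv.comp g.toOrderHom.monotone)) := by
  rw [← act_ofVert, ← NatTrans.naturality_apply]
  rfl

/-- The coordinates `i₁ < ... < iₘ` jump successively along `v`. -/
def IsJumpChain {n m : ℕ} (v : Fin (m + 1) → Fin n → Bool) (i : Fin m → Fin n) : Prop :=
  StrictMono i ∧ ∀ c : Fin m, v c.castSucc (i c) = false ∧ v c.succ (i c) = true

/-- The simplex in which the coordinates of a chain jump successively and the other ones are
constant: a coordinate that jumps together with a smaller coordinate of the chain is set to `1`,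
one that jumps together with a larger coordinate of the chain is set to `0`. -/
def chainFace {n m : ℕ} (v : Fin (m + 1) → Fin n → Bool) (i : Fin m → Fin n) (c : Fin (m + 1))
    (e : Fin n) : Bool :=
  -- For monotone `v`, `v d.succ e = true` holds from the step at which `e` jumps onwards. As `i`
  -- increases, some such `d` satisfies `i d < e` if and only if the jumping step itself does.
  decide (v 0 e = true ∨ ∃ d : Fin m, v d.succ e = true ∧ (i d < e ∨ i d = e ∧ (d : ℕ) < c))

lemma chainFace_mono {n m : ℕ} (v : Fin (m + 1) → Fin n → Bool) (i : Fin m → Fin n) :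
    Monotone (chainFace v i) := by
  intro a b hab e
  simp only [chainFace, Bool.le_iff_imp, decide_eq_true_eq]
  rintro (h | ⟨d, hd, h | ⟨h, h'⟩⟩)
  · exact Or.inl h
  · exact Or.inr ⟨d, hd, Or.inl h⟩
  · exact Or.inr ⟨d, hd, Or.inr ⟨h, h'.trans_le hab⟩⟩

section

variable {n m : ℕ} (v : Fin (m + 1) → Fin n → Bool) (d : Fin m) (t : Fin n)

/-- The vertex between `v d` and `v (d + 1)` in which the coordinates larger than `t` have jumped. -/
def splitVertex (e : Fin n) : Bool := v d.castSucc e || (v d.succ e && decide (t < e))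

variable {v}

lemma le_splitVertex : v d.castSucc ≤ splitVertex v d t := by
  intro e
  simp only [splitVertex, Bool.le_iff_imp]
  intro h
  simp [h]

lemma splitVertex_le (hv : Monotone v) : splitVertex v d t ≤ v d.succ := by
  intro e
  have := hv (Fin.castSucc_lt_succ (i := d)).le e
  simp only [splitVertex, Bool.le_iff_imp] at *
  simp only [Bool.or_eq_true, Bool.and_eq_true]
  rintro (h | h)
  · exact this h
  · exact h.1

/-- The simplex `v` with the split vertex inserted. -/
def splitInsert (v : Fin (m + 1) → Fin n → Bool) (j : Fin (m + 2)) : Fin n → Bool :=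
  if h : (j : ℕ) ≤ d then v ⟨j, by omega⟩
  else if (j : ℕ) = d + 1 then splitVertex v d t else v ⟨j - 1, by omega⟩

lemma splitInsert_mono (hv : Monotone v) : Monotone (splitInsert d t v) := by
  have hd : v d.castSucc ≤ _ := le_splitVertex d t
  have hd' := splitVertex_le d t hv
  intro a b hab
  have hab' : (a : ℕ) ≤ b := hab
  simp only [splitInsert]
  split_ifs with h1 h2 h3 h4 h5 h6 h7
  all_goals first
    | omega
    | exact le_rfl
    | exact hv (by simp only [Fin.mk_le_mk]; omega)
    | exact (hv (by simp only [Fin.le_def, Fin.val_castSucc]; omega)).trans hd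
    | exact hd'.trans (hv (by simp only [Fin.le_def, Fin.val_succ]; omega))

/-- Vertices of a simplex after insertion, with the new vertex removed. -/
lemma splitInsert_δ : (fun a : Fin (m + 1) => splitInsert d t v
    ((SimplexCategory.δ (⟨d + 1, by omega⟩ : Fin (m + 2))).toOrderHom a)) = v := by
  funext a
  change splitInsert d t v (Fin.succAbove _ a) = v a
  rcases lt_or_ge (a : ℕ) (d + 1) with h | h
  · rw [Fin.succAbove_of_castSucc_lt _ _ (by simpa [Fin.lt_def] using h)]
    simp [splitInsert, Nat.lt_succ_iff.1 h]
  · rw [Fin.succAbove_of_le_castSucc _ _ (by simpa [Fin.le_def] using h)]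
    have h1 : ¬ ((a : ℕ) + 1 ≤ d) := by omega
    have h2 : ¬ ((a : ℕ) = d) := by omega
    simp [splitInsert, h1, h2]

lemma splitInsert_δ_castSucc : (fun a : Fin (m + 1) => splitInsert d t v
    ((SimplexCategory.δ (⟨d, by omega⟩ : Fin (m + 2))).toOrderHom a)) =
      Function.update v d.castSucc (splitVertex v d t) := by
  funext a
  change splitInsert d t v (Fin.succAbove _ a) = _
  rcases lt_or_ge (a : ℕ) d with h | h
  · rw [Fin.succAbove_of_castSucc_lt _ _ (by simpa [Fin.lt_def] using h),
      Function.update_of_ne (by simp [Fin.ext_iff]; omega)]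
    simp [splitInsert, h.le]
  · rw [Fin.succAbove_of_le_castSucc _ _ (by simpa [Fin.le_def] using h)]
    have h1 : ¬ ((a : ℕ) + 1 ≤ d) := by omega
    by_cases h2 : (a : ℕ) = d
    · obtain rfl : a = d.castSucc := Fin.ext h2
      simp [splitInsert]
    · rw [Function.update_of_ne (by simpa [Fin.ext_iff] using h2)]
      simp [splitInsert, h1, h2]

lemma splitInsert_δ_succ : (fun a : Fin (m + 1) => splitInsert d t v
    ((SimplexCategory.δ (⟨d + 2, by omega⟩ : Fin (m + 2))).toOrderHom a)) =
      Function.update v d.succ (splitVertex v d t) := by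
  funext a
  change splitInsert d t v (Fin.succAbove _ a) = _
  rcases lt_or_ge (a : ℕ) (d + 2) with h | h
  · rw [Fin.succAbove_of_castSucc_lt _ _ (by simpa [Fin.lt_def] using h)]
    by_cases h2 : (a : ℕ) = d + 1
    · obtain rfl : a = d.succ := Fin.ext h2
      simp [splitInsert]
    · rw [Function.update_of_ne (by simpa [Fin.ext_iff] using h2)]
      have h3 : (a : ℕ) ≤ d := by omega
      simp [splitInsert, h3]
  · rw [Fin.succAbove_of_le_castSucc _ _ (by simpa [Fin.le_def] using h),
      Function.update_of_ne (by simp [Fin.ext_iff]; omega)]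
    have h1 : ¬ ((a : ℕ) + 1 ≤ d) := by omega
    have h2 : ¬ ((a : ℕ) = d) := by omega
    simp [splitInsert, h1, h2]

/-- A face that contains the inserted vertex and its neighbours has no chain. -/
lemma not_isJumpChain_splitInsert {r : ℕ} (γ : ⦋r⦌ ⟶ ⦋m + 1⦌) (h0 : Hits γ d) (h1 : Hits γ (d + 1))
    (h2 : Hits γ (d + 2)) : ¬ HasChain n (fun a => splitInsert d t v (γ.toOrderHom a)) := by
  rintro ⟨i, hi, hi'⟩
  -- Every step of a chain changes a coordinate, so `γ` repeats no vertex and hits the three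
  -- consecutive vertices at consecutive places.
  have hγ : StrictMono (γ.toOrderHom : Fin (r + 1) → Fin (m + 2)) := by
    rw [Fin.strictMono_iff_lt_succ]
    intro c
    refine lt_of_le_of_ne (γ.toOrderHom.monotone (Fin.castSucc_lt_succ (i := c)).le) fun h => ?_
    have h3 := hi' c
    simp only [h] at h3
    exact Bool.false_ne_true (h3.1.symm.trans h3.2)
  have key : ∀ (a b : Fin (r + 1)) (j : ℕ), (γ.toOrderHom a : ℕ) = j → (γ.toOrderHom b : ℕ) = j + 1 →
      ∃ c : Fin r, c.castSucc = a ∧ c.succ = b := by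
    intro a b j ha hb
    have hab : a < b := hγ.lt_iff_lt.1 (by rw [Fin.lt_def]; omega)
    have ha' : (a : ℕ) < r := by have := Fin.lt_def.1 hab; omega
    refine ⟨⟨a, ha'⟩, rfl, ?_⟩
    by_contra hne
    have hlt : (⟨a, ha'⟩ : Fin r).succ < b := by
      refine lt_of_le_of_ne ?_ hne
      rw [Fin.le_def]
      exact Nat.succ_le_of_lt hab
    have h3 := Fin.lt_def.1 (hγ hlt)
    have h4 := Fin.lt_def.1 (hγ (show a < (⟨a, ha'⟩ : Fin r).succ by simp [Fin.lt_def]))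
    omega
  obtain ⟨a0, h0⟩ := h0
  obtain ⟨a1, h1⟩ := h1
  obtain ⟨a2, h2⟩ := h2
  obtain ⟨c, hc, hc'⟩ := key a0 a1 _ h0 h1
  obtain ⟨c', hd, hd'⟩ := key a1 a2 _ h1 h2
  have hcc : c < c' := by
    have := congrArg Fin.val (hc'.trans hd.symm)
    simp at this
    rw [Fin.lt_def]
    omega
  -- Only coordinates larger than `t` jump on the way to the split vertex, and only coordinates at
  -- most `t` after it, whereas a chain has to jump in increasing order.
  have hlt := hi hcc
  have e1 := hi' c
  have e2 := hi' c'
  rw [hc, hc'] at e1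
  rw [hd, hd'] at e2
  simp only [splitInsert, h0, h1, h2] at e1 e2
  simp [splitVertex] at e1 e2
  obtain ⟨e1, e1'⟩ := e1
  obtain ⟨⟨e2, e3⟩, e4⟩ := e2
  have f1 := e1'.resolve_left (by
    intro h
    have : v d.castSucc (i c) = false := e1
    rw [this] at h
    cases h)
  exact absurd hlt (not_lt.2 ((e3 e4).trans f1.2.le))

/-- The reduction step: `marked_δ` is applied to the simplex with the split vertex inserted, at `k =
d + 1`. Faces through the split vertex and its neighbours have no chain and are marked. The two
adjacent faces are those in which the split vertex replaces one end of the step, and the face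
opposite to `k` is `v`. -/
lemma marked_of_split {W : MarkedSSet.{u}} (hW : IsPreComplicial W) (f : (cube.{u} n).obj ⟶ W)
    (hv : Monotone v)
    (h1 : ∀ h, f.map.app (op ⦋m⦌) (ofVert n (Function.update v d.castSucc (splitVertex v d t)) h) ∈
      W.marked m)
    (h2 : ∀ h, f.map.app (op ⦋m⦌) (ofVert n (Function.update v d.succ (splitVertex v d t)) h) ∈
      W.marked m) : f.map.app (op ⦋m⦌) (ofVert n v hv) ∈ W.marked m := by
  obtain ⟨m, rfl⟩ : ∃ m', m = m' + 1 := ⟨m - 1, by have := d.2; omega⟩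
  have hu := splitInsert_mono d t hv
  have := hW.marked_δ ⟨d + 1, by omega⟩ (f.map.app _ (ofVert n (splitInsert d t v) hu)) ?_ ?_
  · rw [map_ofVert, ofVert_congr (splitInsert_δ d t) _ hv] at this
    exact this
  · intro r γ hγ
    rw [map_ofVert]
    refine f.map_marked _ _ ?_
    by_contra hcon
    rw [not_mem_cube_marked_iff, vert_ofVert] at hcon
    refine not_isJumpChain_splitInsert d t γ ?_ ?_ ?_ hcon
    · exact hγ _ (by omega) (by simp; omega) (by simp)
    · exact hγ _ (by omega) (by simp) (by simp)
    · exact hγ _ (by omega) (by simp) (by simp)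
  · rintro ⟨j, hj⟩ (rfl | h)
    · rw [map_ofVert, ofVert_congr (splitInsert_δ_succ d t) _
        (splitInsert_δ_succ d t (v := v) ▸ hu.comp (SimplexCategory.δ _).toOrderHom.monotone)]
      exact h2 _
    · obtain rfl : j = d := by simpa using h
      rw [map_ofVert, ofVert_congr (splitInsert_δ_castSucc d t) _
        (splitInsert_δ_castSucc d t (v := v) ▸ hu.comp (SimplexCategory.δ _).toOrderHom.monotone)]
      exact h1 _

end

end PreComp
end

/-! ### From chain faces to arbitrary simplices of the cube -/

section
open Simplicial

namespace PreComp

section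

variable {n m : ℕ} {v : Fin (m + 1) → Fin n → Bool} {d : Fin m} {t : Fin n} {i : Fin m → Fin n}

lemma splitVertex_eq_true (e : Fin n) : splitVertex v d t e = true ↔
    v d.castSucc e = true ∨ v d.succ e = true ∧ t < e := by
  simp [splitVertex]

lemma splitVertex_eq_false (e : Fin n) : splitVertex v d t e = false ↔
    v d.castSucc e = false ∧ (v d.succ e = true → e ≤ t) := by
  simp [splitVertex]

/-- After the split vertex only the coordinates at most `t` are left to jump, and step `d` of the
chain must use one of them. -/
lemma le_of_isJumpChain_update
    (hi : IsJumpChain (Function.update v d.castSucc (splitVertex v d t)) i) : i d ≤ t := by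
  obtain ⟨h1, h2⟩ := hi.2 d
  rw [Function.update_self, splitVertex_eq_false] at h1
  rw [Function.update_of_ne (by simp [Fin.ext_iff])] at h2
  exact h1.2 h2

/-- Raising `v d` to the split vertex could create new chains only at the step ending there. Its
chain coordinate is smaller than `i d ≤ t`, and at such coordinates the split vertex agrees with `v
d`. -/
lemma isJumpChain_of_update
    (hi : IsJumpChain (Function.update v d.castSucc (splitVertex v d t)) i) : IsJumpChain v i := by
  have hdt := le_of_isJumpChain_update hi
  refine ⟨hi.1, fun c => ?_⟩
  obtain ⟨h1, h2⟩ := hi.2 c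
  constructor
  · by_cases hc : c = d
    · subst hc
      rw [Function.update_self, splitVertex_eq_false] at h1
      exact h1.1
    · rwa [Function.update_of_ne (by simpa [Fin.ext_iff] using hc)] at h1
  · by_cases hc : c.succ = d.castSucc
    · rw [hc, Function.update_self, splitVertex_eq_true] at h2
      rw [hc]
      refine h2.resolve_right fun h => ?_
      have hcd : c < d := by
        rw [Fin.lt_def]
        have := congrArg Fin.val hc
        simp at this
        omega
      exact absurd h.2 (not_lt.2 ((hi.1 hcd).le.trans hdt))
    · rwa [Function.update_of_ne hc] at h2

/-- The coordinates raised by the modification are larger than `t`, hence larger than `i d`, and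
jump together with `i d`. The chain face already gives them the constant value `1`. -/
lemma chainFace_update
    (hi : IsJumpChain (Function.update v d.castSucc (splitVertex v d t)) i) :
    chainFace (Function.update v d.castSucc (splitVertex v d t)) i = chainFace v i := by
  have hdt := le_of_isJumpChain_update hi
  have hle : ∀ c e, v c e = true →
      Function.update v d.castSucc (splitVertex v d t) c e = true := by
    intro c e h
    by_cases hc : c = d.castSucc
    · subst hc
      rw [Function.update_self, splitVertex_eq_true]
      exact Or.inl h
    · rwa [Function.update_of_ne hc]
  have hge : ∀ c e, Function.update v d.castSucc (splitVertex v d t) c e = true →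
      v c e = true ∨ v d.succ e = true ∧ t < e := by
    intro c e h
    by_cases hc : c = d.castSucc
    · subst hc
      rwa [Function.update_self, splitVertex_eq_true] at h
    · rw [Function.update_of_ne hc] at h
      exact Or.inl h
  funext c e
  rw [chainFace, chainFace, decide_eq_decide]
  constructor
  · rintro (h | ⟨d', h, h'⟩)
    · rcases hge _ _ h with h | ⟨h, h'⟩
      · exact Or.inl h
      · exact Or.inr ⟨d, h, Or.inl (hdt.trans_lt h')⟩
    · rcases hge _ _ h with h | ⟨h, h'⟩
      · exact Or.inr ⟨d', h, h'⟩
      · exact Or.inr ⟨d, h, Or.inl (hdt.trans_lt h')⟩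
  · rintro (h | ⟨d', h, h'⟩)
    · exact Or.inl (hle _ _ h)
    · exact Or.inr ⟨d', hle _ _ h, h'⟩

/-- Only coordinates larger than `t` jump on the way from `v d` to the split vertex. -/
lemma lt_of_isJumpChain_update_succ
    (hi : IsJumpChain (Function.update v d.succ (splitVertex v d t)) i) : t < i d := by
  obtain ⟨h1, h2⟩ := hi.2 d
  rw [Function.update_self, splitVertex_eq_true] at h2
  rw [Function.update_of_ne (by simp [Fin.ext_iff])] at h1
  refine (h2.resolve_left fun h => ?_).2
  rw [h1] at h
  cases h

/-- Lowering `v (d + 1)` to the split vertex changes only coordinates at most `t`. The chain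
coordinate of a following step exceeds `i d > t`, so it is not affected. -/
lemma isJumpChain_of_update_succ (hv : Monotone v)
    (hi : IsJumpChain (Function.update v d.succ (splitVertex v d t)) i) : IsJumpChain v i := by
  have hdt := lt_of_isJumpChain_update_succ hi
  refine ⟨hi.1, fun c => ?_⟩
  obtain ⟨h1, h2⟩ := hi.2 c
  constructor
  · by_cases hc : c.castSucc = d.succ
    · rw [hc, Function.update_self, splitVertex_eq_false] at h1
      rw [hc]
      by_contra h
      have hcd : d < c := by
        rw [Fin.lt_def]
        have := congrArg Fin.val hc
        simp at this
        omega
      exact absurd (h1.2 (by simpa using h)) (not_le.2 (hdt.trans (hi.1 hcd)))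
    · rwa [Function.update_of_ne hc] at h1
  · by_cases hc : c = d
    · subst hc
      rw [Function.update_self] at h2
      exact Bool.le_iff_imp.1 (splitVertex_le c t hv (i c)) h2
    · rwa [Function.update_of_ne (by simpa [Fin.ext_iff] using hc)] at h2

/-- In the defining condition the vertex `d.succ` is consulted only for coordinates `e ≥ i d > t`,
and there the modification has no effect. -/
lemma chainFace_update_succ (hv : Monotone v)
    (hi : IsJumpChain (Function.update v d.succ (splitVertex v d t)) i) :
    chainFace (Function.update v d.succ (splitVertex v d t)) i = chainFace v i := by
  have hdt := lt_of_isJumpChain_update_succ hi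
  have h0 : Function.update v d.succ (splitVertex v d t) 0 = v 0 :=
    Function.update_of_ne (Fin.succ_ne_zero d).symm _ _
  funext c e
  rw [chainFace, chainFace, decide_eq_decide, h0]
  refine or_congr_right (exists_congr fun d' => and_congr_left fun h => ?_)
  by_cases hd : d' = d
  · subst hd
    rw [Function.update_self, splitVertex_eq_true]
    constructor
    · rintro (h' | h')
      · exact Bool.le_iff_imp.1 (hv (Fin.castSucc_lt_succ (i := d')).le e) h'
      · exact h'.1
    · intro h'
      refine Or.inr ⟨h', hdt.trans_le ?_⟩
      rcases h with h | h
      · exact h.le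
      · exact h.1.le
  · rw [Function.update_of_ne (by simpa using hd)]

/-- The set of places where a simplex differs from the face determined by a chain. -/
def chainDefect (v : Fin (m + 1) → Fin n → Bool) (i : Fin m → Fin n) :
    Finset (Fin (m + 1) × Fin n) :=
  Finset.univ.filter fun p => v p.1 p.2 ≠ chainFace v i p.1 p.2

open scoped Classical in
/-- The sum of the sizes of the defects, a measure of the complexity of a simplex. -/
noncomputable def totalDefect (v : Fin (m + 1) → Fin n → Bool) : ℕ :=
  -- The summand `1` makes the total positive as soon as there is a chain, so that losing all chains
  -- is also a decrease.
  ∑ i ∈ (Finset.univ : Finset (Fin m → Fin n)).filter (IsJumpChain v), (1 + (chainDefect v i).card)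

/-- Chains may be lost but not gained, and each one that survives gets strictly closer to its chain
face. -/
lemma totalDefect_lt {w : Fin (m + 1) → Fin n → Bool} (hv : ∃ i, IsJumpChain v i)
    (h : ∀ i, IsJumpChain w i → IsJumpChain v i ∧ chainDefect w i ⊂ chainDefect v i) :
    totalDefect w < totalDefect v := by
  classical
  unfold totalDefect
  by_cases hw : ((Finset.univ : Finset (Fin m → Fin n)).filter (IsJumpChain w)).Nonempty
  · refine (Finset.sum_lt_sum_of_nonempty hw (g := fun i => 1 + (chainDefect v i).card) ?_).trans_le ?_
    · intro i hi
      have := Finset.card_lt_card (h i (by simpa using hi)).2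
      omega
    · refine Finset.sum_le_sum_of_subset fun i hi => ?_
      simpa using (h i (by simpa using hi)).1
  · rw [Finset.not_nonempty_iff_eq_empty] at hw
    rw [hw, Finset.sum_empty]
    obtain ⟨i, hi⟩ := hv
    refine Finset.sum_pos (fun _ _ => by omega) ⟨i, by simpa using hi⟩

/-- The vertex `d.castSucc` is changed to `1` precisely at coordinates `> t` that jump in step `d`,
where the chain face is constantly `1` because `i d ≤ t`. So defects only disappear, and the one at
`e` does. -/
lemma chainDefect_update {e : Fin n}
    (he : v d.castSucc e = false) (he' : v d.succ e = true) (het : t < e)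
    (hi : IsJumpChain (Function.update v d.castSucc (splitVertex v d t)) i) :
    chainDefect (Function.update v d.castSucc (splitVertex v d t)) i ⊂ chainDefect v i := by
  have hdt := le_of_isJumpChain_update hi
  have hA : ∀ e, v d.succ e = true → t < e → ∀ c, chainFace v i c e = true := fun e h h' c => by
    rw [chainFace, decide_eq_true_eq]
    exact Or.inr ⟨d, h, Or.inl (hdt.trans_lt h')⟩
  rw [Finset.ssubset_iff_of_subset]
  · refine ⟨(d.castSucc, e), ?_, ?_⟩
    · simp [chainDefect, he, hA e he' het]
    · simp only [chainDefect, Finset.mem_filter, Finset.mem_univ, true_and, not_not, chainFace_update hi,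
        hA e he' het, Function.update_self]
      exact (splitVertex_eq_true _).2 (Or.inr ⟨he', het⟩)
  · rintro ⟨c, e⟩ hc
    simp only [chainDefect, Finset.mem_filter, Finset.mem_univ, true_and, chainFace_update hi] at hc ⊢
    by_cases hcd : c = d.castSucc
    · subst hcd
      rw [Function.update_self] at hc
      by_cases hA' : v d.succ e = true ∧ t < e
      · exact absurd ((splitVertex_eq_true _).2 (Or.inr hA')) (by rw [hA e hA'.1 hA'.2] at hc; exact hc)
      · intro h
        apply hc
        rw [← h, Bool.eq_iff_iff, splitVertex_eq_true]
        tauto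
    · rwa [Function.update_of_ne hcd] at hc

/-- The vertex `d.succ` is changed to `0` precisely at coordinates `≤ t` that jump in step `d`.
There the chain face is `0`: the value `1` would need an index `d'` with `i d' ≤ t < i d`, hence `d'
< d`, by whose end such a coordinate has not yet jumped. -/
lemma chainDefect_update_succ (hv : Monotone v) {e : Fin n}
    (he : v d.castSucc e = false) (he' : v d.succ e = true) (het : e ≤ t)
    (hi : IsJumpChain (Function.update v d.succ (splitVertex v d t)) i) :
    chainDefect (Function.update v d.succ (splitVertex v d t)) i ⊂ chainDefect v i := by
  have hdt := lt_of_isJumpChain_update_succ hi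
  have hB : ∀ e, v d.castSucc e = false → e ≤ t → chainFace v i d.succ e = false := fun e h h' => by
    rw [chainFace, decide_eq_false_iff_not]
    rintro (h1 | ⟨d', h1, h2⟩)
    · rw [Bool.le_iff_imp.1 (hv (Fin.zero_le _) e) h1] at h
      cases h
    · have hid : i d' < i d := by
        rcases h2 with h2 | h2
        · exact h2.trans (h'.trans_lt hdt)
        · exact h2.1.trans_lt (h'.trans_lt hdt)
      have hd' : d' < d := (isJumpChain_of_update_succ hv hi).1.lt_iff_lt.1 hid
      rw [Bool.le_iff_imp.1 (hv (show d'.succ ≤ d.castSucc from hd') e) h1] at h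
      cases h
  rw [Finset.ssubset_iff_of_subset]
  · refine ⟨(d.succ, e), ?_, ?_⟩
    · simp [chainDefect, he', hB e he het]
    · simp only [chainDefect, Finset.mem_filter, Finset.mem_univ, true_and, not_not,
        chainFace_update_succ hv hi, hB e he het, Function.update_self]
      exact (splitVertex_eq_false _).2 ⟨he, fun _ => het⟩
  · rintro ⟨c, e⟩ hc
    simp only [chainDefect, Finset.mem_filter, Finset.mem_univ, true_and,
      chainFace_update_succ hv hi] at hc ⊢
    by_cases hcd : c = d.succ
    · subst hcd
      rw [Function.update_self] at hc
      by_cases hB' : v d.castSucc e = false ∧ e ≤ t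
      · refine absurd ((splitVertex_eq_false _).2 ⟨hB'.1, fun _ => hB'.2⟩) ?_
        rw [hB e hB'.1 hB'.2] at hc
        exact hc
      · intro h
        apply hc
        rw [← h, Bool.eq_iff_iff, splitVertex_eq_true]
        constructor
        · rintro (h' | h')
          · exact Bool.le_iff_imp.1 (hv (Fin.castSucc_lt_succ (i := d)).le e) h'
          · exact h'.1
        · intro h'
          by_cases h1 : v d.castSucc e = true
          · exact Or.inl h1
          · exact Or.inr ⟨h', not_le.1 fun h2 => hB' ⟨by simpa using h1, h2⟩⟩
    · rwa [Function.update_of_ne hcd] at hc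

lemma exists_jump (v : Fin (m + 1) → Fin n → Bool) {e : Fin n} (h0 : v 0 e = false)
    (c : Fin (m + 1)) (hc : v c e = true) :
    ∃ d : Fin m, (d : ℕ) < c ∧ v d.castSucc e = false ∧ v d.succ e = true := by
  induction c using Fin.induction with
  | zero => rw [h0] at hc; cases hc
  | succ c ih =>
    by_cases h : v c.castSucc e = true
    · obtain ⟨d, hd, h'⟩ := ih h
      exact ⟨d, by simp at hd ⊢; omega, h'⟩
    · exact ⟨c, by simp, by simpa using h, hc⟩

/-- If `v` is not the face determined by a chain, then some step of `v` can be split. -/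
lemma exists_split (hv : Monotone v) (hi : IsJumpChain v i) (hne : v ≠ chainFace v i) :
    ∃ (d : Fin m) (t : Fin n),
      (∃ e, v d.castSucc e = false ∧ v d.succ e = true ∧ t < e) ∧
      ∃ e, v d.castSucc e = false ∧ v d.succ e = true ∧ e ≤ t := by
  by_contra hcon
  -- If a second coordinate jumps together with `i d`, the smaller of the two serves as `t`. If none
  -- ever does, the chain accounts for all jumps of `v`, which is then its chain face.
  have key : ∀ (d : Fin m) (e : Fin n), v d.castSucc e = false → v d.succ e = true → e = i d := by
    intro d e h h'
    by_contra hed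
    rcases lt_or_gt_of_ne hed with hlt | hlt
    · exact hcon ⟨d, e, ⟨i d, (hi.2 d).1, (hi.2 d).2, hlt⟩, ⟨e, h, h', le_rfl⟩⟩
    · exact hcon ⟨d, i d, ⟨e, h, h', hlt⟩, ⟨i d, (hi.2 d).1, (hi.2 d).2, le_rfl⟩⟩
  apply hne
  funext c e
  rw [Bool.eq_iff_iff, chainFace, decide_eq_true_eq]
  by_cases h0 : v 0 e = true
  · simp [h0, Bool.le_iff_imp.1 (hv (Fin.zero_le c) e) h0]
  · have h0' : v 0 e = false := by simpa using h0
    constructor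
    · intro hc
      obtain ⟨d, hd, h1, h2⟩ := exists_jump v h0' c hc
      exact Or.inr ⟨d, h2, Or.inr ⟨(key d e h1 h2).symm, hd⟩⟩
    · rintro (h | ⟨d, h1, h2⟩)
      · exact absurd h h0
      · obtain ⟨d', h3, h4, h5⟩ := exists_jump v h0' _ h1
        have h6 := key d' e h4 h5
        have h7 : i d' ≤ i d := hi.1.monotone (by rw [Fin.le_def]; simp at h3; omega)
        rcases h2 with h2 | ⟨-, h2⟩
        · rw [h6] at h2
          exact absurd h2 (not_lt.2 h7)
        · exact Bool.le_iff_imp.1 (hv (show d.succ ≤ c from h2) e) h1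

end

/-- In a pre-complicial marking of the cube, a simplex is marked if the faces determined by its
chains are. -/
theorem marked_of_chainFaces {n m : ℕ} {W : MarkedSSet.{u}} (hW : IsPreComplicial W)
    (f : (cube.{u} n).obj ⟶ W) (v : Fin (m + 1) → Fin n → Bool) (hv : Monotone v)
    (H : ∀ i, IsJumpChain v i →
      f.map.app (op ⦋m⦌) (ofVert n (chainFace v i) (chainFace_mono v i)) ∈ W.marked m) :
    f.map.app (op ⦋m⦌) (ofVert n v hv) ∈ W.marked m := by
  by_cases hex : ∃ i, IsJumpChain v i
  · obtain ⟨i, hi⟩ := hex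
    by_cases hvi : v = chainFace v i
    · rw [ofVert_congr hvi hv (chainFace_mono v i)]
      exact H i hi
    · obtain ⟨d, t, ⟨e, he, he', het⟩, ⟨e₁, he₁, he₁', het₁⟩⟩ := exists_split hv hi hvi
      have lt1 : totalDefect (Function.update v d.castSucc (splitVertex v d t)) < totalDefect v :=
        totalDefect_lt ⟨i, hi⟩ fun j hj => ⟨isJumpChain_of_update hj, chainDefect_update he he' het hj⟩
      have lt2 : totalDefect (Function.update v d.succ (splitVertex v d t)) < totalDefect v :=
        totalDefect_lt ⟨i, hi⟩ fun j hj =>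
          ⟨isJumpChain_of_update_succ hv hj, chainDefect_update_succ hv he₁ he₁' het₁ hj⟩
      -- Every chain of either modified simplex is a chain of `v` with the same chain face, so the
      -- hypothesis on chain faces is inherited.
      refine marked_of_split d t hW f hv (fun h => ?_) (fun h => ?_)
      · refine marked_of_chainFaces hW f _ h fun j hj => ?_
        rw [ofVert_congr (chainFace_update hj) _ (chainFace_mono v j)]
        exact H j (isJumpChain_of_update hj)
      · refine marked_of_chainFaces hW f _ h fun j hj => ?_
        rw [ofVert_congr (chainFace_update_succ hv hj) _ (chainFace_mono v j)]
        exact H j (isJumpChain_of_update_succ hv hj)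
  · refine f.map_marked _ _ ?_
    by_contra hcon
    rw [not_mem_cube_marked_iff, vert_ofVert] at hcon
    exact hex hcon
termination_by totalDefect v

end PreComp

end

/-! ### Maps out of products, and reduction to cylinders -/

section
open Simplicial

namespace MarkedSSet

/-- The pair of two simplices, a simplex of the product. -/
def pr {A B : SSet.{u}} {m : ℕ} (a : A _⦋m⦌) (b : B _⦋m⦌) : (A ⊗ B : SSet.{u}) _⦋m⦌ := (a, b)

lemma map_pr {A B : SSet.{u}} {m m' : ℕ} (g : ⦋m'⦌ ⟶ ⦋m⦌) (a : A _⦋m⦌) (b : B _⦋m⦌) :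
    (A ⊗ B : SSet.{u}).map g.op (pr a b) = pr (A.map g.op a) (B.map g.op b) := rfl

/-- The degeneracy `[p + q] → [p]`, `i ↦ min i p`. -/
def fstProj (p q : ℕ) : ⦋p + q⦌ ⟶ ⦋p⦌ :=
  SimplexCategory.mkHom ⟨fun i => ⟨min (i : ℕ) p, by omega⟩, fun i j hij => by
    have : (i : ℕ) ≤ j := hij
    simp only [Fin.mk_le_mk]
    omega⟩

/-- The degeneracy `[p + q] → [q]`, `i ↦ i - p` (truncated). -/
def sndProj (p q : ℕ) : ⦋p + q⦌ ⟶ ⦋q⦌ :=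
  SimplexCategory.mkHom ⟨fun i => ⟨(i : ℕ) - p, by omega⟩, fun i j hij => by
    have : (i : ℕ) ≤ j := hij
    simp only [Fin.mk_le_mk]
    omega⟩

@[simp] lemma fstProj_apply (p q : ℕ) (i : Fin (p + q + 1)) :
    ((fstProj p q).toOrderHom i : ℕ) = min (i : ℕ) p := rfl
@[simp] lemma sndProj_apply (p q : ℕ) (i : Fin (p + q + 1)) :
    ((sndProj p q).toOrderHom i : ℕ) = i - p := rfl

/-- The simplex of the product that first traverses `a` and then `b`. -/
def cyl {A B : SSet.{u}} {p q : ℕ} (a : A _⦋p⦌) (b : B _⦋q⦌) : (A ⊗ B : SSet.{u}) _⦋p + q⦌ :=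
  pr (A.map (fstProj p q).op a) (B.map (sndProj p q).op b)

lemma map_hom_map {A : SSet.{u}} {l m n : ℕ} (g : ⦋l⦌ ⟶ ⦋m⦌) (h : ⦋m⦌ ⟶ ⦋n⦌) (a : A _⦋n⦌) :
    A.map g.op (A.map h.op a) = A.map (g ≫ h).op a := by
  rw [← Functor.map_comp_apply, ← op_comp]

/-- A simplicial map out of a product that sends mediating simplices, the pairs `(a α, b β)` for which
every front face of `α` or the complementary back face of `β` is degenerate, to marked ones. -/
def IsMediating {A B : SSet.{u}} {W : MarkedSSet.{u}} (f : A ⊗ B ⟶ W.toSSet) : Prop :=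
  ∀ (N N' r : ℕ) (a : A _⦋N⦌) (b : B _⦋N'⦌) (α : ⦋r⦌ ⟶ ⦋N⦌) (β : ⦋r⦌ ⟶ ⦋N'⦌),
    (∀ (p q : ℕ) (h : p + q = r), ¬ Function.Injective (front h ≫ α).toOrderHom ∨
      ¬ Function.Injective (back h ≫ β).toOrderHom) →
    f.app (op ⦋r⦌) (pr (A.map α.op a) (B.map β.op b)) ∈ W.marked r

end MarkedSSet

namespace PreComp

/-- The map `{0,1}ᵐ → [m]` sending a vertex to its largest (one-based) nonzero coordinate. -/
noncomputable def maxJump {m : ℕ} (x : Fin m → Bool) : Fin (m + 1) :=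
  Finset.univ.sup fun e => if x e = true then e.succ else 0

lemma maxJump_le_iff {m : ℕ} (x : Fin m → Bool) (k : Fin (m + 1)) :
    maxJump x ≤ k ↔ ∀ e, x e = true → e.succ ≤ k := by
  simp only [maxJump, Finset.sup_le_iff, Finset.mem_univ, true_implies]
  refine forall_congr' fun e => ?_
  split_ifs with h <;> simp [h]

lemma succ_le_maxJump {m : ℕ} {x : Fin m → Bool} {e : Fin m} (h : x e = true) :
    e.succ ≤ maxJump x := (maxJump_le_iff x _).1 le_rfl e h

lemma maxJump_mono {m : ℕ} : Monotone (maxJump (m := m)) := fun x y h => by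
  rw [maxJump_le_iff]
  exact fun e he => succ_le_maxJump (Bool.le_iff_imp.1 (h e) he)

lemma exists_succ_eq_maxJump {m : ℕ} {x : Fin m → Bool} (h : maxJump x ≠ 0) :
    ∃ e, x e = true ∧ e.succ = maxJump x := by
  have hne : (Finset.univ : Finset (Fin m)).Nonempty := by
    by_contra hcon
    rw [Finset.not_nonempty_iff_eq_empty] at hcon
    apply h
    rw [maxJump, hcon, Finset.sup_empty]
    rfl
  obtain ⟨e, -, he⟩ := Finset.exists_mem_eq_sup _ hne (fun e => if x e = true then e.succ else 0)
  refine ⟨e, ?_⟩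
  change maxJump x = _ at he
  by_cases hx : x e = true
  · exact ⟨hx, by rw [he, if_pos hx]⟩
  · rw [if_neg hx] at he
    exact absurd he h

lemma maxJump_eq {m : ℕ} {x : Fin m → Bool} {k : ℕ} (hk : k ≤ m)
    (h : ∀ e, x e = true ↔ (e : ℕ) < k) : (maxJump x : ℕ) = k := by
  apply le_antisymm
  · have : maxJump x ≤ ⟨k, by omega⟩ := by
      rw [maxJump_le_iff]
      intro e he
      have := (h e).1 he
      rw [Fin.le_def]
      simp
      omega
    exact this
  · rcases Nat.eq_zero_or_pos k with rfl | hk'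
    · exact Nat.zero_le _
    · have := succ_le_maxJump ((h ⟨k - 1, by omega⟩).2 (by simp; omega))
      rw [Fin.le_def] at this
      simp at this
      omega

lemma exists_jump_of_maxJump_lt {m : ℕ} {x y : Fin m → Bool} (h : maxJump x < maxJump y) :
    ∃ e, x e = false ∧ y e = true ∧ (e : ℕ) + 1 = maxJump y := by
  obtain ⟨e, he, he'⟩ := exists_succ_eq_maxJump (x := y) (fun h' => by
    rw [h'] at h
    exact absurd h (Fin.not_lt_zero _))
  refine ⟨e, ?_, he, congrArg Fin.val he'⟩
  by_contra hx
  exact absurd h (not_lt.2 (he' ▸ succ_le_maxJump (by simpa using hx)))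

/-- If `maxJump` increases strictly, first in the first `k` and then in the last `l` coordinates, then
there is a chain. -/
lemma hasChain_of_maxJump_lt {k l r : ℕ} (v : Fin (r + 1) → Fin (k + l) → Bool) (hv : Monotone v) (p : ℕ)
    (h1 : ∀ c : Fin r, (c : ℕ) < p →
      maxJump (fun e => v c.castSucc (Fin.castAdd l e)) < maxJump (fun e => v c.succ (Fin.castAdd l e)))
    (h2 : ∀ c : Fin r, p ≤ (c : ℕ) →
      maxJump (fun e => v c.castSucc (Fin.natAdd k e)) < maxJump (fun e => v c.succ (Fin.natAdd k e))) :
    HasChain (k + l) v := by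
  have hmono1 : Monotone fun c => maxJump (fun e => v c (Fin.castAdd l e)) :=
    fun a b hab => maxJump_mono fun e => hv hab _
  have hmono2 : Monotone fun c => maxJump (fun e => v c (Fin.natAdd k e)) :=
    fun a b hab => maxJump_mono fun e => hv hab _
  -- Step `c` of the chain takes the new largest nonzero coordinate of the relevant block. It was
  -- zero before because the maximum has grown.
  have (c : Fin r) : ∃ e, (v c.castSucc e = false ∧ v c.succ e = true) ∧
      ((c : ℕ) < p → (e : ℕ) + 1 = maxJump (fun e => v c.succ (Fin.castAdd l e))) ∧
      (p ≤ (c : ℕ) → (e : ℕ) + 1 = k + maxJump (fun e => v c.succ (Fin.natAdd k e))) := by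
    by_cases hc : (c : ℕ) < p
    · obtain ⟨e, h, h', h''⟩ := exists_jump_of_maxJump_lt (h1 c hc)
      exact ⟨Fin.castAdd l e, ⟨h, h'⟩, fun _ => h'', fun h => absurd hc (by omega)⟩
    · obtain ⟨e, h, h', h''⟩ := exists_jump_of_maxJump_lt (h2 c (by omega))
      exact ⟨Fin.natAdd k e, ⟨h, h'⟩, fun h => absurd h hc, fun _ => by
        rw [← h'', Fin.val_natAdd]; omega⟩
  choose i hi hi1 hi2 using this
  refine ⟨i, fun a b hab => ?_, hi⟩
  rw [Fin.lt_def]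
  have hab' : (a : ℕ) < b := hab
  have hle : a.succ ≤ b.castSucc := hab
  rcases lt_or_ge (b : ℕ) p with hb | hb
  · have e1 := hi1 a (by omega)
    have e2 := hi1 b hb
    have e3 := Fin.lt_def.1 (h1 b hb)
    have e4 := Fin.le_def.1 (hmono1 hle)
    simp only at e4
    omega
  · have e2 := hi2 b hb
    rcases lt_or_ge (a : ℕ) p with ha | ha
    · have e1 := hi1 a ha
      have e3 := Fin.lt_def.1 (h2 b hb)
      have e4 := (maxJump (fun e => v a.succ (Fin.castAdd l e))).2
      omega
    · have e1 := hi2 a ha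
      have e3 := Fin.lt_def.1 (h2 b hb)
      have e4 := Fin.le_def.1 (hmono2 hle)
      simp only at e4
      omega

end PreComp

namespace MarkedSSet

section

variable {A B : SSet.{u}} {W : MarkedSSet.{u}} {f : A ⊗ B ⟶ W.toSSet}

/-- The simplicial operator given by the largest nonzero coordinates among the first `k`. -/
noncomputable def fstJump {k l r : ℕ} (s : (cube.{u} (k + l)).simplices r) : ⦋r⦌ ⟶ ⦋k⦌ :=
  SimplexCategory.mkHom ⟨fun c => maxJump fun e => vert (k + l) s c (Fin.castAdd l e),
    fun _ _ hab => maxJump_mono fun _ => vert_mono _ s hab _⟩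

/-- The simplicial operator given by the largest nonzero coordinates among the last `l`. -/
noncomputable def sndJump {k l r : ℕ} (s : (cube.{u} (k + l)).simplices r) : ⦋r⦌ ⟶ ⦋l⦌ :=
  SimplexCategory.mkHom ⟨fun c => maxJump fun e => vert (k + l) s c (Fin.natAdd k e),
    fun _ _ hab => maxJump_mono fun _ => vert_mono _ s hab _⟩

lemma fstJump_act {k l r r' : ℕ} (g : ⦋r'⦌ ⟶ ⦋r⦌) (s : (cube.{u} (k + l)).simplices r) :
    fstJump ((cube.{u} (k + l)).act g s) = g ≫ fstJump s :=
  hom_ext' fun c => by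
    change (maxJump (fun e => vert (k + l) ((cube.{u} (k + l)).act g s) c (Fin.castAdd l e)) : ℕ) = _
    rw [vert_act]
    rfl

lemma sndJump_act {k l r r' : ℕ} (g : ⦋r'⦌ ⟶ ⦋r⦌) (s : (cube.{u} (k + l)).simplices r) :
    sndJump ((cube.{u} (k + l)).act g s) = g ≫ sndJump s :=
  hom_ext' fun c => by
    change (maxJump (fun e => vert (k + l) ((cube.{u} (k + l)).act g s) c (Fin.natAdd k e)) : ℕ) = _
    rw [vert_act]
    rfl

/-- The map from a cube given by a pair of simplices. -/
noncomputable def cubeToProd (f : A ⊗ B ⟶ W.toSSet) (hf : IsMediating f) {k l : ℕ} (a : A _⦋k⦌) (b : B _⦋l⦌) :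
    (cube.{u} (k + l)).obj ⟶ W where
  map :=
    { app := fun Δ => TypeCat.ofHom fun s => f.app (op ⦋Δ.unop.len⦌)
        (pr (A.map (fstJump (r := Δ.unop.len) s).op a) (B.map (sndJump (r := Δ.unop.len) s).op b))
      naturality := fun Δ Δ' g => by
        ext s
        have h1 := fstJump_act (r := Δ.unop.len) (r' := Δ'.unop.len) g.unop s
        have h2 := sndJump_act (r := Δ.unop.len) (r' := Δ'.unop.len) g.unop s
        change f.app (op ⦋Δ'.unop.len⦌) (pr
          (A.map (fstJump (r := Δ'.unop.len)
            ((cube.{u} (k + l)).act (m := Δ.unop.len) (m' := Δ'.unop.len) g.unop s)).op a)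
          (B.map (sndJump (r := Δ'.unop.len)
            ((cube.{u} (k + l)).act (m := Δ.unop.len) (m' := Δ'.unop.len) g.unop s)).op b)) = _
        rw [h1, h2, ← map_hom_map, ← map_hom_map, ← map_pr]
        exact NatTrans.naturality_apply f g _ }
  map_marked r s hs := by
    -- If the first operator were injective on a front face and the second on the complementary back
    -- face, the largest coordinates would grow strictly, first in one block and then in the other.
    -- That yields a chain, and `s` would not be marked.
    refine hf _ _ _ a b _ _ fun p q h => ?_
    by_contra hcon
    push Not at hcon
    obtain ⟨h1, h2⟩ := hcon
    have s1 : StrictMono ((front h ≫ fstJump s).toOrderHom : Fin (p + 1) → Fin (k + 1)) :=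
      (front h ≫ fstJump s).toOrderHom.monotone.strictMono_of_injective h1
    have s2 : StrictMono ((back h ≫ sndJump s).toOrderHom : Fin (q + 1) → Fin (l + 1)) :=
      (back h ≫ sndJump s).toOrderHom.monotone.strictMono_of_injective h2
    refine (not_mem_cube_marked_iff _ _).2 (hasChain_of_maxJump_lt _ (vert_mono _ s) p
      (fun c hc => ?_) (fun c hc => ?_)) hs
    · exact s1 (a := (⟨c, by omega⟩ : Fin (p + 1))) (b := (⟨c + 1, by omega⟩ : Fin (p + 1))) (by simp [Fin.lt_def])
    · have := s2 (a := (⟨c - p, by have := c.2; omega⟩ : Fin (q + 1)))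
        (b := (⟨c + 1 - p, by have := c.2; omega⟩ : Fin (q + 1))) (by simp [Fin.lt_def]; omega)
      have e1 : (back h).toOrderHom (⟨c - p, by have := c.2; omega⟩ : Fin (q + 1)) = c.castSucc := by
        ext; simp; omega
      have e2 : (back h).toOrderHom (⟨c + 1 - p, by have := c.2; omega⟩ : Fin (q + 1)) = c.succ := by
        ext; simp; omega
      rw [comp_val, comp_val, e1, e2] at this
      exact this

/-- When both blocks of every vertex are initial segments of ones, the largest nonzero coordinates
are the lengths of these segments, so the two operators can be read off. -/
lemma cubeToProd_ofVert (hf : IsMediating f) {k l r : ℕ} (a : A _⦋k⦌) (b : B _⦋l⦌)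
    (v : Fin (r + 1) → Fin (k + l) → Bool) (hv : Monotone v) (α : ⦋r⦌ ⟶ ⦋k⦌) (β : ⦋r⦌ ⟶ ⦋l⦌)
    (hα : ∀ c e, v c (Fin.castAdd l e) = true ↔ (e : ℕ) < α.toOrderHom c)
    (hβ : ∀ c e, v c (Fin.natAdd k e) = true ↔ (e : ℕ) < β.toOrderHom c) :
    (cubeToProd f hf a b).map.app (op ⦋r⦌) (ofVert _ v hv) =
      f.app (op ⦋r⦌) (pr (A.map α.op a) (B.map β.op b)) := by
  have h1 : fstJump (ofVert.{u} _ v hv) = α := hom_ext' fun c => by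
    refine maxJump_eq (val_le _ _) fun e => ?_
    rw [vert_ofVert]
    exact hα c e
  have h2 : sndJump (ofVert.{u} _ v hv) = β := hom_ext' fun c => by
    refine maxJump_eq (val_le _ _) fun e => ?_
    rw [vert_ofVert]
    exact hβ c e
  change f.app _ (pr (A.map (fstJump (ofVert.{u} _ v hv)).op a) (B.map (sndJump (ofVert.{u} _ v hv)).op b)) = _
  rw [h1, h2]

/-- A simplex of the product is marked if all the cylinders on a front face and the complementary
back face are marked. -/
theorem IsMediating.marked_of_cyl (hf : IsMediating f) (hW : IsPreComplicial W) {m : ℕ}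
    (a : A _⦋m⦌) (b : B _⦋m⦌)
    (H : ∀ (p q : ℕ) (h : p + q = m),
      f.app (op ⦋p + q⦌) (cyl (A.map (front h).op a) (B.map (back h).op b)) ∈ W.marked (p + q)) :
    f.app (op ⦋m⦌) (pr a b) ∈ W.marked m := by
  -- The diagonal simplex of the `2m`-cube: at vertex `c` the first `c` coordinates of each block
  -- are `1`. Its image is the pair `(a, b)`.
  let v : Fin (m + 1) → Fin (m + m) → Bool := fun c e => decide ((e : ℕ) < c ∨ m ≤ e ∧ (e : ℕ) < m + c)
  have hv' : ∀ c e, v c e = true ↔ ((e : ℕ) < c ∨ m ≤ e ∧ (e : ℕ) < m + c) := fun c e => by simp [v]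
  have hv : Monotone v := fun c d hcd e => by
    have : (c : ℕ) ≤ d := hcd
    rw [Bool.le_iff_imp, hv', hv']
    omega
  have h1 := cubeToProd_ofVert hf a b v hv (𝟙 _) (𝟙 _)
    (fun c e => by rw [hv']; simp) (fun c e => by rw [hv']; simp; omega)
  simp only [op_id, Functor.map_id_apply] at h1
  rw [← h1]
  refine marked_of_chainFaces hW _ v hv fun i hi => ?_
  -- At step `c` only `c` and `m + c` jump. As a chain increases, it uses the first block up to some
  -- step `p` and the second block from then on.
  obtain ⟨p, hpm, hp⟩ : ∃ p ≤ m, ∀ c : Fin m, (i c : ℕ) = if (c : ℕ) < p then (c : ℕ) else m + c := by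
    have hex : ∃ p : ℕ, ∀ c : Fin m, p ≤ c → m ≤ i c := ⟨m, fun c hc => absurd c.2 (by omega)⟩
    classical
    refine ⟨Nat.find hex, Nat.find_min' hex fun c hc => absurd c.2 (by omega), fun c => ?_⟩
    have h2 := (hi.2 c).1
    rw [← Bool.not_eq_true, hv', Fin.val_castSucc] at h2
    have h3 := (hv' _ _).1 (hi.2 c).2
    rw [Fin.val_succ] at h3
    have h4 : (c : ℕ) < Nat.find hex ↔ (i c : ℕ) < m := by
      constructor
      · intro h
        have := Nat.find_min hex h
        push Not at this
        obtain ⟨d, hd, hd'⟩ := this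
        have : i c ≤ i d := hi.1.monotone hd
        rw [Fin.le_def] at this
        omega
      · intro h
        by_contra h'
        have := Nat.find_spec hex c (by omega)
        omega
    split_ifs with h <;> omega
  obtain ⟨q, rfl⟩ := Nat.exists_eq_add_of_le hpm
  have hface : ∀ c e, chainFace v i c e = true ↔
      ∃ d : Fin (p + q), v d.succ e = true ∧ (i d < e ∨ i d = e ∧ (d : ℕ) < c) := fun c e => by
    rw [chainFace, decide_eq_true_eq, or_iff_right]
    rw [hv']
    simp
  -- In this chain face the coordinates of the first block from `p` on jump with a larger chain
  -- coordinate, so they stay `0`. The first `p` coordinates of the second block jump with a smaller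
  -- one, so they are `1` throughout. The segments have lengths `min c p` and `p + (c - p)`: this is
  -- the cylinder.
  rw [cubeToProd_ofVert hf a b _ (chainFace_mono v i) (fstProj p q ≫ front rfl) (sndProj p q ≫ back rfl)]
  · have := H p q rfl
    rw [cyl, map_hom_map, map_hom_map] at this
    exact this
  · intro c e
    rw [hface, comp_val, front_apply, fstProj_apply]
    simp only [hv', Fin.lt_def, Fin.ext_iff, hp, Fin.val_castAdd, Fin.val_succ]
    constructor
    · rintro ⟨d, h1, h2⟩
      split_ifs at h2 <;> omega
    · intro h
      refine ⟨⟨e, e.2⟩, by simp, ?_⟩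
      rw [if_pos (by simp; omega)]
      simp
      omega
  · intro c e
    rw [hface, comp_val, back_apply, sndProj_apply]
    simp only [hv', Fin.lt_def, Fin.ext_iff, hp, Fin.val_natAdd, Fin.val_succ]
    constructor
    · rintro ⟨d, h1, h2⟩
      split_ifs at h2 <;> omega
    · intro h
      refine ⟨⟨e, e.2⟩, by simp, ?_⟩
      simp only
      split_ifs <;> omega

end

end MarkedSSet

end

/-! ### The simplices with marked cylinders are closed under the lifting property -/

section
open Simplicial

namespace MarkedSSet

section operators

/-- The simplicial operator given by a monotone function (whose values are truncated). -/
def natHom (r N : ℕ) (φ : ℕ → ℕ) (hφ : ∀ i j, i ≤ j → φ i ≤ φ j) : ⦋r⦌ ⟶ ⦋N⦌ :=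
  SimplexCategory.mkHom ⟨fun i => ⟨min (φ i) N, by omega⟩, fun i j hij => by
    have := hφ _ _ (show (i : ℕ) ≤ j from hij)
    simp only [Fin.mk_le_mk]
    omega⟩

lemma δ_val {n : ℕ} (k : Fin (n + 2)) (i : Fin (n + 1)) :
    ((SimplexCategory.δ k).toOrderHom i : ℕ) = if (i : ℕ) < k then (i : ℕ) else i + 1 := by
  change ((k.succAbove i : Fin (n + 2)) : ℕ) = _
  simp only [Fin.succAbove, Fin.lt_def, Fin.val_castSucc]
  split_ifs <;> simp

lemma hits_δ {n : ℕ} (k : Fin (n + 2)) {j : ℕ} (hj : j ≤ n + 1) (hjk : j ≠ k) :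
    Hits (SimplexCategory.δ k) j := by
  rcases lt_or_gt_of_ne hjk with h | h
  · exact ⟨(⟨j, by omega⟩ : Fin (n + 1)), by rw [δ_val, if_pos h]⟩
  · refine ⟨(⟨j - 1, by omega⟩ : Fin (n + 1)), ?_⟩
    rw [δ_val, if_neg (by simp only; omega)]
    simp only
    omega

variable {p q r N M : ℕ}

lemma Hits.front {γ : ⦋r⦌ ⟶ ⦋N⦌} (h : p + q = r) {j : ℕ} (hj : Hits γ j)
    (hle : j ≤ (γ.toOrderHom (⟨p, by omega⟩ : Fin (r + 1)) : ℕ)) :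
    Hits (MarkedSSet.front h ≫ γ) j := by
  obtain ⟨i, rfl⟩ := hj
  by_cases hi : (i : ℕ) ≤ p
  · exact ⟨(⟨i, by omega⟩ : Fin (p + 1)), rfl⟩
  · refine ⟨Fin.last p, le_antisymm ?_ hle⟩
    exact γ.toOrderHom.monotone (show (⟨p, by omega⟩ : Fin (r + 1)) ≤ i by rw [Fin.le_def]; simp; omega)

lemma Hits.back {γ : ⦋r⦌ ⟶ ⦋N⦌} (h : p + q = r) {j : ℕ} (hj : Hits γ j)
    (hle : (γ.toOrderHom (⟨p, by omega⟩ : Fin (r + 1)) : ℕ) ≤ j) :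
    Hits (MarkedSSet.back h ≫ γ) j := by
  obtain ⟨i, rfl⟩ := hj
  by_cases hi : (i : ℕ) < p
  · refine ⟨(0 : Fin (q + 1)), le_antisymm hle ?_⟩
    exact γ.toOrderHom.monotone (show i ≤ (⟨p, by omega⟩ : Fin (r + 1)) by rw [Fin.le_def]; simp; omega)
  · have := i.2
    change _ < r + 1 at this
    refine ⟨(⟨i - p, by omega⟩ : Fin (q + 1)), ?_⟩
    rw [comp_val]
    congr 2
    ext
    simp
    omega

lemma Hits.comp {γ : ⦋r⦌ ⟶ ⦋N⦌} {j k : ℕ} (hj : Hits γ j) (α : ⦋N⦌ ⟶ ⦋M⦌)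
    (h : ∀ i : Fin (N + 1), (i : ℕ) = j → (α.toOrderHom i : ℕ) = k) : Hits (γ ≫ α) k := by
  obtain ⟨i, hi⟩ := hj
  exact ⟨i, h _ hi⟩

lemma not_injective_of_hits {γ : ⦋r⦌ ⟶ ⦋N⦌} {j k : ℕ} (hj : Hits γ j) (hk : Hits γ k) (hjk : j ≠ k)
    (α : ⦋N⦌ ⟶ ⦋M⦌) (h : ∀ i i' : Fin (N + 1), (i : ℕ) = j → (i' : ℕ) = k →
      (α.toOrderHom i : ℕ) = α.toOrderHom i') : ¬ Function.Injective (γ ≫ α).toOrderHom := by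
  obtain ⟨i, hi⟩ := hj
  obtain ⟨i', hi'⟩ := hk
  intro hinj
  have : i = i' := hinj (Fin.ext (h _ _ hi hi'))
  subst this
  exact hjk (hi.symm.trans hi')

end operators

variable {A B : SSet.{u}} {W : MarkedSSet.{u}} {f : A ⊗ B ⟶ W.toSSet}

/-- The simplices `a` all of whose cylinders `cyl a b` are marked. -/
def LeftMarked (f : A ⊗ B ⟶ W.toSSet) {p : ℕ} (a : A _⦋p⦌) : Prop :=
  ∀ (q : ℕ) (b : B _⦋q⦌), f.app (op ⦋p + q⦌) (cyl a b) ∈ W.marked (p + q)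

/-- The simplices `b` all of whose cylinders `cyl a b` are marked. -/
def RightMarked (f : A ⊗ B ⟶ W.toSSet) {q : ℕ} (b : B _⦋q⦌) : Prop :=
  ∀ (p : ℕ) (a : A _⦋p⦌), f.app (op ⦋p + q⦌) (cyl a b) ∈ W.marked (p + q)

/-- Cut the cylinder at `s`. For `s ≥ p` the front part contains all of the degenerate simplex. For
`s < p` the back part begins with two vertices that have second component `0`. So the cylinder is a
mediating simplex. -/
lemma IsMediating.leftMarked_of_not_injective (hf : IsMediating f) {p N : ℕ} (g : ⦋p⦌ ⟶ ⦋N⦌)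
    (hg : ¬ Function.Injective g.toOrderHom) (a : A _⦋N⦌) : LeftMarked f (A.map g.op a) := by
  intro q b
  rw [cyl, map_hom_map]
  refine hf _ _ _ _ _ _ _ fun s t h => ?_
  by_cases hs : p ≤ s
  · left
    intro hinj
    apply hg
    intro x y hxy
    have hx := x.2
    have hy := y.2
    change _ < p + 1 at hx hy
    have key : ∀ z : Fin (p + 1), (front h ≫ fstProj p q ≫ g).toOrderHom
        (⟨z, by omega⟩ : Fin (s + 1)) = g.toOrderHom z := fun z => by
      rw [comp_val, comp_val]
      congr 1
      ext
      simp
      omega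
    have := @hinj (⟨x, by omega⟩ : Fin (s + 1)) (⟨y, by omega⟩ : Fin (s + 1))
      ((key x).trans (hxy.trans (key y).symm))
    simp only [Fin.mk.injEq] at this
    exact Fin.ext this
  · right
    refine not_injective_of_eq _ (i := (0 : Fin (t + 1))) (j := (⟨1, by omega⟩ : Fin (t + 1)))
      (by simp [Fin.ext_iff]) (Fin.ext ?_)
    simp
    omega

/-- For a cut `s ≤ p` the back part contains all of the degenerate simplex; for `s > p` the front
part repeats the first component `p`. -/
lemma IsMediating.rightMarked_of_not_injective (hf : IsMediating f) {q N : ℕ} (g : ⦋q⦌ ⟶ ⦋N⦌)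
    (hg : ¬ Function.Injective g.toOrderHom) (b : B _⦋N⦌) : RightMarked f (B.map g.op b) := by
  intro p a
  rw [cyl, map_hom_map]
  refine hf _ _ _ _ _ _ _ fun s t h => ?_
  by_cases hs : s ≤ p
  · right
    intro hinj
    apply hg
    intro x y hxy
    have hx := x.2
    have hy := y.2
    change _ < q + 1 at hx hy
    have key : ∀ z : Fin (q + 1), (back h ≫ sndProj p q ≫ g).toOrderHom
        (⟨p - s + z, by omega⟩ : Fin (t + 1)) = g.toOrderHom z := fun z => by
      rw [comp_val, comp_val]
      congr 1
      ext
      simp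
      omega
    have := @hinj (⟨p - s + x, by omega⟩ : Fin (t + 1)) (⟨p - s + y, by omega⟩ : Fin (t + 1))
      ((key x).trans (hxy.trans (key y).symm))
    simp only [Fin.mk.injEq] at this
    exact Fin.ext (by omega)
  · left
    refine not_injective_of_eq _ (i := (⟨p, by omega⟩ : Fin (s + 1)))
      (j := (⟨p + 1, by omega⟩ : Fin (s + 1))) (by simp [Fin.ext_iff]) (Fin.ext ?_)
    simp

/-- The form of `IsMediating.marked_of_cyl` used below, for a path `(α, β)` in the grid `[N] × [M]`.
-/
lemma IsMediating.marked_of_path (hf : IsMediating f) (hW : IsPreComplicial W) {N M r : ℕ}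
    (a : A _⦋N⦌) (b : B _⦋M⦌) (α : ⦋r⦌ ⟶ ⦋N⦌) (β : ⦋r⦌ ⟶ ⦋M⦌)
    (H : ∀ (p q : ℕ) (h : p + q = r), LeftMarked f (A.map (front h ≫ α).op a) ∨
      RightMarked f (B.map (back h ≫ β).op b)) :
    f.app (op ⦋r⦌) (pr (A.map α.op a) (B.map β.op b)) ∈ W.marked r := by
  refine hf.marked_of_cyl hW _ _ fun p q h => ?_
  rw [map_hom_map, map_hom_map]
  exact (H p q h).elim (fun h => h _ _) (fun h => h _ _)

lemma map_app_pr {r r' N M : ℕ} (γ : ⦋r'⦌ ⟶ ⦋r⦌) (α : ⦋r⦌ ⟶ ⦋N⦌) (β : ⦋r⦌ ⟶ ⦋M⦌) (a : A _⦋N⦌)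
    (b : B _⦋M⦌) :
    W.toSSet.map γ.op (f.app (op ⦋r⦌) (pr (A.map α.op a) (B.map β.op b))) =
      f.app (op ⦋r'⦌) (pr (A.map (γ ≫ α).op a) (B.map (γ ≫ β).op b)) := by
  rw [← map_hom_map, ← map_hom_map, ← map_pr]
  exact (NatTrans.naturality_apply f γ.op _).symm

section left

variable {n q : ℕ} {a : A _⦋n + 2⦌} {k : Fin (n + 3)}

/-- The first component of the path through `a` and then a `q`-simplex. -/
def leftFst (n q : ℕ) : ⦋n + q + 2⦌ ⟶ ⦋n + 2⦌ := natHom _ _ (fun i => i) fun _ _ h => h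

/-- The second component of the path through `a` and then a `q`-simplex. -/
def leftSnd (n q : ℕ) : ⦋n + q + 2⦌ ⟶ ⦋q⦌ := natHom _ _ (fun i => i - (n + 2)) fun _ _ _ => by omega

lemma leftFst_apply (i : Fin (n + q + 3)) :
    ((leftFst n q).toOrderHom i : ℕ) = min (i : ℕ) (n + 2) := rfl
lemma leftSnd_apply (i : Fin (n + q + 3)) :
    ((leftSnd n q).toOrderHom i : ℕ) = min (i - (n + 2) : ℕ) q := rfl

/-- At each cut, either the front part still contains every vertex of `a` that makes `γ` good, and
the hypothesis on `a` applies, or one of these vertices lies strictly after the cut. In the latter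
case the back part is degenerate in its second component. -/
lemma IsMediating.marked_left_of_goodIn (hf : IsMediating f) (hW : IsPreComplicial W)
    (H : ∀ (m : ℕ) (γ : ⦋m⦌ ⟶ ⦋n + 2⦌), IsGood k γ → LeftMarked f (A.map γ.op a)) (b : B _⦋q⦌)
    {r : ℕ} (γ : ⦋r⦌ ⟶ ⦋n + q + 2⦌) (hγ : GoodIn 0 k (n + 2) γ) :
    f.app (op ⦋r⦌) (pr (A.map (γ ≫ leftFst n q).op a) (B.map (γ ≫ leftSnd n q).op b)) ∈
      W.marked r := by
  refine hf.marked_of_path hW _ _ _ _ fun s t h => ?_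
  have key : ∀ J : ℕ → Prop, (∀ j, j ≤ n + 2 → J j → Hits γ j) →
      (∀ j, j ≤ n + 2 → J j → Hits (front h ≫ γ ≫ leftFst n q) j) ∨
        ¬ Function.Injective (back h ≫ γ ≫ leftSnd n q).toOrderHom := by
    intro J hJ
    by_cases hall : ∀ j, j ≤ n + 2 → J j → Hits (front h ≫ γ ≫ leftFst n q) j
    · exact Or.inl hall
    · right
      push Not at hall
      obtain ⟨j, hj, hJj, hnot⟩ := hall
      rw [← Category.assoc] at hnot ⊢
      -- A required vertex missed by the front part comes after the cut vertex. Both lie in the back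
      -- part and precede the first step of `b`, so `leftSnd` sends both to `0`.
      have hlt : (γ.toOrderHom (⟨s, by omega⟩ : Fin (r + 1)) : ℕ) < j := by
        by_contra hle
        refine hnot (((hJ j hj hJj).front h (not_lt.1 hle)).comp _ fun i hi => ?_)
        rw [leftFst_apply]
        omega
      refine not_injective_of_hits ((hJ j hj hJj).back h hlt.le)
        (Hits.back h ⟨(⟨s, by omega⟩ : Fin (r + 1)), rfl⟩ le_rfl) hlt.ne' _ fun i i' hi hi' => ?_
      rw [leftSnd_apply, leftSnd_apply]
      omega
  rcases hγ with hγ | ⟨j, hj, h0, hj', hγ⟩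
  · refine (key (fun j => j ≤ k + 1 ∧ k ≤ j + 1) fun j hj hJ => hγ j (by omega) hj hJ.1 hJ.2).imp
      (fun h => H _ _ ((isGood_iff k _).2 (Or.inl fun j _ h1 h2 h3 => h j h1 ⟨h2, h3⟩)))
      (fun h => hf.rightMarked_of_not_injective _ h b)
  · refine (key (fun i => i ≠ j) fun i hi hJ => hγ i (by omega) hi hJ).imp
      (fun h => H _ _ ((isGood_iff k _).2 (Or.inr ⟨j, hj, h0, hj', fun i _ hi => h i hi⟩)))
      (fun h => hf.rightMarked_of_not_injective _ h b)

/-- The first component of the path in which the last step of `a` is taken after `j` steps of a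
`q`-simplex. -/
def leftShiftFst (n q j : ℕ) : ⦋n + q + 2⦌ ⟶ ⦋n + 2⦌ :=
  natHom _ _ (fun i => if i < n + 2 + j then min i (n + 1) else n + 2) fun _ _ _ => by
    split_ifs <;> omega

/-- The second component of the path in which the last step of `a` is taken after `j` steps of a
`q`-simplex. -/
def leftShiftSnd (n q j : ℕ) : ⦋n + q + 2⦌ ⟶ ⦋q⦌ :=
  natHom _ _ (fun i => if i < n + 2 + j then i - (n + 1) else i - (n + 2)) fun _ _ _ => by
    split_ifs <;> omega

lemma leftShiftFst_apply {j : ℕ} (i : Fin (n + q + 3)) : ((leftShiftFst n q j).toOrderHom i : ℕ) =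
    min (if (i : ℕ) < n + 2 + j then min (i : ℕ) (n + 1) else n + 2) (n + 2) := rfl
lemma leftShiftSnd_apply {j : ℕ} (i : Fin (n + q + 3)) : ((leftShiftSnd n q j).toOrderHom i : ℕ) =
    min (if (i : ℕ) < n + 2 + j then i - (n + 1) else i - (n + 2)) q := rfl

/-- For `k = n + 2`, deleting the corner of the cylinder yields a path that still ends at the last
vertex of `a`. The last step of `a` is therefore postponed through `b`. The `j`-th path passes
through `(n + 1, j)` and `(n + 2, j)`. Deleting the former leaves the same path as deleting `(n + 2,
j - 1)` from the preceding one, so the lifting property carries the marking from `j - 1` to `j`. At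
`j = q` the deleted vertex is the endpoint, and the cylinder on the face of `a` opposite to `k`
remains. -/
lemma IsMediating.marked_leftShift (hf : IsMediating f) (hW : IsPreComplicial W)
    (hk : (k : ℕ) = n + 2)
    (H : ∀ (m : ℕ) (γ : ⦋m⦌ ⟶ ⦋n + 2⦌), IsGood k γ → LeftMarked f (A.map γ.op a)) (b : B _⦋q⦌)
    (j : ℕ) (hj : j ≤ q) :
    f.app (op ⦋n + q + 1⦌)
      (pr (A.map (SimplexCategory.δ ⟨n + 2 + j, by omega⟩ ≫ leftShiftFst n q j).op a)
        (B.map (SimplexCategory.δ ⟨n + 2 + j, by omega⟩ ≫ leftShiftSnd n q j).op b)) ∈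
      W.marked (n + q + 1) := by
  have step : f.app (op ⦋n + q + 1⦌)
      (pr (A.map (SimplexCategory.δ ⟨n + 1 + j, by omega⟩ ≫ leftShiftFst n q j).op a)
        (B.map (SimplexCategory.δ ⟨n + 1 + j, by omega⟩ ≫ leftShiftSnd n q j).op b)) ∈
      W.marked (n + q + 1) := by
    -- The induction starts at the cylinder itself: without the vertex `n + 1` it is good because `n
    -- + 1 ≠ k`.
    cases j with
    | zero =>
      have e1 : leftShiftFst n q 0 = leftFst n q := hom_ext' fun i => by
        rw [leftShiftFst_apply, leftFst_apply]
        split_ifs <;> omega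
      have e2 : leftShiftSnd n q 0 = leftSnd n q := hom_ext' fun i => by
        rw [leftShiftSnd_apply, leftSnd_apply]
        split_ifs <;> omega
      rw [e1, e2]
      refine hf.marked_left_of_goodIn hW H b _ (Or.inr ⟨n + 1, by omega, by omega, by omega,
        fun i _ hi hi' => hits_δ _ (by omega) hi'⟩)
    | succ j =>
      have := IsMediating.marked_leftShift hf hW hk H b j (by omega)
      have e1 : SimplexCategory.δ (⟨n + 1 + (j + 1), by omega⟩ : Fin (n + q + 3)) ≫
          leftShiftFst n q (j + 1) =
          SimplexCategory.δ (⟨n + 2 + j, by omega⟩ : Fin (n + q + 3)) ≫ leftShiftFst n q j :=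
        hom_ext' fun i => by
          simp only [comp_val, leftShiftFst_apply, δ_val]
          split_ifs <;> omega
      have e2 : SimplexCategory.δ (⟨n + 1 + (j + 1), by omega⟩ : Fin (n + q + 3)) ≫
          leftShiftSnd n q (j + 1) =
          SimplexCategory.δ (⟨n + 2 + j, by omega⟩ : Fin (n + q + 3)) ≫ leftShiftSnd n q j :=
        hom_ext' fun i => by
          simp only [comp_val, leftShiftSnd_apply, δ_val]
          split_ifs <;> omega
      rw [e1, e2]
      exact this
  -- The vertices `(n + 1, j)` and `(n + 2, j)` differ only in the first component. A cut before the
  -- second of them leaves both in a degenerate back part. Otherwise the front part contains `k - 1`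
  -- and `k` in its first component, which suffices as `k` is the last vertex.
  have good : ∀ (m : ℕ) (γ : ⦋m⦌ ⟶ ⦋n + q + 2⦌), Hits γ (n + 1 + j) → Hits γ (n + 2 + j) →
      W.toSSet.map γ.op (f.app (op ⦋n + q + 2⦌)
        (pr (A.map (leftShiftFst n q j).op a) (B.map (leftShiftSnd n q j).op b))) ∈ W.marked m := by
    intro m γ h1 h2
    rw [map_app_pr]
    refine hf.marked_of_path hW _ _ _ _ fun s t h => ?_
    rw [← Category.assoc, ← Category.assoc]
    rcases lt_or_ge (γ.toOrderHom (⟨s, by omega⟩ : Fin (m + 1)) : ℕ) (n + 2 + j) with hs | hs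
    · right
      refine hf.rightMarked_of_not_injective _ (not_injective_of_hits (h1.back h (by omega))
        (h2.back h hs.le) (by omega) _ fun i i' hi hi' => ?_) b
      rw [leftShiftSnd_apply, leftShiftSnd_apply]
      split_ifs <;> omega
    · left
      refine H _ _ ((isGood_iff k _).2 (Or.inl fun i _ hi _ hi' => ?_))
      obtain rfl | rfl : i = n + 1 ∨ i = n + 2 := by omega
      · refine (h1.front h (by omega)).comp _ fun i hi => ?_
        rw [leftShiftFst_apply]
        split_ifs <;> omega
      · refine (h2.front h hs).comp _ fun i hi => ?_
        rw [leftShiftFst_apply]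
        split_ifs <;> omega
  have := hW.marked_δ (⟨n + 2 + j, by omega⟩ : Fin (n + q + 3)) _
    (fun m γ hγ => good m γ (hγ _ (by omega) (by simp only; omega) (by simp only; omega))
      (hγ _ (by omega) (by simp only; omega) (by simp only; omega))) ?_
  · rwa [map_app_pr] at this
  · rintro ⟨i, hi⟩ (hi' | hi')
    · simp only at hi'
      exact good _ _ (hits_δ _ (by omega) (by simp only; omega)) (hits_δ _ (by omega) (by simp only; omega))
    · obtain rfl : i = n + 1 + j := by simp only at hi'; omega
      rw [map_app_pr]
      exact step

/-- Needed since the dimensions `n + q + 1` and `n + 1 + q` agree only propositionally. -/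
lemma marked_cast {r r' N M : ℕ} (h : r = r') (a : A _⦋N⦌) (b : B _⦋M⦌) (α : ⦋r⦌ ⟶ ⦋N⦌)
    (β : ⦋r⦌ ⟶ ⦋M⦌) (α' : ⦋r'⦌ ⟶ ⦋N⦌) (β' : ⦋r'⦌ ⟶ ⦋M⦌)
    (hα : ∀ i : Fin (r' + 1), (α'.toOrderHom i : ℕ) = α.toOrderHom (⟨i, by omega⟩ : Fin (r + 1)))
    (hβ : ∀ i : Fin (r' + 1), (β'.toOrderHom i : ℕ) = β.toOrderHom (⟨i, by omega⟩ : Fin (r + 1)))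
    (H : f.app (op ⦋r⦌) (pr (A.map α.op a) (B.map β.op b)) ∈ W.marked r) :
    f.app (op ⦋r'⦌) (pr (A.map α'.op a) (B.map β'.op b)) ∈ W.marked r' := by
  subst h
  obtain rfl : α' = α := hom_ext' hα
  obtain rfl : β' = β := hom_ext' hβ
  exact H

/-- For `k < n + 2` the neighbours of `k` in the cylinder are its neighbours in `a`, and the face of
the cylinder opposite to `k` is the cylinder on the face of `a`. So the lifting property of `W`
applies directly. The last vertex needs the shifted paths. -/
lemma IsMediating.leftMarked_δ (hf : IsMediating f) (hW : IsPreComplicial W)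
    (H : ∀ (m : ℕ) (γ : ⦋m⦌ ⟶ ⦋n + 2⦌), IsGood k γ → LeftMarked f (A.map γ.op a)) :
    LeftMarked f (A.map (SimplexCategory.δ k).op a) := by
  intro q b
  rw [cyl, map_hom_map]
  rcases Nat.lt_or_ge k (n + 2) with hk | hk
  · have := (isPreComplicial_iff W).1 hW (n + q) ⟨k, by omega⟩
      (f.app _ (pr (A.map (leftFst n q).op a) (B.map (leftSnd n q).op b))) (fun m γ hγ => ?_)
      (n + q + 1) (SimplexCategory.δ ⟨k, by omega⟩)
      (fun i hi => (hits_iff _ _).2 (hits_δ _ (by omega) (by simpa [Fin.ext_iff] using hi)))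
    · rw [map_app_pr] at this
      refine marked_cast (by omega) _ _ _ _ _ _ (fun i => ?_) (fun i => ?_) this
      · simp only [comp_val, leftFst_apply, δ_val, fstProj_apply]
        grind
      · simp only [comp_val, leftSnd_apply, δ_val, sndProj_apply]
        grind
    · rw [map_app_pr]
      refine hf.marked_left_of_goodIn hW H b _ ?_
      rw [isGood_iff] at hγ
      rcases hγ with hγ | ⟨j, hj, h0, hj', hγ⟩
      · exact Or.inl fun j h1 h2 => hγ j h1 (by omega)
      · by_cases hjn : j ≤ n + 2
        · exact Or.inr ⟨j, hj, h0, hjn, fun i h1 h2 => hγ i h1 (by omega)⟩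
        -- A face whose only permitted omission lies beyond `n + 2` contains every vertex coming
        -- from `a`.
        · exact Or.inl fun i h1 h2 _ _ => hγ i h1 (by omega) (by omega)
  · have hk' : (k : ℕ) = n + 2 := by omega
    have := hf.marked_leftShift hW hk' H b q le_rfl
    refine marked_cast (by omega) _ _ _ _ _ _ (fun i => ?_) (fun i => ?_) this
    · simp only [comp_val, leftShiftFst_apply, δ_val, fstProj_apply]
      grind
    · simp only [comp_val, leftShiftSnd_apply, δ_val, sndProj_apply]
      grind

end left

section right

variable {n p : ℕ} {b : B _⦋n + 2⦌} {k : Fin (n + 3)}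

/-- If the back part misses a required vertex of `b`, then the front part contains it as well as the
later cut vertex, and the first component of both is `p`. -/
lemma IsMediating.marked_right_of_goodIn (hf : IsMediating f) (hW : IsPreComplicial W)
    (H : ∀ (m : ℕ) (γ : ⦋m⦌ ⟶ ⦋n + 2⦌), IsGood k γ → RightMarked f (B.map γ.op b)) (a : A _⦋p⦌)
    {r : ℕ} (γ : ⦋r⦌ ⟶ ⦋p + (n + 2)⦌) (hγ : GoodIn p (p + k) (p + (n + 2)) γ) :
    f.app (op ⦋r⦌) (pr (A.map (γ ≫ fstProj p (n + 2)).op a) (B.map (γ ≫ sndProj p (n + 2)).op b)) ∈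
      W.marked r := by
  refine hf.marked_of_path hW _ _ _ _ fun s t h => ?_
  have key : ∀ J : ℕ → Prop, (∀ j, j ≤ n + 2 → J j → Hits γ (p + j)) →
      ¬ Function.Injective (front h ≫ γ ≫ fstProj p (n + 2)).toOrderHom ∨
      (∀ j, j ≤ n + 2 → J j → Hits (back h ≫ γ ≫ sndProj p (n + 2)) j) := by
    intro J hJ
    by_cases hall : ∀ j, j ≤ n + 2 → J j → Hits (back h ≫ γ ≫ sndProj p (n + 2)) j
    · exact Or.inr hall
    · left
      push Not at hall
      obtain ⟨j, hj, hJj, hnot⟩ := hall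
      rw [← Category.assoc] at hnot ⊢
      have hlt : p + j < (γ.toOrderHom (⟨s, by omega⟩ : Fin (r + 1)) : ℕ) := by
        by_contra hle
        refine hnot (((hJ j hj hJj).back h (not_lt.1 hle)).comp _ fun i hi => ?_)
        rw [sndProj_apply]
        omega
      refine not_injective_of_hits ((hJ j hj hJj).front h hlt.le)
        (Hits.front h ⟨(⟨s, by omega⟩ : Fin (r + 1)), rfl⟩ le_rfl) hlt.ne _ fun i i' hi hi' => ?_
      rw [fstProj_apply, fstProj_apply]
      omega
  rcases hγ with hγ | ⟨j, hj, h0, hj', hγ⟩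
  · refine (key (fun j => j ≤ k + 1 ∧ k ≤ j + 1)
        fun j hj hJ => hγ _ (by omega) (by omega) (by omega) (by omega)).imp
      (fun h => hf.leftMarked_of_not_injective _ h a)
      (fun h => H _ _ ((isGood_iff k _).2 (Or.inl fun j _ h1 h2 h3 => h j h1 ⟨h2, h3⟩)))
  · refine (key (fun i => p + i ≠ j) fun i hi hJ => hγ _ (by omega) (by omega) hJ).imp
      (fun h => hf.leftMarked_of_not_injective _ h a)
      (fun h => H _ _ ((isGood_iff k _).2 (Or.inr ⟨j - p, by omega, by omega, by omega,
        fun i _ hi hi' => h i hi (by omega)⟩)))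

/-- The first component of the path in which the first step of `b` is taken after `e` steps of a
`p`-simplex. -/
def rightShiftFst (n p e : ℕ) : ⦋p + (n + 2)⦌ ⟶ ⦋p⦌ :=
  natHom _ _ (fun i => if i ≤ e then i else i - 1) fun _ _ _ => by
    split_ifs <;> omega

/-- The second component of the path in which the first step of `b` is taken after `e` steps of a
`p`-simplex. -/
def rightShiftSnd (n p e : ℕ) : ⦋p + (n + 2)⦌ ⟶ ⦋n + 2⦌ :=
  natHom _ _ (fun i => if i ≤ e then i - p else max 1 (i - p)) fun _ _ _ => by
    split_ifs <;> omega

lemma rightShiftFst_apply {e : ℕ} (i : Fin (p + (n + 2) + 1)) :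
    ((rightShiftFst n p e).toOrderHom i : ℕ) =
      min (if (i : ℕ) ≤ e then (i : ℕ) else i - 1) p := rfl
lemma rightShiftSnd_apply {e : ℕ} (i : Fin (p + (n + 2) + 1)) :
    ((rightShiftSnd n p e).toOrderHom i : ℕ) =
      min (if (i : ℕ) ≤ e then (i : ℕ) - p else max 1 (i - p)) (n + 2) := rfl

/-- For `k = 0` the first step of `b` is advanced through `a`, from `e = p` down to `e = 0`; `j = p
- e` is the induction variable. The path for `e` passes through `(e, 0)` and `(e, 1)`. Deleting the
latter leaves the same path as deleting `(e + 1, 0)` from the path for `e + 1`. At `e = 0` the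
initial vertex is deleted, and the cylinder on the face of `b` opposite to `0` remains. -/
lemma IsMediating.marked_rightShift (hf : IsMediating f) (hW : IsPreComplicial W)
    (hk : (k : ℕ) = 0)
    (H : ∀ (m : ℕ) (γ : ⦋m⦌ ⟶ ⦋n + 2⦌), IsGood k γ → RightMarked f (B.map γ.op b)) (a : A _⦋p⦌)
    (j e : ℕ) (hj : j + e = p) :
    f.app (op ⦋p + n + 1⦌)
      (pr (A.map (SimplexCategory.δ (⟨e, by omega⟩ : Fin (p + n + 3)) ≫ rightShiftFst n p e).op a)
        (B.map (SimplexCategory.δ (⟨e, by omega⟩ : Fin (p + n + 3)) ≫ rightShiftSnd n p e).op b)) ∈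
      W.marked (p + n + 1) := by
  have step : f.app (op ⦋p + n + 1⦌)
      (pr (A.map (SimplexCategory.δ (⟨e + 1, by omega⟩ : Fin (p + n + 3)) ≫ rightShiftFst n p e).op a)
        (B.map (SimplexCategory.δ (⟨e + 1, by omega⟩ : Fin (p + n + 3)) ≫ rightShiftSnd n p e).op b)) ∈
      W.marked (p + n + 1) := by
    cases j with
    | zero =>
      obtain rfl : e = p := by omega
      have e1 : rightShiftFst n e e = fstProj e (n + 2) := hom_ext' fun i => by
        rw [rightShiftFst_apply, fstProj_apply]
        repeat' split
        all_goals omega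
      have e2 : rightShiftSnd n e e = sndProj e (n + 2) := hom_ext' fun i => by
        rw [rightShiftSnd_apply, sndProj_apply]
        repeat' split
        all_goals omega
      rw [e1, e2]
      refine hf.marked_right_of_goodIn hW H a _ (Or.inr ⟨e + 1, by omega, by omega, by omega,
        fun i _ hi hi' => hits_δ _ (by omega) hi'⟩)
    | succ j =>
      have := IsMediating.marked_rightShift hf hW hk H a j (e + 1) (by omega)
      have e1 : SimplexCategory.δ (⟨e + 1, by omega⟩ : Fin (p + n + 3)) ≫ rightShiftFst n p e =
          SimplexCategory.δ (⟨e + 1, by omega⟩ : Fin (p + n + 3)) ≫ rightShiftFst n p (e + 1) :=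
        hom_ext' fun i => by
          simp only [comp_val, rightShiftFst_apply, δ_val]
          split_ifs <;> omega
      have e2 : SimplexCategory.δ (⟨e + 1, by omega⟩ : Fin (p + n + 3)) ≫ rightShiftSnd n p e =
          SimplexCategory.δ (⟨e + 1, by omega⟩ : Fin (p + n + 3)) ≫ rightShiftSnd n p (e + 1) :=
        hom_ext' fun i => by
          simp only [comp_val, rightShiftSnd_apply, δ_val]
          split_ifs <;> omega
      rw [e1, e2]
      exact this
  have good : ∀ (m : ℕ) (γ : ⦋m⦌ ⟶ ⦋p + n + 2⦌), Hits γ e → Hits γ (e + 1) →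
      W.toSSet.map γ.op (f.app (op ⦋p + n + 2⦌)
        (pr (A.map (rightShiftFst n p e).op a) (B.map (rightShiftSnd n p e).op b))) ∈
        W.marked m := by
    intro m γ h1 h2
    rw [map_app_pr]
    refine hf.marked_of_path hW _ _ _ _ fun s t h => ?_
    rw [← Category.assoc, ← Category.assoc]
    rcases lt_or_ge e (γ.toOrderHom (⟨s, by omega⟩ : Fin (m + 1)) : ℕ) with hs | hs
    · left
      refine hf.leftMarked_of_not_injective _ (not_injective_of_hits (h1.front h hs.le)
        (h2.front h hs) (by omega) _ fun i i' hi hi' => ?_) a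
      rw [rightShiftFst_apply, rightShiftFst_apply]
      split_ifs <;> omega
    · right
      refine H _ _ ((isGood_iff k _).2 (Or.inl fun i _ _ hi _ => ?_))
      obtain rfl | rfl : i = 0 ∨ i = 1 := by omega
      · refine (h1.back h hs).comp _ fun i hi => ?_
        rw [rightShiftSnd_apply]
        split_ifs <;> omega
      · refine (h2.back h (by omega)).comp _ fun i hi => ?_
        rw [rightShiftSnd_apply]
        split_ifs <;> omega
  have := hW.marked_δ (⟨e, by omega⟩ : Fin (p + n + 3)) _
    (fun m γ hγ => good m γ (hγ _ (by omega) (by simp only; omega) (by simp only; omega))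
      (hγ _ (by omega) (by simp only; omega) (by simp only; omega))) ?_
  · rwa [map_app_pr] at this
  · rintro ⟨i, hi⟩ (hi' | hi')
    · obtain rfl : i = e + 1 := by simpa using hi'
      rw [map_app_pr]
      exact step
    · simp only at hi'
      exact good _ _ (hits_δ _ (by omega) (by simp only; omega)) (hits_δ _ (by omega) (by simp only; omega))

/-- For `k > 0` the neighbours of `p + k` in the cylinder come from `b`, so the lifting property
applies directly; `k = 0` needs the shifted paths. -/
lemma IsMediating.rightMarked_δ (hf : IsMediating f) (hW : IsPreComplicial W)
    (H : ∀ (m : ℕ) (γ : ⦋m⦌ ⟶ ⦋n + 2⦌), IsGood k γ → RightMarked f (B.map γ.op b)) :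
    RightMarked f (B.map (SimplexCategory.δ k).op b) := by
  intro p a
  rw [cyl, map_hom_map]
  rcases Nat.eq_zero_or_pos (k : ℕ) with hk | hk
  · have := hf.marked_rightShift hW hk H a p 0 rfl
    refine marked_cast (by omega) _ _ _ _ _ _ (fun i => ?_) (fun i => ?_) this
    · simp only [comp_val, rightShiftFst_apply, δ_val, fstProj_apply]
      grind
    · simp only [comp_val, rightShiftSnd_apply, δ_val, sndProj_apply]
      grind
  · have := (isPreComplicial_iff W).1 hW (p + n) ⟨p + k, by omega⟩
      (f.app _ (pr (A.map (fstProj p (n + 2)).op a) (B.map (sndProj p (n + 2)).op b)))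
      (fun m γ hγ => ?_) (p + n + 1) (SimplexCategory.δ ⟨p + k, by omega⟩)
      (fun i hi => (hits_iff _ _).2 (hits_δ _ (by omega) (by simpa [Fin.ext_iff] using hi)))
    · rw [map_app_pr] at this
      refine marked_cast (by omega) _ _ _ _ _ _ (fun i => ?_) (fun i => ?_) this
      · simp only [comp_val, δ_val, fstProj_apply]
        grind
      · simp only [comp_val, δ_val, sndProj_apply]
        grind
    · rw [map_app_pr]
      refine hf.marked_right_of_goodIn hW H a _ ?_
      rw [isGood_iff] at hγ
      rcases hγ with hγ | ⟨j, hj, h0, hj', hγ⟩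
      · exact Or.inl fun j h1 h2 => hγ j (by omega) (by omega)
      · by_cases hjp : p ≤ j
        · exact Or.inr ⟨j, hj, hjp, by omega, fun i h1 h2 => hγ i (by omega) (by omega)⟩
        · exact Or.inl fun i h1 h2 _ _ => hγ i (by omega) (by omega) (by omega)

end right

end MarkedSSet

end

/-! ### Passage to the pre-complicial reflections -/

section
open Simplicial

namespace MarkedSSet

variable {A B W : MarkedSSet.{u}} {f : A.toSSet ⊗ B.toSSet ⟶ W.toSSet}

/-- The simplices of positive dimension with marked cylinders are a pre-complicial marking that
contains the given one, hence contain its reflection, which is the smallest. -/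
lemma IsMediating.leftMarked_of_preReflection (hf : IsMediating f) (hW : IsPreComplicial W)
    (hA : ∀ (p : ℕ) (a : A.toSSet _⦋p⦌), a ∈ A.marked p → LeftMarked f a) {p : ℕ}
    (a : A.toSSet _⦋p⦌) (ha : a ∈ (preReflection A).marked p) : LeftMarked f a := by
  refine (ha (fun p => {a | p ≠ 0 ∧ LeftMarked f a}) (fun _ h => h.1 rfl) (fun p a ha => ?_)
    (fun p a ha => ⟨?_, hA p a ha⟩) ?_).2
  · refine ⟨?_, ?_⟩
    · rintro rfl
      simp at ha
    · obtain ⟨n, g, hg, y, rfl⟩ := (degenerate_iff a).1 ha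
      exact hf.leftMarked_of_not_injective g hg y
  · rintro rfl
    exact A.not_marked_zero a ha
  -- The restriction to positive dimension is harmless, since the face to be marked has dimension `n
  -- + 1`.
  · exact isPreComplicial_of_δ fun n k x hx =>
      ⟨Nat.succ_ne_zero n, hf.leftMarked_δ hW fun m γ hγ => (hx m γ hγ).2⟩

lemma IsMediating.rightMarked_of_preReflection (hf : IsMediating f) (hW : IsPreComplicial W)
    (hB : ∀ (q : ℕ) (b : B.toSSet _⦋q⦌), b ∈ B.marked q → RightMarked f b) {q : ℕ}
    (b : B.toSSet _⦋q⦌) (hb : b ∈ (preReflection B).marked q) : RightMarked f b := by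
  refine (hb (fun q => {b | q ≠ 0 ∧ RightMarked f b}) (fun _ h => h.1 rfl) (fun q b hb => ?_)
    (fun q b hb => ⟨?_, hB q b hb⟩) ?_).2
  · refine ⟨?_, ?_⟩
    · rintro rfl
      simp at hb
    · obtain ⟨n, g, hg, y, rfl⟩ := (degenerate_iff b).1 hb
      exact hf.rightMarked_of_not_injective g hg y
  · rintro rfl
    exact B.not_marked_zero b hb
  · exact isPreComplicial_of_δ fun n k x hx =>
      ⟨Nat.succ_ne_zero n, hf.rightMarked_δ hW fun m γ hγ => (hx m γ hγ).2⟩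

/-- A mediating map that sends cylinders on marked simplices to marked simplices is a map out of the
Gray tensor product of the pre-complicial reflections. -/
def IsMediating.grayLift (hf : IsMediating f) (hW : IsPreComplicial W)
    (hA : ∀ (p : ℕ) (a : A.toSSet _⦋p⦌), a ∈ A.marked p → LeftMarked f a)
    (hB : ∀ (q : ℕ) (b : B.toSSet _⦋q⦌), b ∈ B.marked q → RightMarked f b) :
    gray (preReflection A) (preReflection B) ⟶ W where
  map := f
  map_marked _ z hz := hf.marked_of_cyl hW z.1 z.2 fun p q h =>
    (hz p q h).elim (fun h => hf.leftMarked_of_preReflection hW hA _ h q _)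
      (fun h => hf.rightMarked_of_preReflection hW hB _ h p _)

end MarkedSSet

/-! ### Chains and faces in products of cubes -/

namespace PreComp

/-- Since a chain increases, its coordinates in the first block precede those in the second one. The
cut `p` is the number of the former. -/
lemma IsJumpChain.exists_cut {k l m : ℕ} {v : Fin (m + 1) → Fin k → Bool}
    {w : Fin (m + 1) → Fin l → Bool} {i : Fin m → Fin (k + l)}
    (hi : IsJumpChain (fun a => Fin.append (v a) (w a)) i) :
    ∃ (p q : ℕ) (h : p + q = m), (∀ c, (i c : ℕ) < k ↔ (c : ℕ) < p) ∧
      HasChain k (fun a => v ((front h).toOrderHom a)) ∧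
      HasChain l (fun a => w ((back h).toOrderHom a)) := by
  classical
  have hex : ∃ p : ℕ, ∀ c : Fin m, p ≤ c → k ≤ i c := ⟨m, fun c hc => absurd c.2 (by omega)⟩
  have hpm : Nat.find hex ≤ m := Nat.find_min' hex fun c hc => absurd c.2 (by omega)
  have hcut : ∀ c : Fin m, (i c : ℕ) < k ↔ (c : ℕ) < Nat.find hex := by
    intro c
    constructor
    · intro h
      by_contra h'
      have := Nat.find_spec hex c (by omega)
      omega
    · intro h
      have := Nat.find_min hex h
      push Not at this
      obtain ⟨d, hd, hd'⟩ := this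
      have : i c ≤ i d := hi.1.monotone hd
      rw [Fin.le_def] at this
      omega
  obtain ⟨q, hq⟩ := Nat.exists_eq_add_of_le hpm
  generalize Nat.find hex = p at hcut hq
  subst hq
  refine ⟨p, q, rfl, hcut, ?_, ?_⟩
  · have hlt : ∀ c : Fin p, (i (Fin.castAdd q c) : ℕ) < k := fun c => (hcut _).2 (by simp)
    refine ⟨fun c => ⟨i (Fin.castAdd q c), hlt c⟩, fun a b hab => hi.1 hab, fun c => ?_⟩
    have := hi.2 (Fin.castAdd q c)
    have e : i (Fin.castAdd q c) = Fin.castAdd l ⟨i (Fin.castAdd q c), hlt c⟩ := rfl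
    rw [e] at this
    simp only [Fin.append_left] at this
    exact this
  · have hge : ∀ c : Fin q, k ≤ (i (Fin.natAdd p c) : ℕ) := fun c => by
      have := hcut (Fin.natAdd p c)
      simp at this
      exact this
    refine ⟨fun c => ⟨i (Fin.natAdd p c) - k, by have := hge c; omega⟩, fun a b hab => ?_, fun c => ?_⟩
    · have h1 : i (Fin.natAdd p a) < i (Fin.natAdd p b) := hi.1 (by
        rw [Fin.lt_def] at hab ⊢
        simpa using hab)
      have := hge a
      rw [Fin.lt_def] at h1 ⊢
      simp only
      omega
    · have := hi.2 (Fin.natAdd p c)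
      have e : i (Fin.natAdd p c) = Fin.natAdd k ⟨i (Fin.natAdd p c) - k, by have := hge c; omega⟩ := by
        have := hge c
        ext
        simp
        omega
      rw [e] at this
      simp only [Fin.append_right] at this
      exact this

/-- Converse to `IsJumpChain.exists_cut`: chains of a front face and of the complementary back face
are concatenated. -/
lemma hasChain_append {k l m p q : ℕ} (h : p + q = m) {v : Fin (m + 1) → Fin k → Bool}
    {w : Fin (m + 1) → Fin l → Bool} (hv : HasChain k (fun a => v ((front h).toOrderHom a)))
    (hw : HasChain l (fun a => w ((back h).toOrderHom a))) :
    HasChain (k + l) (fun a => Fin.append (v a) (w a)) := by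
  obtain ⟨i, hi, hi'⟩ := hv
  obtain ⟨j, hj, hj'⟩ := hw
  subst h
  refine ⟨Fin.append (fun c => Fin.castAdd l (i c)) (fun c => Fin.natAdd k (j c)), ?_, ?_⟩
  · intro a b
    refine Fin.addCases (fun a => ?_) (fun a => ?_) a <;>
      refine Fin.addCases (fun b => ?_) (fun b => ?_) b
    · intro h
      rw [Fin.append_left, Fin.append_left]
      exact hi h
    · intro _
      rw [Fin.append_left, Fin.append_right, Fin.lt_def]
      simp
      omega
    · intro h
      rw [Fin.lt_def] at h
      simp at h
      omega
    · intro h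
      rw [Fin.append_right, Fin.append_right]
      simpa using hj (show a < b by simpa using h)
  · intro c
    refine Fin.addCases (fun c => ?_) (fun c => ?_) c
    · simp only [Fin.append_left]
      exact hi' c
    · simp only [Fin.append_right]
      exact hj' c

lemma HasChain.le {n m : ℕ} {v : Fin (m + 1) → Fin n → Bool} (h : HasChain n v) : m ≤ n := by
  obtain ⟨i, hi, -⟩ := h
  simpa using Fintype.card_le_of_injective i hi.injective

section faces

/-- The face inclusion `{0,1}ᵗ → {0,1}ˡ` that puts the coordinates in the places `j` and the
constants `κ` elsewhere. -/
noncomputable def faceMap {t l : ℕ} (j : Fin t → Fin l) (κ : Fin l → Bool) (x : Fin t → Bool)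
    (e : Fin l) : Bool :=
  open scoped Classical in if h : ∃ d, j d = e then x h.choose else κ e

lemma faceMap_apply {t l : ℕ} {j : Fin t → Fin l} (hj : Function.Injective j) (κ : Fin l → Bool)
    (x : Fin t → Bool) (d : Fin t) : faceMap j κ x (j d) = x d := by
  have h : ∃ d', j d' = j d := ⟨d, rfl⟩
  rw [faceMap, dif_pos h, hj h.choose_spec]

lemma faceMap_of_notMem {t l : ℕ} {j : Fin t → Fin l} (κ : Fin l → Bool)
    (x : Fin t → Bool) {e : Fin l} (he : ∀ d, j d ≠ e) : faceMap j κ x e = κ e := by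
  rw [faceMap, dif_neg (by simpa using he)]

/-- Induction on the last coordinate. If it is one of the places `j`, it is the last of them and the
map is a smaller face inclusion tensored with `[1]`. Otherwise it is constant and the map ends with
a face. -/
lemma isBoxMap_faceMap {t l : ℕ} (j : Fin t → Fin l) (hj : StrictMono j) (κ : Fin l → Bool) :
    IsBoxMap (faceMap j κ) := by
  induction l generalizing t with
  | zero =>
    obtain rfl : t = 0 := by
      rcases Nat.eq_zero_or_pos t with h | h
      · exact h
      · exact (j ⟨0, h⟩).elim0
    have : faceMap j κ = fun x => x := funext fun x => funext fun e => e.elim0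
    rw [this]
    exact .id 0
  | succ l ih =>
    by_cases hl : ∃ d, j d = Fin.last l
    · obtain ⟨d, hd⟩ := hl
      obtain ⟨t, rfl⟩ : ∃ t', t = t' + 1 := ⟨t - 1, by have := d.2; omega⟩
      have hd' : d = Fin.last t := by
        by_contra hne
        have : j d < j (Fin.last t) := hj (lt_of_le_of_ne (Fin.le_last d) hne)
        rw [hd] at this
        exact absurd this (not_lt.2 (Fin.le_last _))
      subst hd'
      have hlt : ∀ c : Fin t, (j c.castSucc : ℕ) < l := fun c => by
        have : j c.castSucc < j (Fin.last t) := hj (Fin.castSucc_lt_last c)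
        rw [hd, Fin.lt_def] at this
        exact this
      have := (ih (fun c : Fin t => ⟨j c.castSucc, hlt c⟩) (fun a b hab => hj hab)
        (fun e => κ e.castSucc)).tensor_id 1
      convert this using 1
      funext x e
      refine Fin.lastCases ?_ (fun e => ?_) e
      · rw [← hd, faceMap_apply hj.injective, boxTensor, dif_neg (by rw [hd]; simp)]
        congr 1
        ext
        simp [hd]
      · rw [boxTensor, dif_pos (by simp)]
        change _ = faceMap _ _ _ e
        by_cases he : ∃ d : Fin t, (⟨j d.castSucc, hlt d⟩ : Fin l) = e
        · obtain ⟨d, rfl⟩ := he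
          rw [faceMap_apply (fun a b hab => Fin.castSucc_injective _
            (hj.injective (Fin.ext (Fin.mk.inj hab))))]
          exact faceMap_apply hj.injective _ _ d.castSucc
        · push Not at he
          rw [faceMap_of_notMem _ _ he, faceMap_of_notMem]
          intro d
          refine Fin.lastCases ?_ (fun d => ?_) d
          · rw [hd]
            exact (Fin.castSucc_lt_last e).ne'
          · intro h
            exact he d (Fin.ext (congrArg (fun z : Fin (l + 1) => (z : ℕ)) h))
    · push Not at hl
      have hlt : ∀ c : Fin t, (j c : ℕ) < l := fun c => by
        have := Fin.lt_last_iff_ne_last.2 (hl c)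
        rwa [Fin.lt_def] at this
      have := (ih (fun c : Fin t => ⟨j c, hlt c⟩) (fun a b hab => hj hab)
        (fun e => κ e.castSucc)).comp (.face (Fin.last l) (κ (Fin.last l)))
      convert this using 1
      funext x e
      refine Fin.lastCases ?_ (fun e => ?_) e
      · rw [faceMap_of_notMem _ _ hl]
        simp [boxFace]
      · simp only [boxFace, Fin.val_castSucc, Fin.val_last, e.2, dite_true]
        by_cases he : ∃ d : Fin t, (⟨j d, hlt d⟩ : Fin l) = e
        · obtain ⟨d, rfl⟩ := he
          rw [faceMap_apply (fun a b hab => hj.injective (Fin.ext (Fin.mk.inj hab)))]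
          exact faceMap_apply hj.injective κ x d
        · push Not at he
          rw [faceMap_of_notMem _ _ he, faceMap_of_notMem]
          intro d h
          exact he d (Fin.ext (congrArg (fun z : Fin (l + 1) => (z : ℕ)) h))

/-- The face inclusion as a morphism of the box category. -/
noncomputable def faceHom {t l : ℕ} (j : Fin t → Fin l) (hj : StrictMono j) (κ : Fin l → Bool) :
    (⟨t⟩ : Box) ⟶ ⟨l⟩ := ⟨faceMap j κ, isBoxMap_faceMap j hj κ⟩

lemma faceHom_apply {t l : ℕ} {j : Fin t → Fin l} (hj : StrictMono j) (κ : Fin l → Bool)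
    (x : Fin t → Bool) (d : Fin t) : (faceHom j hj κ).toFun x (j d) = x d :=
  faceMap_apply hj.injective κ x d

lemma faceHom_of_notMem {t l : ℕ} {j : Fin t → Fin l} (hj : StrictMono j) (κ : Fin l → Bool)
    (x : Fin t → Bool) {e : Fin l} (he : ∀ d, j d ≠ e) : (faceHom j hj κ).toFun x e = κ e :=
  faceMap_of_notMem κ x he

lemma eq_self_of_strictMono {t : ℕ} (j : Fin t → Fin t) (hj : StrictMono j) (c : Fin t) : j c = c := by
  have : j = id := (StrictMono.range_inj hj strictMono_id).1 (by
    rw [(Finite.surjective_of_injective hj.injective).range_eq, Set.range_id])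
  rw [this]; rfl

lemma faceHom_self {t : ℕ} (j : Fin t → Fin t) (hj : StrictMono j) (κ : Fin t → Bool) :
    faceHom j hj κ = 𝟙 _ :=
  Box.hom_ext fun x e => by
    have := faceHom_apply hj κ x e
    rwa [eq_self_of_strictMono j hj] at this

/-- The nondegenerate simplex of top dimension of the cube in which the coordinates jump in their
natural order. -/
noncomputable def topSimplex (m : ℕ) : (cube.{u} m).simplices m :=
  ofVert m (fun c e => decide ((e : ℕ) < c)) fun a b hab e => by
    have : (a : ℕ) ≤ b := hab
    simp only [Bool.le_iff_imp, decide_eq_true_eq]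
    omega

lemma vert_topSimplex (m : ℕ) (c : Fin (m + 1)) :
    vert m (topSimplex.{u} m) c = fun e : Fin m => decide ((e : ℕ) < c) :=
  congrFun (vert_ofVert m _ _) c

/-- The coordinate `i d` is still `0` in `v` after all earlier steps, which excludes the other
clauses of the definition. -/
lemma chainFace_chain {n m : ℕ} {v : Fin (m + 1) → Fin n → Bool} (hv : Monotone v)
    {i : Fin m → Fin n} (hi : IsJumpChain v i) (d : Fin m) (c : Fin (m + 1)) :
    chainFace v i c (i d) = decide ((d : ℕ) < c) := by
  rw [chainFace, decide_eq_decide]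
  constructor
  · rintro (h | ⟨d', h, h' | ⟨h', h''⟩⟩)
    · have := Bool.le_iff_imp.1 (hv (Fin.zero_le d.castSucc) (i d)) h
      rw [(hi.2 d).1] at this
      cases this
    · have hlt : d' < d := hi.1.lt_iff_lt.1 h'
      have := Bool.le_iff_imp.1 (hv (show d'.succ ≤ d.castSucc from hlt) (i d)) h
      rw [(hi.2 d).1] at this
      cases this
    · rwa [← hi.1.injective h']
  · intro h
    exact Or.inr ⟨d, (hi.2 d).2, Or.inr ⟨rfl, h⟩⟩

lemma chainFace_of_notMem {n m : ℕ} {v : Fin (m + 1) → Fin n → Bool} {i : Fin m → Fin n}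
    {e : Fin n} (he : ∀ d, i d ≠ e) (c c' : Fin (m + 1)) : chainFace v i c e = chainFace v i c' e := by
  simp [chainFace, he]

end faces

lemma vert_pair {k l m : ℕ} (φ : (cube.{u} k).simplices m) (ψ : (cube.{u} l).simplices m)
    (a : Fin (m + 1)) : vert (k + l) (pair φ ψ) a = Fin.append (vert k φ a) (vert l ψ a) :=
  congrFun (vert_ofVert (k + l) _ _) a

lemma act_pair {k l m m' : ℕ} (g : ⦋m'⦌ ⟶ ⦋m⦌) (φ : (cube.{u} k).simplices m)
    (ψ : (cube.{u} l).simplices m) :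
    (cube.{u} (k + l)).act g (pair φ ψ) = pair ((cube k).act g φ) ((cube l).act g ψ) :=
  vert_injective _ fun a => by rw [vert_act, vert_pair, vert_pair, vert_act, vert_act]

lemma boxTensor_castAdd {m n m' n' : ℕ} (f : (Fin m → Bool) → (Fin n → Bool))
    (g : (Fin m' → Bool) → (Fin n' → Bool)) (x : Fin (m + m') → Bool) (e : Fin n) :
    boxTensor f g x (Fin.castAdd n' e) = f (fun i => x (Fin.castAdd m' i)) e := by
  rw [boxTensor, dif_pos (by simp)]
  rfl

lemma boxTensor_natAdd {m n m' n' : ℕ} (f : (Fin m → Bool) → (Fin n → Bool))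
    (g : (Fin m' → Bool) → (Fin n' → Bool)) (x : Fin (m + m') → Bool) (e : Fin n') :
    boxTensor f g x (Fin.natAdd n e) = g (fun i => x (Fin.natAdd m i)) e := by
  rw [boxTensor, dif_neg (by simp)]
  exact boxFun_congr g (fun _ => rfl) (by simp)

lemma boxTensor_append {m n m' n' : ℕ} (f : (Fin m → Bool) → (Fin n → Bool))
    (g : (Fin m' → Bool) → (Fin n' → Bool)) (x : Fin m → Bool) (y : Fin m' → Bool) :
    boxTensor f g (Fin.append x y) = Fin.append (f x) (g y) := by
  funext e
  refine Fin.addCases (fun e => ?_) (fun e => ?_) e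
  · simp only [boxTensor_castAdd, Fin.append_left]
  · simp only [boxTensor_natAdd, Fin.append_right]

lemma ap_cubeMap_pair {k l k' l' m : ℕ} (f : (⟨k⟩ : Box) ⟶ ⟨k'⟩) (g : (⟨l⟩ : Box) ⟶ ⟨l'⟩)
    (φ : (cube.{u} k).simplices m) (ψ : (cube.{u} l).simplices m) :
    (ap (cubeMap (Box.par f g)) (pair φ ψ) : (cube.{u} (k' + l')).simplices m) =
      pair (k := k') (l := l') (ap (cubeMap f) φ) (ap (cubeMap g) ψ) :=
  vert_injective (k' + l') fun a => by
    refine (vert_cubeMap (Box.par f g) (pair φ ψ) a).trans ?_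
    have e1 := vert_cubeMap f φ a
    have e2 := vert_cubeMap g ψ a
    rw [vert_pair, vert_pair]
    simp only at e1 e2
    rw [e1, e2]
    exact boxTensor_append _ _ _ _

end PreComp

section triangulation

lemma par_toFun_apply {k l k' l' : ℕ} (f : (⟨k⟩ : Box) ⟶ ⟨k'⟩) (g : (⟨l⟩ : Box) ⟶ ⟨l'⟩)
    (x : Fin (k + l) → Bool) (e : Fin (k' + l')) :
    (Box.par f g).toFun x e = boxTensor f.toFun g.toFun x e := rfl

variable {X Y : CSet.{u}}

/-- A chain face is the top simplex of the `(s + t)`-cube placed on the chain coordinates, with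
constants elsewhere. As the chain is cut at `s`, this face inclusion is a tensor product of face
inclusions of the two blocks, and the coend relation moves it onto `x ⊗ y`. The constants are read
off at vertex `0`. -/
lemma tmk_tmul_chainFace {k l s t : ℕ} (x : X.cubes k) (y : Y.cubes l)
    (v : Fin (s + t + 1) → Fin (k + l) → Bool) (hv : Monotone v) (i : Fin (s + t) → Fin (k + l))
    (hi : IsJumpChain v i) (hcut : ∀ c, (i c : ℕ) < k ↔ (c : ℕ) < s) :
    ∃ (j₁ : Fin s → Fin k) (j₂ : Fin t → Fin l) (h₁ : StrictMono j₁) (h₂ : StrictMono j₂)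
      (κ₁ : Fin k → Bool) (κ₂ : Fin l → Bool),
      tmk (CSet.tmul x y) (ofVert (k + l) (chainFace v i) (chainFace_mono v i)) =
        tmk (CSet.tmul (X.act (faceHom j₁ h₁ κ₁) x)
          (Y.act (faceHom j₂ h₂ κ₂) y))
          (topSimplex (s + t)) := by
  have hlt : ∀ c : Fin s, (i (Fin.castAdd t c) : ℕ) < k := fun c => (hcut _).2 (by simp)
  have hge : ∀ c : Fin t, k ≤ (i (Fin.natAdd s c) : ℕ) := fun c => by
    have := hcut (Fin.natAdd s c)
    simp at this
    exact this
  let j₁ : Fin s → Fin k := fun c => ⟨i (Fin.castAdd t c), hlt c⟩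
  let j₂ : Fin t → Fin l := fun c => ⟨i (Fin.natAdd s c) - k, by have := hge c; omega⟩
  have e₁ : ∀ c, i (Fin.castAdd t c) = Fin.castAdd l (j₁ c) := fun c => rfl
  have e₂ : ∀ c, i (Fin.natAdd s c) = Fin.natAdd k (j₂ c) := fun c => by
    have := hge c
    ext
    simp [j₂]
    omega
  have h₁ : StrictMono j₁ := fun a b hab => hi.1 hab
  have h₂ : StrictMono j₂ := fun a b hab => by
    have h : i (Fin.natAdd s a) < i (Fin.natAdd s b) := hi.1 (by
      rw [Fin.lt_def] at hab ⊢
      simpa using hab)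
    rw [e₂, e₂, Fin.lt_def] at h
    rw [Fin.lt_def]
    simpa using h
  refine ⟨j₁, j₂, h₁, h₂, fun e => chainFace v i 0 (Fin.castAdd l e),
    fun e => chainFace v i 0 (Fin.natAdd k e), ?_⟩
  rw [CSet.tmul_act, tmk_act]
  congr 1
  refine vert_injective _ fun c => ?_
  refine Eq.trans ?_ (vert_cubeMap (Box.par _ _) (topSimplex (s + t)) c).symm
  rw [vert_topSimplex]
  refine (congrFun (vert_ofVert (k + l) _ _) c).trans ?_
  funext e
  rw [par_toFun_apply]
  refine Fin.addCases (fun e => ?_) (fun e => ?_) e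
  · rw [boxTensor_castAdd]
    by_cases he : ∃ d, j₁ d = e
    · obtain ⟨d, rfl⟩ := he
      refine Eq.trans ?_ (faceHom_apply h₁ _ _ d).symm
      rw [← e₁, chainFace_chain hv hi]
    · push Not at he
      refine Eq.trans ?_ (faceHom_of_notMem h₁ _ _ he).symm
      refine chainFace_of_notMem (fun d => ?_) _ _
      refine Fin.addCases (fun d => ?_) (fun d => ?_) d
      · rw [e₁]
        exact fun h => he d (Fin.castAdd_injective _ _ h)
      · rw [e₂, ne_eq, Fin.ext_iff]
        simp
        omega
  · rw [boxTensor_natAdd]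
    by_cases he : ∃ d, j₂ d = e
    · obtain ⟨d, rfl⟩ := he
      refine Eq.trans ?_ (faceHom_apply h₂ _ _ d).symm
      rw [← e₂, chainFace_chain hv hi]
    · push Not at he
      refine Eq.trans ?_ (faceHom_of_notMem h₂ _ _ he).symm
      refine chainFace_of_notMem (fun d => ?_) _ _
      refine Fin.addCases (fun d => ?_) (fun d => ?_) d
      · rw [e₁, ne_eq, Fin.ext_iff]
        simp
        omega
      · rw [e₂]
        exact fun h => he d (Fin.natAdd_injective _ _ h)

end triangulation

end

/-! ### The comparison map -/

section
open Simplicial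

namespace PreComp

/-- A coordinate jumps in every step of a chain, so no vertex can be repeated. -/
lemma HasChain.injective {n m N : ℕ} {w : Fin (N + 1) → Fin n → Bool} (hw : Monotone w)
    (g : ⦋m⦌ ⟶ ⦋N⦌) (h : HasChain n (fun a : Fin (m + 1) => w (g.toOrderHom a))) :
    Function.Injective (g.toOrderHom : Fin (m + 1) → Fin (N + 1)) := by
  obtain ⟨i, -, hi⟩ := h
  refine StrictMono.injective (Fin.strictMono_iff_lt_succ.2 fun c => ?_)
  by_contra hc
  have := Bool.le_iff_imp.1 (hw (not_lt.1 hc) (i c)) (hi c).2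
  exact Bool.false_ne_true ((hi c).1.symm.trans this)

lemma le_of_injective {m N : ℕ} (g : ⦋m⦌ ⟶ ⦋N⦌)
    (h : Function.Injective (g.toOrderHom : Fin (m + 1) → Fin (N + 1))) : m ≤ N := by
  have := Fintype.card_le_of_injective _ h
  simp at this
  exact this

/-- A cut `p' + q' = p + q` of the chain makes `fstProj` injective on the front and `sndProj`
injective on the back. Hence `p' ≤ p` and `q' ≤ q`, so a cylinder can only be cut at its corner. -/
lemma IsJumpChain.cut_cyl {k l p q : ℕ} {v : Fin (p + 1) → Fin k → Bool} (hv : Monotone v)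
    {w : Fin (q + 1) → Fin l → Bool} (hw : Monotone w) {i : Fin (p + q) → Fin (k + l)}
    (hi : IsJumpChain (fun a => Fin.append (v ((fstProj p q).toOrderHom a))
      (w ((sndProj p q).toOrderHom a))) i) :
    (∀ c, (i c : ℕ) < k ↔ (c : ℕ) < p) ∧ HasChain k v ∧ HasChain l w := by
  obtain ⟨p', q', h, hcut, h1, h2⟩ := hi.exists_cut
  have l1 := le_of_injective (front h ≫ fstProj p q) (HasChain.injective hv _ h1)
  have l2 := le_of_injective (back h ≫ sndProj p q) (HasChain.injective hw _ h2)
  have h3 : p' + q' = p + q := h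
  obtain rfl : p' = p := by omega
  obtain rfl : q' = q := by omega
  refine ⟨hcut, ?_, ?_⟩
  · convert h1 using 3 with a
    ext
    simp
    omega
  · convert h2 using 3 with a
    ext
    simp

lemma ap_cubeMap_id {n m : ℕ} (φ : (cube.{u} n).simplices m) :
    ap (cubeMap (𝟙 (⟨n⟩ : Box))) φ = φ :=
  congrArg (fun h : cube.{u} n ⟶ cube n => ap h φ) (cubes.map_id ⟨n⟩)

end PreComp

/-- The comparison map `([x, φ], [y, ψ]) ↦ [x ⊗ y, (φ, ψ)]` of simplicial sets. -/
noncomputable def tPair (X Y : CSet.{u}) : (tSSet X ⊗ tSSet Y : SSet.{u}) ⟶ tSSet (X ⊗ Y) where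
  app Δ := TypeCat.ofHom fun z => Quot.map₂
    (fun z w => ⟨z.1 + w.1, CSet.tmul z.2.1 w.2.1, pair (m := Δ.unop.len) z.2.2 w.2.2⟩)
    (by
      rintro ⟨k, x, φ⟩ _ _ ⟨g, y, ψ⟩
      -- A coend relation along `g` in the second variable becomes the relation along `id ⊗ g`.
      have h := TRel.mk (X := X ⊗ Y) (Δ := Δ) (Box.par (𝟙 (⟨k⟩ : Box)) g) (CSet.tmul x y)
        (pair (m := Δ.unop.len) φ ψ)
      have h' := ap_cubeMap_pair (𝟙 (⟨k⟩ : Box)) g (m := Δ.unop.len) φ ψ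
      rw [ap_cubeMap_id] at h'
      rw [← CSet.tmul_act, CSet.act_id] at h
      exact h' ▸ h)
    (by
      rintro _ _ ⟨l, y, ψ⟩ ⟨g, x, φ⟩
      have h := TRel.mk (X := X ⊗ Y) (Δ := Δ) (Box.par g (𝟙 (⟨l⟩ : Box))) (CSet.tmul x y)
        (pair (m := Δ.unop.len) φ ψ)
      have h' := ap_cubeMap_pair g (𝟙 (⟨l⟩ : Box)) (m := Δ.unop.len) φ ψ
      rw [ap_cubeMap_id] at h'
      rw [← CSet.tmul_act, CSet.act_id] at h
      exact h' ▸ h) z.1 z.2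
  naturality Δ Δ' g := by
    ext ⟨⟨z⟩, ⟨w⟩⟩
    exact congrArg (fun t => Quot.mk (TRel (X ⊗ Y) Δ') ⟨z.1 + w.1, CSet.tmul z.2.1 w.2.1, t⟩)
      (act_pair (m := Δ.unop.len) (m' := Δ'.unop.len) g.unop z.2.2 w.2.2).symm

section

variable (X Y : MarkedCSet.{u})

/-- The comparison map, with values in the underlying simplicial set of the triangulation. -/
noncomputable def tComparison : (tMarked X).toSSet ⊗ (tMarked Y).toSSet ⟶
    (preReflection (tMarked (X ⊗ Y))).toSSet := tPair X.toCSet Y.toCSet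

variable {X Y}

lemma tmk_pair_mem {k l m : ℕ} (x : X.toCSet.cubes k) (y : Y.toCSet.cubes l)
    (φ : (cube.{u} k).simplices m) (ψ : (cube.{u} l).simplices m)
    (h : ¬ HasChain (k + l) (fun a => Fin.append (vert k φ a) (vert l ψ a))) :
    (tmk (CSet.tmul x y) (pair φ ψ) : (preReflection (tMarked (X ⊗ Y))).toSSet _⦋m⦌) ∈
      (preReflection (tMarked (X ⊗ Y))).marked m := by
  refine marked_le_preReflection _ _ ⟨k + l, CSet.tmul x y, pair φ ψ, rfl, Or.inl ?_⟩
  by_contra hcon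
  rw [not_mem_cube_marked_iff] at hcon
  apply h
  convert hcon using 2 with a
  exact (vert_pair φ ψ a).symm

/-- A chain of the pair would be cut into chains of a front face and of the complementary back face,
making both operators injective there. So the simplex of the cube has no chain and is already
marked. -/
lemma isMediating_tComparison : IsMediating (tComparison X Y) := by
  intro N N' r a b α β H
  obtain ⟨k, x, φ, rfl⟩ := exists_tmk a
  obtain ⟨l, y, ψ, rfl⟩ := exists_tmk b
  refine tmk_pair_mem x y ((cube k).act α φ) ((cube l).act β ψ) ?_
  rintro ⟨i, hi⟩
  obtain ⟨p, q, h, -, h1, h2⟩ := IsJumpChain.exists_cut hi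
  simp only [vert_act] at h1 h2
  rcases H p q h with h' | h'
  · exact h' (HasChain.injective (vert_mono k φ) (front h ≫ α) h1)
  · exact h' (HasChain.injective (vert_mono l ψ) (back h ≫ β) h2)

/-- Its chain faces decide whether the cylinder is marked. All of them are cut at the corner `p`, so
they are top simplices of `x' ⊗ y'` with `x'` and `y'` faces of dimensions `p` and `q`. The
hypothesis covers the case that one of these is the full cube and is marked. -/
lemma tmk_pair_cyl_mem {k l p q : ℕ} (x : X.toCSet.cubes k) (y : Y.toCSet.cubes l)
    (φ : (cube.{u} k).simplices p) (ψ : (cube.{u} l).simplices q)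
    (h : HasChain k (vert k φ) → HasChain l (vert l ψ) → p ≤ k → q ≤ l →
      p + q ≠ 0 ∧ (k = p ∧ x ∈ X.marked k ∨ l = q ∧ y ∈ Y.marked l)) :
    (tmk (CSet.tmul x y) (pair ((cube k).act (fstProj p q) φ) ((cube l).act (sndProj p q) ψ)) :
      (preReflection (tMarked (X ⊗ Y))).toSSet _⦋p + q⦌) ∈
      (preReflection (tMarked (X ⊗ Y))).marked (p + q) := by
  have hW := preReflection_isPreComplicial (tMarked (X ⊗ Y))
  rw [← ofVert_vert (pair _ _)]
  refine marked_of_chainFaces hW (cell (X := X ⊗ Y) (CSet.tmul x y)).hom _ (vert_mono _ _)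
    fun i hi => ?_
  have hi' : IsJumpChain (fun a => Fin.append (vert k φ ((fstProj p q).toOrderHom a))
      (vert l ψ ((sndProj p q).toOrderHom a))) i := by
    convert hi using 2 with a
    rw [vert_pair, vert_act, vert_act]
  obtain ⟨hcut, h1, h2⟩ := hi'.cut_cyl (vert_mono k φ) (vert_mono l ψ)
  obtain ⟨j₁, j₂, h₁, h₂, κ₁, κ₂, e⟩ := tmk_tmul_chainFace x y _ (vert_mono _ _) i hi hcut
  refine Eq.mp (congrArg (· ∈ (preReflection (tMarked (X ⊗ Y))).marked (p + q)) e.symm) ?_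
  -- A strictly increasing self-map of `Fin k` is the identity, so for `k = p` the face of `x` is
  -- `x` itself. The condition `p + q ≠ 0` is needed because `markedCube` truncates at `n - 1`,
  -- which is `0` for `n = 0`.
  obtain ⟨h0, ⟨rfl, hx⟩ | ⟨rfl, hy⟩⟩ := h h1 h2 h1.le h2.le
  · rw [faceHom_self, CSet.act_id]
    exact marked_le_preReflection _ _ ⟨k + q, CSet.tmul x _, topSimplex (k + q), rfl,
      Or.inr ⟨MarkedCSet.GrayMarked.left x _ hx, Or.inr (by omega)⟩⟩
  · rw [faceHom_self j₂, CSet.act_id]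
    exact marked_le_preReflection _ _ ⟨p + l, CSet.tmul _ y, topSimplex (p + l), rfl,
      Or.inr ⟨MarkedCSet.GrayMarked.right _ y hy, Or.inr (by omega)⟩⟩

/-- If `φ` has a chain then `p ≤ k` and `φ` is not marked in the cube. So `x` is marked and `k - 1 <
p`, which forces `p = k`. -/
lemma leftMarked_tComparison {p : ℕ} (a : (tMarked X).toSSet _⦋p⦌) (ha : a ∈ (tMarked X).marked p) :
    LeftMarked (tComparison X Y) a := by
  obtain ⟨k, x, φ, rfl, h⟩ := ha
  intro q b
  obtain ⟨l, y, ψ, rfl⟩ := exists_tmk b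
  refine tmk_pair_cyl_mem x y φ ψ fun h1 h2 hp hq => ?_
  have hφ := (not_mem_cube_marked_iff k φ).2 h1
  obtain ⟨hx, h | h⟩ := h.resolve_left hφ
  · exact absurd h hφ
  · have : k - 1 < p := h
    exact ⟨by omega, Or.inl ⟨by omega, hx⟩⟩

lemma rightMarked_tComparison {q : ℕ} (b : (tMarked Y).toSSet _⦋q⦌) (hb : b ∈ (tMarked Y).marked q) :
    RightMarked (tComparison X Y) b := by
  obtain ⟨l, y, ψ, rfl, h⟩ := hb
  intro p a
  obtain ⟨k, x, φ, rfl⟩ := exists_tmk a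
  refine tmk_pair_cyl_mem x y φ ψ fun h1 h2 hp hq => ?_
  have hψ := (not_mem_cube_marked_iff l ψ).2 h2
  obtain ⟨hy, h | h⟩ := h.resolve_left hψ
  · exact absurd h hψ
  · have : l - 1 < q := h
    exact ⟨by omega, Or.inr ⟨by omega, hy⟩⟩

variable (X Y)

/-- The comparison map `T X ⊗ T Y ⟶ T (X ⊗ Y)`. -/
noncomputable def tMu : tObj X ⊗ tObj Y ⟶ tObj (X ⊗ Y) :=
  ObjectProperty.homMk ((isMediating_tComparison (X := X) (Y := Y)).grayLift
    (preReflection_isPreComplicial _) (fun _ => leftMarked_tComparison)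
    (fun _ => rightMarked_tComparison))

variable {X Y}

lemma ap_tMu {k l m : ℕ} (x : X.toCSet.cubes k) (y : Y.toCSet.cubes l)
    (φ : (cube.{u} k).simplices m) (ψ : (cube.{u} l).simplices m) :
    PreComp.ap (tMu X Y) (prodMk (X := tObj X) (Y := tObj Y) (tmk x φ) (tmk y ψ)) =
      tmk (CSet.tmul x y) (pair φ ψ) := rfl

end

end

/-! ### The inverse of the comparison map -/

section
open Simplicial

namespace PreComp

section parts

variable {k l m : ℕ}

/-- The first `k` coordinates of a simplex of `(Δ[1])^{⊗ (k + l)}`. -/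
noncomputable def fstPart (s : (cube.{u} (k + l)).simplices m) : (cube.{u} k).simplices m :=
  ofVert k (fun a e => vert (k + l) s a (Fin.castAdd l e)) fun _ _ h _ => vert_mono _ s h _

/-- The last `l` coordinates of a simplex of `(Δ[1])^{⊗ (k + l)}`. -/
noncomputable def sndPart (s : (cube.{u} (k + l)).simplices m) : (cube.{u} l).simplices m :=
  ofVert l (fun a e => vert (k + l) s a (Fin.natAdd k e)) fun _ _ h _ => vert_mono _ s h _

lemma vert_fstPart (s : (cube.{u} (k + l)).simplices m) (a : Fin (m + 1)) :
    vert k (fstPart s) a = fun e => vert (k + l) s a (Fin.castAdd l e) :=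
  congrFun (vert_ofVert k _ _) a

lemma vert_sndPart (s : (cube.{u} (k + l)).simplices m) (a : Fin (m + 1)) :
    vert l (sndPart s) a = fun e => vert (k + l) s a (Fin.natAdd k e) :=
  congrFun (vert_ofVert l _ _) a

lemma append_vert_parts (s : (cube.{u} (k + l)).simplices m) (a : Fin (m + 1)) :
    Fin.append (vert k (fstPart s) a) (vert l (sndPart s) a) = vert (k + l) s a := by
  rw [vert_fstPart, vert_sndPart]
  exact Fin.append_castAdd_natAdd

lemma pair_parts (s : (cube.{u} (k + l)).simplices m) : pair (fstPart s) (sndPart s) = s :=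
  vert_injective _ fun a => by rw [vert_pair, append_vert_parts]

lemma fstPart_pair (φ : (cube.{u} k).simplices m) (ψ : (cube.{u} l).simplices m) :
    fstPart (pair φ ψ) = φ :=
  vert_injective _ fun a => by
    rw [vert_fstPart, vert_pair]
    simp only [Fin.append_left]

lemma sndPart_pair (φ : (cube.{u} k).simplices m) (ψ : (cube.{u} l).simplices m) :
    sndPart (pair φ ψ) = ψ :=
  vert_injective _ fun a => by
    rw [vert_sndPart, vert_pair]
    simp only [Fin.append_right]

lemma fstPart_act {m' : ℕ} (g : ⦋m'⦌ ⟶ ⦋m⦌) (s : (cube.{u} (k + l)).simplices m) :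
    fstPart ((cube (k + l)).act g s) = (cube k).act g (fstPart s) := by
  conv_lhs => rw [← pair_parts s, act_pair, fstPart_pair]

lemma sndPart_act {m' : ℕ} (g : ⦋m'⦌ ⟶ ⦋m⦌) (s : (cube.{u} (k + l)).simplices m) :
    sndPart ((cube (k + l)).act g s) = (cube l).act g (sndPart s) := by
  conv_lhs => rw [← pair_parts s, act_pair, sndPart_pair]

variable (k l)

/-- The comparison map `(Δ[1])^{⊗ (k + l)} ⟶ (Δ[1])^{⊗ k} ⊗ (Δ[1])^{⊗ l}`. -/
noncomputable def cubeSplit : cube.{u} (k + l) ⟶ cube k ⊗ cube l :=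
  ObjectProperty.homMk
    { map :=
        { app := fun Δ => TypeCat.ofHom fun s =>
            (fstPart (m := Δ.unop.len) s, sndPart (m := Δ.unop.len) s)
          naturality := fun Δ Δ' g => by
            ext s
            exact Prod.ext (fstPart_act (m := Δ.unop.len) (m' := Δ'.unop.len) g.unop s)
              (sndPart_act (m := Δ.unop.len) (m' := Δ'.unop.len) g.unop s) }
      -- Were both parts unmarked for some cut, their chains would concatenate to a chain of `s`.
      map_marked := fun m s hs p q h => by
        by_contra hcon
        rw [not_or] at hcon
        refine (not_mem_cube_marked_iff _ _).2 ?_ hs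
        have h1 := (not_mem_cube_marked_iff k ((cube.{u} k).act (front h) (fstPart s))).1 hcon.1
        have h2 := (not_mem_cube_marked_iff l ((cube.{u} l).act (back h) (sndPart s))).1 hcon.2
        have h3 := hasChain_append h (v := vert k (fstPart s)) (w := vert l (sndPart s))
          (by convert h1 using 2 with a; exact (vert_act _ _ _ _).symm)
          (by convert h2 using 2 with a; exact (vert_act _ _ _ _).symm)
        convert h3 using 2 with a
        exact (append_vert_parts s a).symm }

end parts

lemma ap_cubeMap_castIso_assoc {k l n m : ℕ} (φ : (cube.{u} k).simplices m)
    (ψ : (cube.{u} l).simplices m) (χ : (cube.{u} n).simplices m) :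
    ap (cubeMap (Box.castIso (Nat.add_assoc k l n)).hom) (pair (pair φ ψ) χ) =
      (pair φ (pair ψ χ) : (cube.{u} (k + (l + n))).simplices m) :=
  vert_injective (k + (l + n)) fun a => by
    refine (vert_cubeMap (Box.castIso (Nat.add_assoc k l n)).hom _ a).trans ?_
    rw [vert_pair, vert_pair, vert_pair, vert_pair, Fin.append_assoc]
    rfl

lemma ap_cubeMap_castIso_zero_left {k m : ℕ} (u : (cube.{u} 0).simplices m)
    (φ : (cube.{u} k).simplices m) :
    ap (cubeMap (Box.castIso (Nat.zero_add k)).hom) (pair u φ) = φ :=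
  vert_injective k fun a => by
    refine (vert_cubeMap (Box.castIso (Nat.zero_add k)).hom _ a).trans ?_
    rw [vert_pair]
    funext e
    have : Fin.cast (Nat.zero_add k).symm e = Fin.natAdd 0 e := by ext; simp
    exact (congrArg (Fin.append (vert 0 u a) (vert k φ a)) this).trans (Fin.append_right _ _ e)

lemma ap_cubeMap_castIso_zero_right {k m : ℕ} (u : (cube.{u} 0).simplices m)
    (φ : (cube.{u} k).simplices m) :
    ap (cubeMap (Box.castIso (Nat.add_zero k)).hom) (pair φ u) = φ :=
  vert_injective k fun a => by
    refine (vert_cubeMap (Box.castIso (Nat.add_zero k)).hom _ a).trans ?_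
    rw [vert_pair]
    funext e
    exact Fin.append_left _ _ e

end PreComp

section

variable {X Y : MarkedCSet.{u}}

/-- The map `(Δ[1])^{⊗ (k + l)} ⟶ T X ⊗ T Y` given by two cubes. -/
noncomputable def cellPair {k l : ℕ} (x : X.toCSet.cubes k) (y : Y.toCSet.cubes l) :
    cube.{u} (k + l) ⟶ tObj X ⊗ tObj Y :=
  cubeSplit k l ≫ (cell x ⊗ₘ cell y)

lemma ap_cellPair {k l m : ℕ} (x : X.toCSet.cubes k) (y : Y.toCSet.cubes l)
    (s : (cube.{u} (k + l)).simplices m) :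
    PreComp.ap (cellPair x y) s = prodMk (X := tObj X) (Y := tObj Y) (tmk x (fstPart s)) (tmk y (sndPart s)) :=
  rfl

/-- The naturality with which the universal property of the Day convolution yields `toSingTensor`.
-/
lemma cellPair_act {k l k' l' : ℕ} (f : (⟨k'⟩ : Box) ⟶ ⟨k⟩) (g : (⟨l'⟩ : Box) ⟶ ⟨l⟩)
    (x : X.toCSet.cubes k) (y : Y.toCSet.cubes l) :
    cellPair (X.toCSet.act f x) (Y.toCSet.act g y) = cubeMap (Box.par f g) ≫ cellPair x y :=
  PreComp.hom_ext fun m s => by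
    have h : PreComp.ap (cubeMap (Box.par f g)) s =
        (pair (ap (cubeMap f) (fstPart (k := k') (l := l') s)) (ap (cubeMap g) (sndPart (k := k') (l := l') s)) :
          (cube.{u} (k + l)).simplices m) := by
      refine Eq.trans ?_ (ap_cubeMap_pair f g _ _)
      rw [pair_parts]
    refine Eq.trans ?_ (congrArg (PreComp.ap (cellPair x y)) h).symm
    rw [ap_cellPair, ap_cellPair, tmk_act, tmk_act, fstPart_pair, sndPart_pair]

/-- In a simplex of dimension at least `k + l`, every cut `p + q` has `p > k`, or `q > l`, or `p =
k` and `q = l`. In the first two cases one part exceeds the dimension of its cube and is marked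
there. -/
lemma cellPair_mem_marked {k l : ℕ} (x : X.toCSet.cubes k) (y : Y.toCSet.cubes l)
    (h : x ∈ X.marked k ∨ y ∈ Y.marked l) : cellPair x y ∈ (tObj X ⊗ tObj Y).sing.marked (k + l) := by
  have hk : x ∈ X.marked k → k ≠ 0 := by
    rintro h rfl
    exact X.not_marked_zero x h
  have hl : y ∈ Y.marked l → l ≠ 0 := by
    rintro h rfl
    exact Y.not_marked_zero y h
  have hkl : k + l ≠ 0 := by
    rcases h with h | h
    · exact fun h' => hk h (by omega)
    · exact fun h' => hl h (by omega)
  refine ⟨hkl, ⟨(cellPair x y).hom.map, fun m s hs => ?_⟩, rfl⟩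
  rcases hs with hs | hs
  · exact (cellPair x y).hom.map_marked m s hs
  · intro p q hpq
    change tmk x ((cube k).act (front hpq) (fstPart s)) ∈ (preReflection (tMarked X)).marked p ∨
      tmk y ((cube l).act (back hpq) (sndPart s)) ∈ (preReflection (tMarked Y)).marked q
    by_cases hp : k < p
    · exact Or.inl (marked_le_preReflection _ _ ⟨k, x, _, rfl, Or.inl (mem_cube_marked_of_lt hp _)⟩)
    by_cases hq : l < q
    · exact Or.inr (marked_le_preReflection _ _ ⟨l, y, _, rfl, Or.inl (mem_cube_marked_of_lt hq _)⟩)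
    -- Here `p = k` and `q = l`, so the part belonging to the marked cube has the dimension of that
    -- cube and is marked with it.
    exact h.imp
      (fun h => marked_le_preReflection _ _ ⟨k, x, _, rfl, Or.inr ⟨h, Or.inr (by have := hk h; omega)⟩⟩)
      (fun h => marked_le_preReflection _ _ ⟨l, y, _, rfl, Or.inr ⟨h, Or.inr (by have := hl h; omega)⟩⟩)

variable (X Y)

/-- The cubical map `X ⊗ Y ⟶ U (T X ⊗ T Y)` sending `x ⊗ y` to the pair of the cells of `x` and `y`. -/
noncomputable def toSingTensor : X.toCSet ⊗ Y.toCSet ⟶ (tObj X ⊗ tObj Y).singCSet :=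
  tensorDesc
    { app := fun p => TypeCat.ofHom fun z =>
        cellPair (k := p.1.unop.dim) (l := p.2.unop.dim) (X := X) (Y := Y) z.1 z.2
      naturality := fun p p' g => by
        ext z
        exact cellPair_act (k := p.1.unop.dim) (l := p.2.unop.dim) (k' := p'.1.unop.dim)
          (l' := p'.2.unop.dim) g.1.unop g.2.unop z.1 z.2 }

variable {X Y}

lemma ap_toSingTensor {k l : ℕ} (x : X.toCSet.cubes k) (y : Y.toCSet.cubes l) :
    CSet.ap (toSingTensor X Y) (CSet.tmul x y) = cellPair x y := by
  let p : (externalProductBifunctor _ _ _ |>.obj (X.toCSet.functor, Y.toCSet.functor)).obj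
    (op (⟨k⟩ : Box), op (⟨l⟩ : Box)) := (⟨x, y⟩ : X.toCSet.cubes k × Y.toCSet.cubes l)
  exact ConcreteCategory.congr_hom (η_comp_tensorDesc_app
    (F := X.toCSet) (G := Y.toCSet) (H := (tObj X ⊗ tObj Y).singCSet) _ (op ⟨k⟩) (op ⟨l⟩)) p

variable (X Y)

/-- The transpose of the inverse of the comparison map. -/
noncomputable def toSingTensorMarked : X ⊗ Y ⟶ (tObj X ⊗ tObj Y).sing where
  map := toSingTensor X Y
  map_marked n c hc := by
    cases hc with
    | degenerate _ hc => exact (tObj X ⊗ tObj Y).sing.degenerate_le _ (CSet.ap_mem_degenerate _ hc)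
    | left x y hx =>
      exact MarkedCSet.mem_of_eq (tObj X ⊗ tObj Y).sing (ap_toSingTensor x y)
        (cellPair_mem_marked x y (Or.inl hx))
    | right x y hy =>
      exact MarkedCSet.mem_of_eq (tObj X ⊗ tObj Y).sing (ap_toSingTensor x y)
        (cellPair_mem_marked x y (Or.inr hy))

/-- The inverse of the comparison map. -/
noncomputable def tDelta : tObj (X ⊗ Y) ⟶ tObj X ⊗ tObj Y := untranspose (toSingTensorMarked X Y)

variable {X Y}

lemma ap_tDelta {k l m : ℕ} (x : X.toCSet.cubes k) (y : Y.toCSet.cubes l)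
    (s : (cube.{u} (k + l)).simplices m) :
    PreComp.ap (X := tObj (X ⊗ Y)) (tDelta X Y) (tmk (CSet.tmul x y) s) =
      prodMk (X := tObj X) (Y := tObj Y) (tmk x (fstPart s)) (tmk y (sndPart s)) :=
  congrArg (fun h : cube (k + l) ⟶ tObj X ⊗ tObj Y => PreComp.ap h s) (ap_toSingTensor x y)

/-- A cube of `X ⊗ Y` is a restriction of some `x ⊗ y` along a map of the box category; the coend
relation moves this map to the simplex, which then splits into its two blocks. -/
lemma exists_tmk_tmul {X Y : CSet.{u}} {m : ℕ} (z : (tSSet (X ⊗ Y)).obj (op (.mk m))) :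
    ∃ (k l : ℕ) (x : X.cubes k) (y : Y.cubes l) (φ : (cube.{u} k).simplices m)
      (ψ : (cube.{u} l).simplices m), tmk (CSet.tmul x y) (pair φ ψ) = z := by
  obtain ⟨n, c, s, rfl⟩ := exists_tmk z
  obtain ⟨k, l, f, x, y, rfl⟩ := CSet.exists_act_tmul c
  refine ⟨k, l, x, y, fstPart (ap (cubeMap f) s), sndPart (ap (cubeMap f) s), ?_⟩
  rw [tmk_act, pair_parts]

variable (X Y)

/-- The triangulation of a tensor product. -/
noncomputable def tMuIso : tObj X ⊗ tObj Y ≅ tObj (X ⊗ Y) where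
  hom := tMu X Y
  inv := tDelta X Y
  hom_inv_id := PreComp.hom_ext fun m z => by
    obtain ⟨a, b⟩ := z
    obtain ⟨k, x, φ, rfl⟩ := exists_tmk a
    obtain ⟨l, y, ψ, rfl⟩ := exists_tmk b
    refine (ap_tDelta x y (pair φ ψ)).trans ?_
    rw [fstPart_pair, sndPart_pair]
    rfl
  inv_hom_id := PreComp.hom_ext fun m z => by
    obtain ⟨k, l, x, y, φ, ψ, rfl⟩ := exists_tmk_tmul z
    refine (congrArg (PreComp.ap (tMu X Y)) (ap_tDelta x y (pair φ ψ))).trans ?_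
    rw [fstPart_pair, sndPart_pair]
    rfl

/-- The triangulation of the unit. -/
noncomputable def tEpsIso : 𝟙_ PreComp.{u} ≅ tObj (𝟙_ MarkedCSet.{u}) where
  hom := cell (X := 𝟙_ MarkedCSet.{u}) (n := 0) CSet.one
  inv := ObjectProperty.homMk
    { map := { app := fun Δ => TypeCat.ofHom fun _ => PUnit.unit }
      map_marked := fun m z hz => by
        cases m with
        | zero => exact absurd hz ((preReflection (tMarked (𝟙_ MarkedCSet.{u}))).not_marked_zero z)
        | succ m => exact point_marked _ }
  hom_inv_id := PreComp.hom_ext fun _ _ => rfl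
  -- Every cube of the unit is a restriction of its `0`-cube. Moving the restriction to the simplex
  -- leaves a simplex of the `0`-cube, which is unique in each dimension.
  inv_hom_id := tObj_hom_ext fun n m c φ => by
    obtain ⟨f, rfl⟩ := CSet.exists_one c
    exact (tmk_act (X := 𝟙_ CSet.{u}) f CSet.one φ).symm

/-! ### Naturality and coherence of the comparison -/

section coherence

variable {X X' Y Y' Z : MarkedCSet.{u}}

lemma tMu_naturality (f : X ⟶ X') (g : Y ⟶ Y') :
    (triangulation.map f ⊗ₘ triangulation.map g) ≫ tMu X' Y' =
      tMu X Y ≫ triangulation.map (f ⊗ₘ g) :=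
  PreComp.hom_ext fun m z => by
    obtain ⟨a, b⟩ := z
    obtain ⟨k, x, φ, rfl⟩ := exists_tmk a
    obtain ⟨l, y, ψ, rfl⟩ := exists_tmk b
    exact congrArg (fun c => tmk (X := X'.toCSet ⊗ Y'.toCSet) c (pair φ ψ))
      (CSet.ap_tmul f.map g.map x y).symm

/-- The associator of the geometric product introduces the reindexing `(k + l) + n = k + (l + n)`.
The coend relation moves it to the simplices, where it is the associativity of concatenating
coordinates. The unit conditions hold in the same way. -/
lemma tMu_associativity :
    tMu X Y ▷ tObj Z ≫ tMu (X ⊗ Y) Z ≫ triangulation.map (α_ X Y Z).hom =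
      (α_ (tObj X) (tObj Y) (tObj Z)).hom ≫ tObj X ◁ tMu Y Z ≫ tMu X (Y ⊗ Z) :=
  PreComp.hom_ext fun m z => by
    obtain ⟨⟨a, b⟩, c⟩ := z
    obtain ⟨k, x, φ, rfl⟩ := exists_tmk a
    obtain ⟨l, y, ψ, rfl⟩ := exists_tmk b
    obtain ⟨n, z, χ, rfl⟩ := exists_tmk c
    refine (congrArg (fun c => tmk (X := X.toCSet ⊗ Y.toCSet ⊗ Z.toCSet) c (pair (pair φ ψ) χ))
      (CSet.associator_tmul x y z)).trans ?_
    refine (tmk_act _ _ _).trans ?_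
    exact congrArg (tmk _) (ap_cubeMap_castIso_assoc φ ψ χ)

lemma tMu_left_unitality :
    (λ_ (tObj X)).hom = tEpsIso.hom ▷ tObj X ≫ tMu (𝟙_ MarkedCSet.{u}) X ≫
      triangulation.map (λ_ X).hom :=
  PreComp.hom_ext fun m z => by
    obtain ⟨a, b⟩ := z
    obtain ⟨k, x, φ, rfl⟩ := exists_tmk b
    refine Eq.symm ((congrArg (fun c => tmk (X := X.toCSet) c (pair (k := 0) a φ))
      (CSet.leftUnitor_tmul x)).trans ?_)
    refine (tmk_act _ _ _).trans ?_
    exact congrArg (tmk _) (ap_cubeMap_castIso_zero_left a φ)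

lemma tMu_right_unitality :
    (ρ_ (tObj X)).hom = tObj X ◁ tEpsIso.hom ≫ tMu X (𝟙_ MarkedCSet.{u}) ≫
      triangulation.map (ρ_ X).hom :=
  PreComp.hom_ext fun m z => by
    obtain ⟨b, a⟩ := z
    obtain ⟨k, x, φ, rfl⟩ := exists_tmk b
    refine Eq.symm ((congrArg (fun c => tmk (X := X.toCSet) c (pair (l := 0) φ a))
      (CSet.rightUnitor_tmul x)).trans ?_)
    refine (tmk_act _ _ _).trans ?_
    exact congrArg (tmk _) (ap_cubeMap_castIso_zero_right a φ)

end coherence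

/-- The triangulation is strong monoidal. -/
noncomputable def triangulationCoreMonoidal : triangulation.{u}.CoreMonoidal where
  εIso := tEpsIso
  μIso X Y := tMuIso X Y
  μIso_hom_natural_left f Y := by
    have := tMu_naturality f (𝟙 Y)
    rw [triangulation.map_id, tensorHom_id, tensorHom_id] at this
    exact this
  μIso_hom_natural_right X g := by
    have := tMu_naturality (𝟙 X) g
    rw [triangulation.map_id, id_tensorHom, id_tensorHom] at this
    exact this
  associativity _ _ _ := tMu_associativity
  left_unitality _ := tMu_left_unitality
  right_unitality _ := tMu_right_unitality

end

end

/-! ### The monoidal adjunction -/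

theorem mainTheorem4 :
    ∃ (_ : triangulation.{u}.Monoidal) (_ : cubicalNerve.{u}.LaxMonoidal),
      triangulationAdj.{u}.IsMonoidal ∧
      ∀ (X Y : MarkedCSet.{u}) (k l m : ℕ) (x : X.toCSet.cubes k) (y : Y.toCSet.cubes l)
        (φ : (PreComp.cube.{u} k).simplices m) (ψ : (PreComp.cube.{u} l).simplices m),
        PreComp.ap (Functor.LaxMonoidal.μ triangulation X Y) (prodMk (tSimplex x φ) (tSimplex y ψ)) =
          tSimplex (X := X ⊗ Y) (CSet.tmul x y) (pair φ ψ) := by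
  let : triangulation.{u}.Monoidal := triangulationCoreMonoidal.toMonoidal
  let : cubicalNerve.{u}.LaxMonoidal := triangulationAdj.rightAdjointLaxMonoidal
  -- The lax structure on the nerve is by construction the one transposed from the triangulation, so
  -- compatibility with the adjunction is definitional.
  exact ⟨inferInstance, inferInstance, ⟨rfl, fun _ _ => rfl⟩, fun X Y k l m x y φ ψ => ap_tMu x y φ ψ⟩
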